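/- **Setting.** Let $\Omega\subset\mathbb R^3$ be a bounded domain with smooth boundary $\Gamma=\partial\Omega$, outward unit normal $\nu$ and surface measure $ds$. Let $\lambda,\mu,\nu_p,\nu_u,B,\rho_s,\rho_f,C,\phi,\kappa,\omega$ be real parameters with $\mu>0$, $3\lambda+2\mu>0$, such that no denominator below vanishes, and put $$\rho_a=C\phi\rho_f,\quad \rho=(1-\phi)\rho_s+\phi\rho_f,\quad \alpha=\frac{3(\nu_u-\nu_p)}{B(1-2\nu_p)(1+\nu_u)},\quad R=\frac{2\phi^2\mu B^2(1-2\nu_p)(1+\nu_u)^2}{9(\nu_u-\nu_p)(1-2\nu_u)},$$ $$\beta=\frac{\omega\phi^2\rho_f\kappa}{i\phi^2+\omega\kappa(\rho_a+\phi\rho_f)},\quad q=\frac{\omega^2\phi^2\rho_f}{\beta R},\quad \gamma=-\frac{i\omega\rho_f(\alpha-\beta)}{\beta},\quad \epsilon=\frac{i\omega\gamma(\alpha-\beta)}{q(\lambda+2\mu)},$$ $$k_p=\omega\sqrt{\frac{\rho-\beta\rho_f}{\lambda+2\mu}},\qquad k_s=\omega\sqrt{\frac{\rho-\beta\rho_f}{\mu}}$$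 (principal square roots). Let $k_1,k_2\in\mathbb C$ satisfy $k_1^2+k_2^2=q(1+\epsilon)+k_p^2$, $k_1^2k_2^2=qk_p^2$, $\operatorname{Im}k_1,\operatorname{Im}k_2\ge0$ and $k_1^2\ne k_2^2$. For $x\neq y$ let $\gamma_k(x,y)=\dfrac{e^{ik|x-y|}}{4\pi|x-y|}$, and let $E(x,y)=\begin{bmatrix}E_{11}&E_{12}\\E_{21}^\top&E_{22}\end{bmatrix}$, where $$E_{11}=\frac1\mu\gamma_{k_s}I+\frac1{(\rho-\beta\rho_f)\omega^2}\nabla_x\nabla_x^\top\Big(\gamma_{k_s}-\frac{k_p^2-k_2^2}{k_1^2-k_2^2}\gamma_{k_1}+\frac{k_p^2-k_1^2}{k_1^2-k_2^2}\gamma_{k_2}\Big),$$ $$E_{12}=\frac{i\omega\gamma}{(\lambda+2\mu)(k_1^2-k_2^2)}\nabla_x(\gamma_{k_1}-\gamma_{k_2}),\qquad E_{21}=-\frac{\alpha-\beta}{(\lambda+2\mu)(k_1^2-k_2^2)}\nabla_x(\gamma_{k_1}-\gamma_{k_2}),$$ $$E_{22}=-\frac1{k_1^2-k_2^2}\big[(k_p^2-k_1^2)\gamma_{k_1}-(k_p^2-k_2^2)\gamma_{k_2}\big].$$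 With $T(\partial,\nu)u=2\mu\,\partial_\nu u+\lambda\,\nu\,\nabla\cdot u+\mu\,\nu\times(\nabla\times u)$ let $$\widetilde T(\partial,\nu)=\begin{bmatrix}T(\partial,\nu)&-\alpha\nu\\-\rho_f\omega^2\nu^\top&\partial_\nu\end{bmatrix},\qquad \widetilde T^*(\partial,\nu)=\begin{bmatrix}T(\partial,\nu)&-\frac{\rho_f\omega^2\alpha}{\beta}\nu\\-\beta\nu^\top&\partial_\nu\end{bmatrix},$$ acting on matrix-valued functions column by column. The hyper-singular operator is the Hadamard finite part integral $$N(\psi)(x)=\mathrm{f.p.}\!\int_\Gamma \widetilde T(\partial_x,\nu_x)\big(\widetilde T^*(\partial_y,\nu_y)E(x,y)\big)^\top\psi(y)\,ds_y,\qquad x\in\Gamma,$$ where $\mathrm{f.p.}\int_\Gamma f\,ds=l$ means that $\int_{\Gamma\setminus B_\varepsilon(x)}f\,ds=c/\varepsilon+l+o(1)$ as $\varepsilon\to0^+$ for some constant $c$. Write $N=\begin{bmatrix}N_1&N_2\\N_3&N_4\end{bmatrix}$ in accordance with $\psi=(u,p)$, so that $N_4$ maps a scalar density to a scalar function. Finally,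 let $\nabla^S=\nabla-\nu\partial_\nu$ be the surface gradient, and for a scalar field $p$ and a vector field $v$ on $\Gamma$ put $\tau_1p=\nu\times\nabla^Sp$ and $\tau_2v=(\nu\times\nabla^S)\cdot v$. **Theorem.** Let $0<a$ and let $p\in C^{1,a}(\Gamma)$, that is, $p$ is the restriction to $\Gamma$ of a complex valued $C^1$ function on $\mathbb R^3$ whose derivative is Hölder continuous with exponent $a$. Then $N_4(p)(x)$ exists for every $x\in\Gamma$, and $$N_4(p)=N_4^1(p)+\tau_2\,N_4^2\,\tau_1\,p\qquad\text{on }\Gamma,$$ where $$\begin{aligned}N_4^1(p)(x)=\;&\rho_f\omega^2\beta\int_\Gamma\nu_x^\top E_{11}(x,y)\nu_y\,p(y)\,ds_y\\&+\frac{i\omega\gamma\beta+\rho_f\omega^2(\alpha-\beta)}{(\lambda+2\mu)(k_1^2-k_2^2)}\int_\Gamma\big[k_1^2\gamma_{k_1}(x,y)-k_2^2\gamma_{k_2}(x,y)\big]\nu_x^\top\nu_y\,p(y)\,ds_y\\&-\frac1{k_1^2-k_2^2}\int_\Gamma\big[(k_p^2-k_1^2)k_1^2\gamma_{k_1}(x,y)-(k_p^2-k_2^2)k_2^2\gamma_{k_2}(x,y)\big]\nu_x^\top\nu_y\,p(y)\,ds_y,\end{aligned}$$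 and $N_4^2$ acts on vector fields $v$ componentwise by $$\begin{aligned}N_4^2(v)(x)=\;&\frac{\rho_f\omega^2(\alpha-\beta)+i\omega\beta\gamma}{(\lambda+2\mu)(k_1^2-k_2^2)}\int_\Gamma\big[\gamma_{k_1}(x,y)-\gamma_{k_2}(x,y)\big]v(y)\,ds_y\\&-\frac1{k_1^2-k_2^2}\int_\Gamma\big[(k_p^2-k_1^2)\gamma_{k_1}(x,y)-(k_p^2-k_2^2)\gamma_{k_2}(x,y)\big]v(y)\,ds_y.\end{aligned}$$ Each of these five integral operators is weakly singular: its kernel $K$ is continuous off the diagonal of $\Gamma\times\Gamma$ and satisfies $|K(x,y)|\le \mathrm{const}/|x-y|$ there. The integrals converge absolutely, and $p$ and $N_4^2\tau_1p$ are differentiable along $\Gamma$, so that all terms are well defined. -/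

import Mathlib

open scoped Matrix ContDiff MeasureTheory NNReal Topology

noncomputable section

namespace Poroelastic

open MeasureTheory Filter Set

/-- Euclidean three-space. -/
abbrev Vec3 : Type := EuclideanSpace ℝ (Fin 3)

/-- Indices of the four unknowns `(u₁, u₂, u₃, p)`. -/
abbrev Idx : Type := Fin 3 ⊕ Unit

/-! ### Bounded domains with smooth boundary -/

/-- `f` is a smooth defining function of `Ω` near `x`: locally `Ω = {f < 0}`, and `f` has a
non-zero differential at `x`. -/
structure IsDefiningFunctionAt (Ω : Set Vec3) (f : Vec3 → ℝ) (x : Vec3) : Prop where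
  smooth : ContDiff ℝ ∞ f
  gradient_ne : gradient f x ≠ 0
  eventually_mem_iff : ∀ᶠ y in 𝓝 x, (y ∈ Ω ↔ f y < 0)
  apply_eq : f x = 0

/-- A bounded domain in three-space with smooth boundary. -/
structure IsSmoothBoundedDomain (Ω : Set Vec3) : Prop where
  isOpen : IsOpen Ω
  isConnected : IsConnected Ω
  isBounded : Bornology.IsBounded Ω
  smoothBoundary : ∀ x ∈ frontier Ω, ∃ f, IsDefiningFunctionAt Ω f x

open Classical in
/-- The outward unit normal `ν(x) = ∇f(x) / |∇f(x)|`, `f` a defining function of `Ω` near the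
boundary point `x` (the choice of `f` does not matter, see
`IsDefiningFunctionAt.outwardNormal_eq`). -/
def outwardNormal (Ω : Set Vec3) (x : Vec3) : Vec3 :=
  if h : ∃ f, IsDefiningFunctionAt Ω f x then
    ‖gradient h.choose x‖⁻¹ • gradient h.choose x
  else 0

/-- The surface measure of `Γ`: two-dimensional Hausdorff measure, normalised so as to agree
with area, restricted to `Γ`. -/
def surfaceMeasure (Γ : Set Vec3) : Measure Vec3 := (μHE[2] : Measure Vec3).restrict Γ

/-- `p` is, on `Γ`, the trace of a `C¹` function whose derivative is Hölder continuous with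
exponent `a`, i.e. `p ∈ C^{1,a}(Γ)`; the values of `p` off `Γ` are irrelevant. -/
def IsC1Holder (a : ℝ≥0) (Γ : Set Vec3) (p : Vec3 → ℂ) : Prop :=
  ∃ P : Vec3 → ℂ, ContDiff ℝ 1 P ∧ (∃ C : ℝ≥0, HolderWith C a (fderiv ℝ P)) ∧ EqOn p P Γ

/-! ### Differential operators in space -/

/-- A real vector regarded as a complex one. -/
def cvec (n : Vec3) : Fin 3 → ℂ := fun i => (n i : ℂ)

/-- Derivative in the direction `n`, i.e. `n · ∇ f`. -/
def dirDeriv (n : Vec3) (f : Vec3 → ℂ) (x : Vec3) : ℂ := fderiv ℝ f x n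

/-- The partial derivative `∂ᵢ f`. -/
def partialD (i : Fin 3) (f : Vec3 → ℂ) (x : Vec3) : ℂ :=
  dirDeriv (EuclideanSpace.single i 1) f x

/-- The gradient of a complex valued function. -/
def grad (f : Vec3 → ℂ) (x : Vec3) : Fin 3 → ℂ := fun i => partialD i f x

/-- The Hessian `∇∇ᵀ f`. -/
def hess (f : Vec3 → ℂ) (x : Vec3) : Matrix (Fin 3) (Fin 3) ℂ :=
  Matrix.of fun i j => partialD i (fun z => partialD j f z) x

/-- The divergence. -/
def divergence (u : Vec3 → Fin 3 → ℂ) (x : Vec3) : ℂ := ∑ i, partialD i (fun z => u z i) x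

/-- The curl. -/
def curl (u : Vec3 → Fin 3 → ℂ) (x : Vec3) : Fin 3 → ℂ :=
  ![partialD 1 (fun z => u z 2) x - partialD 2 (fun z => u z 1) x,
    partialD 2 (fun z => u z 0) x - partialD 0 (fun z => u z 2) x,
    partialD 0 (fun z => u z 1) x - partialD 1 (fun z => u z 0) x]

/-! ### Tangential differential operators on a surface -/

/-- The surface gradient `∇ˢ p = ∇ p - ν ∂_ν p`. Its `i`-th component is the derivative of `p`
along `Γ` in the tangential direction `eᵢ - νᵢ ν`; only the values of `p` on `Γ` enter. -/
def surfaceGrad (Ω : Set Vec3) (p : Vec3 → ℂ) (x : Vec3) : Fin 3 → ℂ := fun i =>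
  fderivWithin ℝ p (frontier Ω) x
    (EuclideanSpace.single i 1 - outwardNormal Ω x i • outwardNormal Ω x)

/-- `τ₁ p = ν × ∇ˢ p`. -/
def tau1 (Ω : Set Vec3) (p : Vec3 → ℂ) (x : Vec3) : Fin 3 → ℂ :=
  cvec (outwardNormal Ω x) ⨯₃ surfaceGrad Ω p x

/-- `τ₂ v = (ν × ∇ˢ) · v`. -/
def tau2 (Ω : Set Vec3) (v : Vec3 → Fin 3 → ℂ) (x : Vec3) : ℂ :=
  ∑ i, tau1 Ω (fun y => v y i) x i

/-! ### Material parameters -/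

/-- Material parameters of a poroelastic medium, and the frequency. -/
structure Params where
  /-- First Lamé parameter. -/
  lam : ℝ
  /-- Second Lamé parameter. -/
  mu : ℝ
  /-- Poisson ratio. -/
  nuP : ℝ
  /-- Undrained Poisson ratio. -/
  nuU : ℝ
  /-- Skempton pore-pressure coefficient. -/
  B : ℝ
  /-- Solid density. -/
  rhoS : ℝ
  /-- Fluid density. -/
  rhoF : ℝ
  /-- The factor in the apparent mass density. -/
  C : ℝ
  /-- Porosity. -/
  phi : ℝ
  /-- Permeability coefficient. -/
  kappa : ℝ
  /-- Frequency. -/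
  omega : ℝ

namespace Params

variable (P : Params)

/-- Apparent mass density. -/
def rhoA : ℝ := P.C * P.phi * P.rhoF

/-- Bulk density. -/
def rho : ℝ := (1 - P.phi) * P.rhoS + P.phi * P.rhoF

/-- Compressibility `α`. -/
def alpha : ℝ := 3 * (P.nuU - P.nuP) / (P.B * (1 - 2 * P.nuP) * (1 + P.nuU))

/-- Constitutive coefficient `R`. -/
def R : ℝ :=
  2 * P.phi ^ 2 * P.mu * P.B ^ 2 * (1 - 2 * P.nuP) * (1 + P.nuU) ^ 2 /
    (9 * (P.nuU - P.nuP) * (1 - 2 * P.nuU))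

/-- `β = ω φ² ρ_f κ / (i φ² + ω κ (ρ_a + φ ρ_f))`. -/
def beta : ℂ :=
  P.omega * P.phi ^ 2 * P.rhoF * P.kappa /
    (Complex.I * P.phi ^ 2 + P.omega * P.kappa * (P.rhoA + P.phi * P.rhoF))

/-- `q = ω² φ² ρ_f / (β R)`. -/
def q : ℂ := P.omega ^ 2 * P.phi ^ 2 * P.rhoF / (P.beta * P.R)

/-- `γ = - i ω ρ_f (α - β) / β`. -/
def gam : ℂ := -(Complex.I * P.omega * P.rhoF * (P.alpha - P.beta) / P.beta)

/-- Compressional wave number (principal square root). -/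
def kp : ℂ := P.omega * ((P.rho - P.beta * P.rhoF) / (P.lam + 2 * P.mu)) ^ (1 / 2 : ℂ)

/-- Shear wave number (principal square root). -/
def ks : ℂ := P.omega * ((P.rho - P.beta * P.rhoF) / P.mu) ^ (1 / 2 : ℂ)

/-- `ε = i ω γ (α - β) / (q (λ + 2 μ))`. -/
def eps : ℂ :=
  Complex.I * P.omega * P.gam * (P.alpha - P.beta) / (P.q * (P.lam + 2 * P.mu))

/-- `k₁` and `k₂` are the wave numbers of the fast and the slow compressional wave. -/
structure IsWaveNumbers (k₁ k₂ : ℂ) : Prop where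
  sum_sq : k₁ ^ 2 + k₂ ^ 2 = P.q * (1 + P.eps) + P.kp ^ 2
  prod_sq : k₁ ^ 2 * k₂ ^ 2 = P.q * P.kp ^ 2
  im_fst : 0 ≤ k₁.im
  im_snd : 0 ≤ k₂.im

end Params

/-! ### The fundamental solution and the boundary operators -/

/-- The Helmholtz fundamental solution `exp(i k |x - y|) / (4 π |x - y|)`. -/
def helmholtz (k : ℂ) (x y : Vec3) : ℂ :=
  Complex.exp (Complex.I * k * (‖x - y‖ : ℝ)) / (4 * Real.pi * (‖x - y‖ : ℝ))

section FundamentalSolution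

variable (P : Params) (k₁ k₂ : ℂ)

/-- The `3 × 3` block `E₁₁`. -/
def E11 (x y : Vec3) : Matrix (Fin 3) (Fin 3) ℂ :=
  ((1 / P.mu : ℂ) * helmholtz P.ks x y) • (1 : Matrix (Fin 3) (Fin 3) ℂ) +
    (1 / ((P.rho - P.beta * P.rhoF) * P.omega ^ 2)) •
      hess (fun z => helmholtz P.ks z y
        - (P.kp ^ 2 - k₂ ^ 2) / (k₁ ^ 2 - k₂ ^ 2) * helmholtz k₁ z y
        + (P.kp ^ 2 - k₁ ^ 2) / (k₁ ^ 2 - k₂ ^ 2) * helmholtz k₂ z y) x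

/-- The column `E₁₂`. -/
def E12 (x y : Vec3) : Fin 3 → ℂ :=
  (Complex.I * P.omega * P.gam / ((P.lam + 2 * P.mu) * (k₁ ^ 2 - k₂ ^ 2))) •
    grad (fun z => helmholtz k₁ z y - helmholtz k₂ z y) x

/-- The column `E₂₁` (its transpose is the lower left block). -/
def E21 (x y : Vec3) : Fin 3 → ℂ :=
  (-((P.alpha - P.beta) / ((P.lam + 2 * P.mu) * (k₁ ^ 2 - k₂ ^ 2)))) •
    grad (fun z => helmholtz k₁ z y - helmholtz k₂ z y) x

/-- The scalar block `E₂₂`. -/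
def E22 (x y : Vec3) : ℂ :=
  -(1 / (k₁ ^ 2 - k₂ ^ 2)) *
    ((P.kp ^ 2 - k₁ ^ 2) * helmholtz k₁ x y - (P.kp ^ 2 - k₂ ^ 2) * helmholtz k₂ x y)

/-- The `4 × 4` fundamental solution `E`. -/
def E (x y : Vec3) : Matrix Idx Idx ℂ :=
  Matrix.fromBlocks (E11 P k₁ k₂ x y) (Matrix.of fun i _ => E12 P k₁ k₂ x y i)
    (Matrix.of fun _ j => E21 P k₁ k₂ x y j) (Matrix.of fun _ _ => E22 P k₁ k₂ x y)

/-- The traction `T(∂, n) u = 2 μ ∂ₙ u + λ n (∇ · u) + μ n × (∇ × u)`. -/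
def traction (n : Vec3) (u : Vec3 → Fin 3 → ℂ) (x : Vec3) : Fin 3 → ℂ := fun i =>
  2 * P.mu * dirDeriv n (fun z => u z i) x + P.lam * n i * divergence u x
    + P.mu * (cvec n ⨯₃ curl u x) i

/-- The boundary operator `T̃(∂, n)` on fields `U = (u, p)`. -/
def bdryOp (n : Vec3) (U : Vec3 → Idx → ℂ) (x : Vec3) : Idx → ℂ :=
  Sum.elim
    (fun i => traction P n (fun z j => U z (Sum.inl j)) x i
      - P.alpha * n i * U x (Sum.inr ()))
    (fun _ => -(P.rhoF * P.omega ^ 2 * ∑ i, (n i : ℂ) * U x (Sum.inl i))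
      + dirDeriv n (fun z => U z (Sum.inr ())) x)

/-- The adjoint boundary operator `T̃*(∂, n)` on fields `V = (v, θ)`. -/
def bdryOpAdj (n : Vec3) (V : Vec3 → Idx → ℂ) (x : Vec3) : Idx → ℂ :=
  Sum.elim
    (fun i => traction P n (fun z j => V z (Sum.inl j)) x i
      - P.rhoF * P.omega ^ 2 * P.alpha / P.beta * n i * V x (Sum.inr ()))
    (fun _ => -(P.beta * ∑ i, (n i : ℂ) * V x (Sum.inl i))
      + dirDeriv n (fun z => V z (Sum.inr ())) x)

/-- An operator on fields, applied to each column of a matrix valued function. -/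
def onColumns (D : (Vec3 → Idx → ℂ) → Vec3 → Idx → ℂ) (A : Vec3 → Matrix Idx Idx ℂ)
    (x : Vec3) : Matrix Idx Idx ℂ :=
  Matrix.of fun i j => D (fun z k => A z k j) x i

/-- The kernel `(T̃*(∂_y, ν_y) E(x, y))ᵀ` of the double-layer potential. -/
def doubleLayerKernel (Ω : Set Vec3) (x y : Vec3) : Matrix Idx Idx ℂ :=
  (onColumns (bdryOpAdj P (outwardNormal Ω y)) (fun w => E P k₁ k₂ x w) y)ᵀ

/-- The kernel `T̃(∂_x, ν_x) (T̃*(∂_y, ν_y) E(x, y))ᵀ` of the hyper-singular operator. -/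
def hyperKernel (Ω : Set Vec3) (x y : Vec3) : Matrix Idx Idx ℂ :=
  onColumns (bdryOp P (outwardNormal Ω x)) (fun z => doubleLayerKernel P k₁ k₂ Ω z y) x

end FundamentalSolution

/-! ### Finite part integrals and the hyper-singular operator -/

/-- `l` is the Hadamard finite part at `x` of the integral of `f` over the surface `Γ`: the
integral over the part of `Γ` outside the ball of radius `ε` about `x` equals
`c / ε + l + o(1)` as `ε → 0`, with some constant `c`. -/
def IsFinitePart (Γ : Set Vec3) (x : Vec3) (f : Vec3 → ℂ) (l : ℂ) : Prop :=
  (∀ ε : ℝ, 0 < ε → IntegrableOn f (Metric.ball x ε)ᶜ (surfaceMeasure Γ)) ∧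
    ∃ c : ℂ, Tendsto
      (fun ε : ℝ => (∫ y in (Metric.ball x ε)ᶜ, f y ∂surfaceMeasure Γ) - c / (ε : ℂ))
      (𝓝[>] 0) (𝓝 l)

open Classical in
/-- The Hadamard finite part of an integral over `Γ` (`0` if there is none). -/
def finitePart (Γ : Set Vec3) (x : Vec3) (f : Vec3 → ℂ) : ℂ :=
  if h : ∃ l, IsFinitePart Γ x f l then h.choose else 0

section Operators

variable (P : Params) (k₁ k₂ : ℂ) (Ω : Set Vec3)

/-- The hyper-singular boundary integral operator `N`, as a finite part integral. -/
def hyperOp (ψ : Vec3 → Idx → ℂ) (x : Vec3) : Idx → ℂ := fun i =>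
  finitePart (frontier Ω) x fun y => (hyperKernel P k₁ k₂ Ω x y *ᵥ ψ y) i

/-- The field `(0, p)`. -/
def pressureField (p : Vec3 → ℂ) (y : Vec3) : Idx → ℂ := Sum.elim 0 fun _ => p y

/-- The block `N₄` of the hyper-singular operator, from pressures to pressures. -/
def N4 (p : Vec3 → ℂ) (x : Vec3) : ℂ := hyperOp P k₁ k₂ Ω (pressureField p) x (Sum.inr ())

/-- The kernel `ρ_f ω² β ν_xᵀ E₁₁ ν_y`. -/
def kernel41a (x y : Vec3) : ℂ :=
  P.rhoF * P.omega ^ 2 * P.beta *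
    (cvec (outwardNormal Ω x) ⬝ᵥ (E11 P k₁ k₂ x y *ᵥ cvec (outwardNormal Ω y)))

/-- The second kernel of `N₄¹`. -/
def kernel41b (x y : Vec3) : ℂ :=
  (Complex.I * P.omega * P.gam * P.beta + P.rhoF * P.omega ^ 2 * (P.alpha - P.beta)) /
      ((P.lam + 2 * P.mu) * (k₁ ^ 2 - k₂ ^ 2)) *
    (k₁ ^ 2 * helmholtz k₁ x y - k₂ ^ 2 * helmholtz k₂ x y) *
    (cvec (outwardNormal Ω x) ⬝ᵥ cvec (outwardNormal Ω y))

/-- The third kernel of `N₄¹`. -/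
def kernel41c (x y : Vec3) : ℂ :=
  -(1 / (k₁ ^ 2 - k₂ ^ 2)) *
    ((P.kp ^ 2 - k₁ ^ 2) * k₁ ^ 2 * helmholtz k₁ x y
      - (P.kp ^ 2 - k₂ ^ 2) * k₂ ^ 2 * helmholtz k₂ x y) *
    (cvec (outwardNormal Ω x) ⬝ᵥ cvec (outwardNormal Ω y))

/-- The first kernel of `N₄²`. -/
def kernel42a (x y : Vec3) : ℂ :=
  (P.rhoF * P.omega ^ 2 * (P.alpha - P.beta) + Complex.I * P.omega * P.beta * P.gam) /
      ((P.lam + 2 * P.mu) * (k₁ ^ 2 - k₂ ^ 2)) *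
    (helmholtz k₁ x y - helmholtz k₂ x y)

/-- The second kernel of `N₄²`. -/
def kernel42b (x y : Vec3) : ℂ :=
  -(1 / (k₁ ^ 2 - k₂ ^ 2)) *
    ((P.kp ^ 2 - k₁ ^ 2) * helmholtz k₁ x y - (P.kp ^ 2 - k₂ ^ 2) * helmholtz k₂ x y)

/-- The operator `N₄¹`. -/
def N41 (p : Vec3 → ℂ) (x : Vec3) : ℂ :=
  (∫ y, kernel41a P k₁ k₂ Ω x y * p y ∂surfaceMeasure (frontier Ω))
    + (∫ y, kernel41b P k₁ k₂ Ω x y * p y ∂surfaceMeasure (frontier Ω))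
    + ∫ y, kernel41c P k₁ k₂ Ω x y * p y ∂surfaceMeasure (frontier Ω)

/-- The operator `N₄²`, acting on vector fields componentwise. -/
def N42 (v : Vec3 → Fin 3 → ℂ) (x : Vec3) : Fin 3 → ℂ :=
  (∫ y, kernel42a P k₁ k₂ x y • v y ∂surfaceMeasure (frontier Ω))
    + ∫ y, kernel42b P k₁ k₂ x y • v y ∂surfaceMeasure (frontier Ω)

end Operators

/-- A kernel on the surface `Γ` is weakly singular (here, of order one) if it is continuous off
the diagonal and bounded by a multiple of `1 / |x - y|`. -/
def IsWeaklySingular (Γ : Set Vec3) (K : Vec3 → Vec3 → ℂ) : Prop :=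
  ContinuousOn (fun z : Vec3 × Vec3 => K z.1 z.2) {z | z.1 ∈ Γ ∧ z.2 ∈ Γ ∧ z.1 ≠ z.2} ∧
    ∃ C : ℝ, ∀ x ∈ Γ, ∀ y ∈ Γ, x ≠ y → ‖K x y‖ ≤ C / ‖x - y‖

/-! ### Well-definedness of the normal and of the finite part -/

theorem IsDefiningFunctionAt.inner_nonpos {Ω : Set Vec3} {f g : Vec3 → ℝ} {x : Vec3}
    (hf : IsDefiningFunctionAt Ω f x) (hg : IsDefiningFunctionAt Ω g x) (v : Vec3)
    (hv : inner ℝ (gradient f x) v < 0) : inner ℝ (gradient g x) v ≤ 0 := by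
  have key : ∀ h : Vec3 → ℝ, IsDefiningFunctionAt Ω h x →
      HasDerivAt (fun t : ℝ => h (x + t • v)) (inner ℝ (gradient h x) v) 0 := by
    intro h hh
    have h1 : HasGradientAt h (gradient h x) x :=
      ((hh.smooth.differentiable (by simp)) x).hasGradientAt
    have h2 : HasDerivAt (fun t : ℝ => x + t • v) v 0 := by
      simpa using ((hasDerivAt_id (0 : ℝ)).smul_const v).const_add x
    have h3 : HasFDerivAt h (InnerProductSpace.toDual ℝ Vec3 (gradient h x))
        ((fun t : ℝ => x + t • v) 0) := by simpa using h1.hasFDerivAt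
    have h4 := h3.comp_hasDerivAt (0 : ℝ) h2
    rw [InnerProductSpace.toDual_apply_apply] at h4
    exact h4
  have hline : Tendsto (fun t : ℝ => x + t • v) (𝓝[>] 0) (𝓝 x) := by
    have : Continuous (fun t : ℝ => x + t • v) := by fun_prop
    simpa using (this.tendsto 0).mono_left nhdsWithin_le_nhds
  have hsf := hasDerivAt_iff_tendsto_slope.1 (key f hf)
  have hsg := hasDerivAt_iff_tendsto_slope.1 (key g hg)
  have hle : 𝓝[>] (0 : ℝ) ≤ 𝓝[≠] 0 := nhdsWithin_mono _ fun t ht => ne_of_gt ht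
  have hfneg := (hsf.mono_left hle).eventually (gt_mem_nhds hv)
  refine le_of_tendsto (hsg.mono_left hle) ?_
  filter_upwards [hfneg, hline.eventually hf.eventually_mem_iff,
    hline.eventually hg.eventually_mem_iff, self_mem_nhdsWithin] with t h1 h2 h3 ht
  have ht' : (0 : ℝ) < t := ht
  have e1 : f (x + t • v) < 0 := by
    simp only [slope_def_field, zero_smul, add_zero, hf.apply_eq, sub_zero] at h1
    by_contra! hc
    exact absurd h1 (not_lt.2 (div_nonneg hc ht'.le))
  have e2 : g (x + t • v) < 0 := h3.1 (h2.2 e1)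
  simp only [slope_def_field, zero_smul, add_zero, hg.apply_eq, sub_zero]
  exact div_nonpos_of_nonpos_of_nonneg e2.le ht'.le

/-- The outward normal may be computed with any defining function. -/
theorem IsDefiningFunctionAt.outwardNormal_eq {Ω : Set Vec3} {f : Vec3 → ℝ} {x : Vec3}
    (hf : IsDefiningFunctionAt Ω f x) :
    outwardNormal Ω x = ‖gradient f x‖⁻¹ • gradient f x := by
  have hex : ∃ f, IsDefiningFunctionAt Ω f x := ⟨f, hf⟩
  rw [outwardNormal, dif_pos hex]
  have hg := hex.choose_spec
  set g := hex.choose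
  set a := gradient f x with ha
  set b := gradient g x with hb
  have ha0 : 0 < ‖a‖ := norm_pos_iff.2 hf.gradient_ne
  have hb0 : 0 < ‖b‖ := norm_pos_iff.2 hg.gradient_ne
  by_contra hne
  set a' := ‖a‖⁻¹ • a with ha'
  set b' := ‖b‖⁻¹ • b with hb'
  have na : ‖a'‖ = 1 := norm_smul_inv_norm hf.gradient_ne
  have nb : ‖b'‖ = 1 := norm_smul_inv_norm hg.gradient_ne
  have hlt : inner ℝ a' b' < 1 := (inner_lt_one_iff_real_of_norm_eq_one na nb).2 fun h => hne h.symm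
  have e1 : a = ‖a‖ • a' := by rw [ha', smul_smul, mul_inv_cancel₀ ha0.ne', one_smul]
  have e2 : b = ‖b‖ • b' := by rw [hb', smul_smul, mul_inv_cancel₀ hb0.ne', one_smul]
  have h1 : inner ℝ a (b' - a') < 0 := by
    rw [e1, real_inner_smul_left, inner_sub_right, real_inner_self_eq_norm_sq, na]
    exact mul_neg_of_pos_of_neg ha0 (by linarith)
  have h2 := hf.inner_nonpos hg _ h1
  rw [← hb, e2, real_inner_smul_left, inner_sub_right, real_inner_self_eq_norm_sq, nb,
    real_inner_comm] at h2
  have := mul_pos hb0 (show (0 : ℝ) < 1 ^ 2 - inner ℝ a' b' by linarith)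
  linarith

/-- The finite part is unique. -/
theorem IsFinitePart.finitePart_eq {Γ : Set Vec3} {x : Vec3} {f : Vec3 → ℂ} {l : ℂ}
    (h : IsFinitePart Γ x f l) : finitePart Γ x f = l := by
  have hex : ∃ l, IsFinitePart Γ x f l := ⟨l, h⟩
  rw [finitePart, dif_pos hex]
  obtain ⟨-, c, hc⟩ := h
  obtain ⟨-, d, hd⟩ := hex.choose_spec
  have hsub := hc.sub hd
  have hid : Tendsto (fun ε : ℝ => (ε : ℂ)) (𝓝[>] 0) (𝓝 0) := by
    simpa using (Complex.continuous_ofReal.tendsto 0).mono_left nhdsWithin_le_nhds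
  have hmul := hid.mul hsub
  have hcd : d - c = 0 := by
    rw [zero_mul] at hmul
    refine tendsto_nhds_unique (tendsto_const_nhds (x := d - c)) (hmul.congr' ?_)
    filter_upwards [self_mem_nhdsWithin] with ε hε
    have : (ε : ℂ) ≠ 0 := by exact_mod_cast (ne_of_gt hε)
    field_simp
    ring
  have : d = c := sub_eq_zero.1 hcd
  subst this
  exact tendsto_nhds_unique hd hc

end Poroelastic

end

/-! Off the diagonal, the entry of the hyper-singular kernel that acts on pressures has a closed
form (`hyperKernel_inr_inr`): the kernel of the first integral in N₄¹, plus a combination of the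
kernels -ν_xᵀ∇∇ᵀγ_k ν_y for k = k₁, k₂ (`normalHess`). The former is weakly singular, because the
weights of the three potentials under the Hessian in E₁₁ sum to zero and their leading singularities
cancel. What remains is Maue's formula for the Helmholtz equation (`isFinitePart_normalHess`): the
finite part of ∫ -ν_xᵀ∇∇ᵀγ_k ν_y p equals k² ∫ γ_k ν_x·ν_y p + τ₂ S_k τ₁ p, with S_k the
single-layer potential. Linearity then gives the theorem.

Maue's formula is proved by regularisation. With |z| replaced by ρ = √(|z|² + δ²) the kernel is
smooth, and Stokes' theorem on the closed surface, applied to an extension F of p times the gradient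
of the kernel, gives an exact identity for every δ > 0 (`integral_regField`). One side tends to τ₂
S_k τ₁ p as δ → 0. By the Helmholtz equation for the radial profiles, the other side consists of -k²
times a single-layer potential, a weakly singular remainder, and the integral of ρ⁻³ - 3δ²ρ⁻⁵
against the density F ν_x·ν_y / 4π. Two analytic facts are needed.

The regularisation sees the same finite part as the truncation |y - x| ≥ ε (`exists_finitePart`). In
a graph chart the density is affine up to O(|u|^(1+a)), the linear part cancels by oddness, and the
radial integrals are explicit: 1/ε - 1/R for the truncation, -1/R + o(1) for the regularisation. The
combination ρ⁻³ - 3δ²ρ⁻⁵ produces no divergent term.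

The single-layer potential of a Hölder continuous density is differentiable along the surface, and
its tangential derivatives are limits of the regularised ones
(`differentiableWithinAt_singleLayer`). Subtracting v(ξ) times a Stokes identity makes the integral
for the derivative weakly singular, so that it converges jointly in δ and in the base point; the
mean value inequality then survives the limit δ → 0.

The geometric foundation is a graph chart at each boundary point, from the inverse function theorem
(`exists_isGraphChart`), an area formula that identifies the Hausdorff measure in it
(`restrict_surfaceMeasure`), and Stokes' theorem, which in a chart comes down to the symmetry of the
second derivatives of the graph function. -/

noncomputable section

namespace Poroelastic

open MeasureTheory Filter Set

section

/-! ### The area formula for bi-Lipschitz parametrisations -/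

section AreaFormula

open Module

/-- The assumption makes `f` factor through `g` by a map that is `K`-Lipschitz on `g '' s`. The
symmetric form allows a chart and its linearisation to be compared in both directions. -/
theorem euclideanHausdorffMeasure_image_le_of_dist_le {α X Y : Type*}
    [MetricSpace X] [MeasurableSpace X] [BorelSpace X]
    [MetricSpace Y] [MeasurableSpace Y] [BorelSpace Y] {f : α → X} {g : α → Y} {s : Set α}
    {K : ℝ≥0} (d : ℕ) (h : ∀ a ∈ s, ∀ b ∈ s, dist (f a) (f b) ≤ K * dist (g a) (g b)) :
    (μHE[d] : Measure X) (f '' s) ≤ (K : ENNReal) ^ d * (μHE[d] : Measure Y) (g '' s) := by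
  rcases isEmpty_or_nonempty α with hα | hα
  · simp [Set.eq_empty_of_isEmpty s]
  set F : Y → X := f ∘ Function.invFunOn g s
  have hmem : ∀ a ∈ s, Function.invFunOn g s (g a) ∈ s := fun a ha =>
    Function.invFunOn_mem ⟨a, ha, rfl⟩
  have heq : ∀ a ∈ s, g (Function.invFunOn g s (g a)) = g a := fun a ha =>
    Function.invFunOn_eq ⟨a, ha, rfl⟩
  have hF : LipschitzOnWith K F (g '' s) := by
    refine LipschitzOnWith.of_dist_le_mul ?_
    rintro _ ⟨a, ha, rfl⟩ _ ⟨b, hb, rfl⟩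
    have := h _ (hmem a ha) _ (hmem b hb)
    rwa [heq a ha, heq b hb] at this
  have himg : F '' (g '' s) = f '' s := by
    rw [Set.image_image]
    refine Set.image_congr fun a ha => ?_
    have := h _ (hmem a ha) _ ha
    rw [heq a ha, dist_self, mul_zero] at this
    exact dist_le_zero.1 this
  have := hF.hausdorffMeasure_image_le (d := (d : ℝ)) (by positivity)
  rw [himg, ENNReal.rpow_natCast] at this
  simp only [Measure.euclideanHausdorffMeasure_def, Measure.smul_apply, ENNReal.smul_def,
    smul_eq_mul]
  rw [mul_left_comm]
  gcongr

variable {U V : Type*} [NormedAddCommGroup U] [InnerProductSpace ℝ U] [FiniteDimensional ℝ U]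
  [MeasurableSpace U] [BorelSpace U] [NormedAddCommGroup V] [InnerProductSpace ℝ V]
  [MeasurableSpace V] [BorelSpace V]

/-- Area formula. -/
theorem euclideanHausdorffMeasure_image_eq_lintegral {φ : U → V} (hφ : ContDiff ℝ 1 φ) {K : ℝ≥0}
    (hK : LipschitzWith K φ) (hanti : ∀ a b, dist a b ≤ dist (φ a) (φ b)) (s : Set U)
    (hs : MeasurableSet s) :
    (μHE[finrank ℝ U] : Measure V) (φ '' s)
      = ∫⁻ u in s, ENNReal.ofReal (fderiv ℝ φ u).toLinearMap.normDet := by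
  set d := finrank ℝ U
  have hinj : Function.Injective φ := fun a b hab => by
    have := hanti a b
    rw [hab, dist_self] at this
    exact dist_le_zero.1 this
  have : CompleteSpace U := FiniteDimensional.complete ℝ U
  have hemb : MeasurableEmbedding φ := hφ.continuous.measurableEmbedding hinj
  -- The area formula becomes a statement on the density of this pulled-back measure, and
  -- Besicovitch differentiation computes a density from small balls.
  set ν : Measure U := Measure.comap φ (μHE[d] : Measure V) with hν
  have hνs : ∀ t, ν t = (μHE[d] : Measure V) (φ '' t) := fun t => hemb.comap_apply _ _
  have hvol : (μHE[d] : Measure U) = volume := InnerProductSpace.euclideanHausdorffMeasure_eq_volume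
  have hle : ∀ t, ν t ≤ (K : ENNReal) ^ d * volume t := fun t => by
    rw [hνs, ← hvol]
    simpa using euclideanHausdorffMeasure_image_le_of_dist_le (f := φ) (g := id) (s := t) d
      fun a _ b _ => hK.dist_le_mul a b
  have hac : ν ≪ (volume : Measure U) := fun t ht => by
    have := hle t
    rw [ht, mul_zero] at this
    exact le_antisymm this zero_le
  have : IsLocallyFiniteMeasure ν := by
    refine ⟨fun x => ⟨Metric.ball x 1, Metric.ball_mem_nhds x one_pos, ?_⟩⟩
    refine (hle _).trans_lt (ENNReal.mul_lt_top ?_ measure_ball_lt_top)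
    exact ENNReal.pow_lt_top ENNReal.coe_lt_top
  -- On a small ball the differences of `φ` and of its derivative `T` almost agree, so each map is a
  -- `(1 + ε)`-Lipschitz function of the other. Hence the ratio of measures is squeezed between
  -- multiples of the normal determinant of `T` that tend to it.
  have key : ∀ u, ∀ ε : ℝ≥0, 0 < ε → ∀ᶠ r in 𝓝[>] (0 : ℝ),
      ν (Metric.closedBall u r) / volume (Metric.closedBall u r)
          ≤ ((1 + ε : ℝ≥0) : ENNReal) ^ d * ENNReal.ofReal (fderiv ℝ φ u).toLinearMap.normDet ∧
        ENNReal.ofReal (fderiv ℝ φ u).toLinearMap.normDet ≤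
          ((1 + ε : ℝ≥0) : ENNReal) ^ d *
            (ν (Metric.closedBall u r) / volume (Metric.closedBall u r)) := by
    intro u ε hε
    -- This choice gives `(1 + ε)(1 - c) = 1` and `c ≤ ε`, the two relations that turn an error of
    -- relative size `c` into the Lipschitz constant `1 + ε` in either direction.
    set c : ℝ≥0 := ε / (1 + ε)
    have hc : 0 < c := by positivity
    have hc' : (c : ℝ) = ε / (1 + ε) := by simp [c]
    have hε' : (0 : ℝ) < ε := hε
    obtain ⟨t, ht, happ⟩ := ((hφ.contDiffAt (x := u)).hasStrictFDerivAt
      one_ne_zero).approximates_deriv_on_nhds (c := c) (Or.inr hc)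
    obtain ⟨r0, hr0, hball⟩ := Metric.nhds_basis_closedBall.mem_iff.1 ht
    filter_upwards [Ioc_mem_nhdsGT hr0] with r hr
    set T := fderiv ℝ φ u
    have hsub : Metric.closedBall u r ⊆ t := (Metric.closedBall_subset_closedBall hr.2).trans hball
    have hpos : volume (Metric.closedBall u r) ≠ 0 :=
      (Metric.measure_closedBall_pos _ _ hr.1).ne'
    have hfin : volume (Metric.closedBall u r) ≠ ⊤ := measure_closedBall_lt_top.ne
    have hT : (μHE[d] : Measure V) (T '' Metric.closedBall u r)
        = ENNReal.ofReal T.toLinearMap.normDet * volume (Metric.closedBall u r) :=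
      T.toLinearMap.euclideanHausdorffMeasure_image_eq_normDet_mul_volume _
    -- Since `φ` does not contract, the error `c ‖a - b‖` may be measured by `‖φ a - φ b‖`; no lower
    -- bound for `T` is required.
    have hest : ∀ a ∈ Metric.closedBall u r, ∀ b ∈ Metric.closedBall u r,
        ‖φ a - φ b - (T a - T b)‖ ≤ c * ‖φ a - φ b‖ := fun a ha b hb => by
      have h1 := happ a (hsub ha) b (hsub hb)
      rw [map_sub] at h1
      refine h1.trans ?_
      have := hanti a b
      rw [dist_eq_norm, dist_eq_norm] at this
      gcongr
    have e1 : (1 + ε : ℝ) * (1 - c) = 1 := by rw [hc']; field_simp; ring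
    have e2 : (c : ℝ) ≤ ε := by
      rw [hc', div_le_iff₀ (by positivity)]
      nlinarith
    constructor
    · rw [ENNReal.div_le_iff hpos hfin, mul_assoc, ← hT, hνs]
      refine euclideanHausdorffMeasure_image_le_of_dist_le d fun a ha b hb => ?_
      rw [dist_eq_norm, dist_eq_norm]
      have h1 := hest a ha b hb
      have h2 := norm_sub_norm_le (φ a - φ b) (T a - T b)
      have h3 : (1 - c : ℝ) * ‖φ a - φ b‖ ≤ ‖T a - T b‖ := by linarith
      have h4 := mul_le_mul_of_nonneg_left h3 (show (0 : ℝ) ≤ 1 + ε by positivity)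
      rw [← mul_assoc, e1, one_mul] at h4
      simpa using h4
    · rw [← mul_div_assoc, ENNReal.le_div_iff_mul_le (Or.inl hpos) (Or.inl hfin), ← hT, hνs]
      refine euclideanHausdorffMeasure_image_le_of_dist_le d fun a ha b hb => ?_
      rw [dist_eq_norm, dist_eq_norm]
      have h1 := hest a ha b hb
      have h2 := norm_sub_norm_le (T a - T b) (φ a - φ b)
      rw [norm_sub_rev (T a - T b) (φ a - φ b)] at h2
      have h4 := mul_le_mul_of_nonneg_right e2 (norm_nonneg (φ a - φ b))
      push_cast
      linarith
  have hlim : Tendsto (fun ε : ℝ≥0 => ((1 + ε : ℝ≥0) : ENNReal) ^ d) (𝓝[>] 0) (𝓝 1) := by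
    have : Continuous fun ε : ℝ≥0 => ((1 + ε : ℝ≥0) : ENNReal) ^ d := by fun_prop
    simpa using (this.tendsto 0).mono_left nhdsWithin_le_nhds
  have hae : ν.rnDeriv volume =ᵐ[volume]
      fun u => ENNReal.ofReal (fderiv ℝ φ u).toLinearMap.normDet := by
    filter_upwards [Besicovitch.ae_tendsto_rnDeriv ν (volume : Measure U),
      Measure.rnDeriv_lt_top ν (volume : Measure U)] with u hu hfin
    refine le_antisymm ?_ ?_
    · have h := ENNReal.Tendsto.mul_const (b := ENNReal.ofReal (fderiv ℝ φ u).toLinearMap.normDet)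
        hlim (Or.inl one_ne_zero)
      rw [one_mul] at h
      refine ge_of_tendsto h ?_
      filter_upwards [self_mem_nhdsWithin] with ε hε
      exact le_of_tendsto hu ((key u ε hε).mono fun r hr => hr.1)
    · have h := ENNReal.Tendsto.mul_const (b := ν.rnDeriv volume u) hlim (Or.inl one_ne_zero)
      rw [one_mul] at h
      refine ge_of_tendsto h ?_
      filter_upwards [self_mem_nhdsWithin] with ε hε
      refine ge_of_tendsto (ENNReal.Tendsto.const_mul hu (Or.inr ?_))
        ((key u ε hε).mono fun r hr => hr.2)
      exact (ENNReal.pow_lt_top ENNReal.coe_lt_top).ne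
  rw [← hνs, ← Measure.withDensity_rnDeriv_eq ν volume hac, withDensity_apply _ hs]
  exact lintegral_congr_ae (ae_restrict_of_ae hae)

end AreaFormula

end

section

/-! ### Graph charts of the boundary -/

/-- The Euclidean plane. -/
abbrev Vec2 : Type := EuclideanSpace ℝ (Fin 2)

/-- The `i`-th partial derivative of a function on the plane. -/
def planeD (i : Fin 2) (h : Vec2 → ℝ) (u : Vec2) : ℝ := fderiv ℝ h u (EuclideanSpace.single i 1)

/-- The parametrisation `u ↦ x + u₀ b₀ + u₁ b₁ + h(u) b₂` of a graph. -/
def graphMap (x : Vec3) (b : OrthonormalBasis (Fin 3) ℝ Vec3) (h : Vec2 → ℝ) (u : Vec2) : Vec3 :=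
  x + u 0 • b 0 + u 1 • b 1 + h u • b 2

/-- The coordinates of a vector with respect to `b₀` and `b₁`. -/
def planeProj (b : OrthonormalBasis (Fin 3) ℝ Vec3) (v : Vec3) : Vec2 :=
  !₂[inner ℝ (b 0) v, inner ℝ (b 1) v]

/-- `φ(u) = x + u₀ b₀ + u₁ b₁ + h(u) ν(x)` parametrises the part of the boundary in `V`. -/
structure IsGraphChart (Ω : Set Vec3) (x : Vec3) (b : OrthonormalBasis (Fin 3) ℝ Vec3)
    (h : Vec2 → ℝ) (V : Set Vec3) (ρ : ℝ) : Prop where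
  basis_two : b 2 = outwardNormal Ω x
  contDiff : ContDiff ℝ 2 h
  hasCompactSupport : HasCompactSupport h
  apply_zero : h 0 = 0
  fderiv_zero : fderiv ℝ h 0 = 0
  isOpen : IsOpen V
  mem : x ∈ V
  pos : 0 < ρ
  planeProj_mem : ∀ y ∈ V, planeProj b (y - x) ∈ Metric.ball 0 ρ
  image_ball : graphMap x b h '' Metric.ball 0 ρ = frontier Ω ∩ V
  normal : ∀ u ∈ Metric.ball (0 : Vec2) ρ,
    √(1 + planeD 0 h u ^ 2 + planeD 1 h u ^ 2) • outwardNormal Ω (graphMap x b h u)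
      = b 2 - planeD 0 h u • b 0 - planeD 1 h u • b 1

theorem IsDefiningFunctionAt.norm_outwardNormal {Ω : Set Vec3} {f : Vec3 → ℝ} {x : Vec3}
    (hf : IsDefiningFunctionAt Ω f x) : ‖outwardNormal Ω x‖ = 1 := by
  rw [hf.outwardNormal_eq]
  exact norm_smul_inv_norm hf.gradient_ne

theorem continuous_gradient {f : Vec3 → ℝ} (hf : ContDiff ℝ ∞ f) : Continuous (gradient f) :=
  (InnerProductSpace.toDual ℝ Vec3).symm.continuous.comp (hf.continuous_fderiv (by simp))

theorem inner_gradient {f : Vec3 → ℝ} (x v : Vec3) :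
    inner ℝ (gradient f x) v = fderiv ℝ f x v := by
  rw [gradient, InnerProductSpace.toDual_symm_apply]

/-- A defining function vanishes near the point exactly on the boundary, and is a defining
function at the nearby boundary points. -/
theorem IsDefiningFunctionAt.eventually_mem_frontier {Ω : Set Vec3} (hΩ : IsOpen Ω)
    {f : Vec3 → ℝ} {x : Vec3} (hf : IsDefiningFunctionAt Ω f x) :
    ∀ᶠ y in 𝓝 x, (y ∈ frontier Ω ↔ f y = 0) ∧ (f y = 0 → IsDefiningFunctionAt Ω f y) := by
  have h1 : ∀ᶠ y in 𝓝 x, gradient f y ≠ 0 :=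
    (continuous_gradient hf.smooth).continuousAt.eventually_ne hf.gradient_ne
  filter_upwards [hf.eventually_mem_iff.eventually_nhds, h1] with y hy hg
  have hdef : f y = 0 → IsDefiningFunctionAt Ω f y := fun h0 => ⟨hf.smooth, hg, hy, h0⟩
  refine ⟨?_, hdef⟩
  rw [hΩ.frontier_eq]
  constructor
  · rintro ⟨hc, hn⟩
    refine le_antisymm ?_ ?_
    · by_contra! hpos
      have h2 : ∀ᶠ w in 𝓝 y, 0 < f w := hf.smooth.continuous.continuousAt.eventually_const_lt hpos
      obtain ⟨w, hw, hw1, hw2⟩ := ((mem_closure_iff_frequently.1 hc).and_eventually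
        (hy.and h2)).exists
      exact absurd (hw1.1 hw) (not_lt.2 hw2.le)
    · have := hy.self_of_nhds
      by_contra! hneg
      exact hn (this.2 hneg)
  · intro h0
    have hyn : y ∉ Ω := fun h => by
      have := hy.self_of_nhds.1 h
      rw [h0] at this
      exact lt_irrefl _ this
    refine ⟨?_, hyn⟩
    rw [mem_closure_iff_frequently]
    intro hcon
    -- Moving from `y` against the gradient makes `f` negative, that is, enters `Ω`; so `y` cannot
    -- have a neighbourhood free of `Ω`.
    set v := -gradient f y
    have hd : HasDerivAt (fun t : ℝ => f (y + t • v)) (fderiv ℝ f y v) 0 := by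
      have h2 : HasDerivAt (fun t : ℝ => y + t • v) v 0 := by
        simpa using ((hasDerivAt_id (0 : ℝ)).smul_const v).const_add y
      have h3 : HasFDerivAt f (fderiv ℝ f y) ((fun t : ℝ => y + t • v) 0) := by
        simpa using ((hf.smooth.differentiable (by simp)) y).hasFDerivAt
      exact h3.comp_hasDerivAt (0 : ℝ) h2
    have hneg : fderiv ℝ f y v < 0 := by
      rw [← inner_gradient, inner_neg_right, real_inner_self_eq_norm_sq]
      have := norm_pos_iff.2 hg
      nlinarith
    have hline : Tendsto (fun t : ℝ => y + t • v) (𝓝[>] 0) (𝓝 y) := by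
      have : Continuous (fun t : ℝ => y + t • v) := by fun_prop
      simpa using (this.tendsto 0).mono_left nhdsWithin_le_nhds
    have hle : 𝓝[>] (0 : ℝ) ≤ 𝓝[≠] 0 := nhdsWithin_mono _ fun t ht => ne_of_gt ht
    have hs := ((hasDerivAt_iff_tendsto_slope.1 hd).mono_left hle).eventually (gt_mem_nhds hneg)
    obtain ⟨t, h4, h5, h6, ht⟩ := (hs.and ((hline.eventually hcon).and ((hline.eventually hy).and
      self_mem_nhdsWithin))).exists
    have ht' : (0 : ℝ) < t := ht
    simp only [slope_def_field, zero_smul, add_zero, h0, sub_zero] at h4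
    refine h5 (h6.2 ?_)
    by_contra! hc
    exact absurd h4 (not_lt.2 (div_nonneg hc ht'.le))

/-- Multiplication by a bump function. Compact support makes the graph function and its first
derivative globally Lipschitz, so the estimates in a chart hold with constants valid on the whole
plane. -/
theorem exists_contDiff_eventuallyEq {f : Vec2 → ℝ} {x : Vec2} (hf : ContDiffAt ℝ 2 f x) :
    ∃ g : Vec2 → ℝ, ContDiff ℝ 2 g ∧ HasCompactSupport g ∧ g =ᶠ[𝓝 x] f := by
  obtain ⟨r, hr, hball⟩ := Metric.nhds_basis_closedBall.mem_iff.1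
    (hf.eventually (by simp))
  set χ : ContDiffBump x := ⟨r / 2, r, by positivity, by linarith⟩
  refine ⟨fun u => χ u * f u, ?_, χ.hasCompactSupport.mul_right, ?_⟩
  · refine contDiff_iff_contDiffAt.2 fun u => ?_
    by_cases hu : u ∈ tsupport χ
    · rw [χ.tsupport_eq] at hu
      exact χ.contDiffAt.mul (hball hu)
    · refine (contDiffAt_const (c := (0 : ℝ))).congr_of_eventuallyEq ?_
      filter_upwards [notMem_tsupport_iff_eventuallyEq.1 hu] with w hw
      simp [hw]
  · filter_upwards [χ.eventuallyEq_one] with u hu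
    simp [hu]

section GraphMap

variable (x : Vec3) (b : OrthonormalBasis (Fin 3) ℝ Vec3) (h : Vec2 → ℝ)

theorem basis_inner (i j : Fin 3) : inner ℝ (b i) (b j) = if i = j then (1 : ℝ) else 0 :=
  orthonormal_iff_ite.1 b.orthonormal i j

theorem basis_expand (v : Vec3) :
    v = inner ℝ (b 0) v • b 0 + inner ℝ (b 1) v • b 1 + inner ℝ (b 2) v • b 2 := by
  conv_lhs => rw [← b.sum_repr' v]
  rw [Fin.sum_univ_three]

theorem norm_sq_basis (v : Vec3) :
    ‖v‖ ^ 2 = inner ℝ (b 0) v ^ 2 + inner ℝ (b 1) v ^ 2 + inner ℝ (b 2) v ^ 2 := by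
  rw [← b.sum_sq_norm_inner_right v, Fin.sum_univ_three]
  simp

theorem norm_sq_vec2 (u : Vec2) : ‖u‖ ^ 2 = u 0 ^ 2 + u 1 ^ 2 := by
  rw [EuclideanSpace.norm_sq_eq, Fin.sum_univ_two]
  simp

theorem planeProj_norm_le (v : Vec3) : ‖planeProj b v‖ ≤ ‖v‖ := by
  refine le_of_sq_le_sq ?_ (norm_nonneg _)
  rw [norm_sq_basis b, norm_sq_vec2]
  simp [planeProj]
  positivity

theorem continuous_planeProj : Continuous (planeProj b) := by
  unfold planeProj
  fun_prop

theorem inner_graphMap_sub (u v : Vec2) :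
    inner ℝ (b 0) (graphMap x b h u - graphMap x b h v) = u 0 - v 0 ∧
    inner ℝ (b 1) (graphMap x b h u - graphMap x b h v) = u 1 - v 1 ∧
    inner ℝ (b 2) (graphMap x b h u - graphMap x b h v) = h u - h v := by
  simp [graphMap, inner_sub_right, inner_add_right, inner_smul_right]

theorem norm_sq_graphMap_sub (u v : Vec2) :
    ‖graphMap x b h u - graphMap x b h v‖ ^ 2 = ‖u - v‖ ^ 2 + (h u - h v) ^ 2 := by
  obtain ⟨h0, h1, h2⟩ := inner_graphMap_sub x b h u v
  rw [norm_sq_basis b, norm_sq_vec2, h0, h1, h2]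
  simp

/-- The orthogonal projection onto the tangent plane inverts the graph map and shortens distances.
This is the non-contraction hypothesis of the area formula. -/
theorem dist_le_dist_graphMap (u v : Vec2) :
    dist u v ≤ dist (graphMap x b h u) (graphMap x b h v) := by
  rw [dist_eq_norm, dist_eq_norm]
  refine le_of_sq_le_sq ?_ (norm_nonneg _)
  rw [norm_sq_graphMap_sub]
  nlinarith [sq_nonneg (h u - h v)]

theorem planeProj_graphMap (u : Vec2) : planeProj b (graphMap x b h u - x) = u := by
  ext i
  fin_cases i <;>
  simp [planeProj, graphMap, inner_sub_right, inner_add_right, inner_smul_right]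

variable {h}

theorem graphMap_hasFDerivAt {u : Vec2} (hh : DifferentiableAt ℝ h u) :
    HasFDerivAt (graphMap x b h)
      ((EuclideanSpace.proj (0 : Fin 2) : Vec2 →L[ℝ] ℝ).smulRight (b 0)
        + (EuclideanSpace.proj (1 : Fin 2) : Vec2 →L[ℝ] ℝ).smulRight (b 1)
        + (fderiv ℝ h u).smulRight (b 2)) u := by
  have h0 := (EuclideanSpace.proj (0 : Fin 2) : Vec2 →L[ℝ] ℝ).hasFDerivAt (x := u)
  have h1 := (EuclideanSpace.proj (1 : Fin 2) : Vec2 →L[ℝ] ℝ).hasFDerivAt (x := u)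
  exact ((h0.smul_const (b 0)).const_add x |>.add (h1.smul_const (b 1))).add
    (hh.hasFDerivAt.smul_const (b 2))

theorem fderiv_graphMap_single {u : Vec2} (hh : DifferentiableAt ℝ h u) :
    fderiv ℝ (graphMap x b h) u (EuclideanSpace.single 0 1) = b 0 + planeD 0 h u • b 2 ∧
    fderiv ℝ (graphMap x b h) u (EuclideanSpace.single 1 1) = b 1 + planeD 1 h u • b 2 := by
  rw [(graphMap_hasFDerivAt x b hh).fderiv]
  simp [planeD]

theorem contDiff_graphMap {n : WithTop ℕ∞} (hh : ContDiff ℝ n h) :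
    ContDiff ℝ n (graphMap x b h) := by
  unfold graphMap
  have h0 : ContDiff ℝ n fun u : Vec2 => u 0 := by fun_prop
  have h1 : ContDiff ℝ n fun u : Vec2 => u 1 := by fun_prop
  exact ((contDiff_const.add (h0.smul contDiff_const)).add (h1.smul contDiff_const)).add
    (hh.smul contDiff_const)

/-- The Gram determinant of the tangent vectors is `(1 + h₀²)(1 + h₁²) - (h₀h₁)²`, with `hᵢ` the
partial derivatives of `h`. -/
theorem normDet_graphMap {u : Vec2} (hh : DifferentiableAt ℝ h u) :
    (fderiv ℝ (graphMap x b h) u).toLinearMap.normDet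
      = √(1 + planeD 0 h u ^ 2 + planeD 1 h u ^ 2) := by
  have h1 := LinearMap.normDet_sq_eq_det_gram (fderiv ℝ (graphMap x b h) u).toLinearMap
    (EuclideanSpace.basisFun (Fin 2) ℝ)
  rw [Matrix.det_fin_two] at h1
  obtain ⟨e0, e1⟩ := fderiv_graphMap_single x b hh
  simp only [Matrix.gram_apply, EuclideanSpace.basisFun_apply, ContinuousLinearMap.coe_coe, e0, e1,
    inner_add_left, inner_add_right, inner_smul_left, inner_smul_right, basis_inner] at h1
  rw [eq_comm, Real.sqrt_eq_iff_mul_self_eq (by positivity) (LinearMap.normDet_nonneg _)]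
  simp at h1
  rw [← sq, h1]
  ring

end GraphMap

end

/-! ### Existence of graph charts -/

section

theorem exists_orthonormalBasis_two {n : Vec3} (hn : ‖n‖ = 1) :
    ∃ b : OrthonormalBasis (Fin 3) ℝ Vec3, b 2 = n := by
  have hcard : Module.finrank ℝ Vec3 = Fintype.card (Fin 3) := by simp
  obtain ⟨b, hb⟩ := Orthonormal.exists_orthonormalBasis_extension_of_card_eq (𝕜 := ℝ) hcard
    (v := fun _ => n) (s := {2}) ⟨fun _ => hn, fun i j hij => by
      exact absurd (Subsingleton.elim i j) hij⟩
  exact ⟨b, hb 2 rfl⟩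

/-- The two vectors span the tangent plane of a graph with slopes `p` and `q`. The factor is kept
explicit because its sign later identifies the outward direction. -/
theorem eq_smul_of_inner_eq_zero {b : OrthonormalBasis (Fin 3) ℝ Vec3} {N : Vec3} {p q : ℝ}
    (h0 : inner ℝ N (b 0 + p • b 2) = 0) (h1 : inner ℝ N (b 1 + q • b 2) = 0) :
    N = inner ℝ (b 2) N • (b 2 - p • b 0 - q • b 1) := by
  rw [inner_add_right, inner_smul_right, real_inner_comm, real_inner_comm (b 2)] at h0 h1
  have e := basis_expand b N
  rw [eq_neg_of_add_eq_zero_left h0, eq_neg_of_add_eq_zero_left h1] at e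
  conv_lhs => rw [e]
  module

/-- Near a boundary point, the boundary is a graph over its tangent plane. -/
theorem exists_isGraphChart {Ω : Set Vec3} (hΩ : IsOpen Ω) {f : Vec3 → ℝ} {x : Vec3}
    (hf : IsDefiningFunctionAt Ω f x) : ∃ b h V ρ, IsGraphChart Ω x b h V ρ := by
  set n := outwardNormal Ω x with hn
  have hn1 : ‖n‖ = 1 := hf.norm_outwardNormal
  obtain ⟨b, hb⟩ := exists_orthonormalBasis_two hn1
  set c : ℝ := ‖gradient f x‖⁻¹ with hc
  have hc0 : 0 < c := inv_pos.2 (norm_pos_iff.2 hf.gradient_ne)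
  have hgrad : c • gradient f x = n := hf.outwardNormal_eq.symm
  have hcf : ContDiff ℝ 2 fun y => c * f y := 
    contDiff_const.mul (hf.smooth.of_le (WithTop.coe_le_coe.2 le_top))
  -- the straightening map
  set g : Vec3 → ℝ := fun y => c * f y - inner ℝ n (y - x) with hg
  have hgs : ContDiff ℝ 2 g :=
    hcf.sub ((innerSL ℝ n).contDiff.comp (contDiff_id.sub contDiff_const))
  -- `Ψ` replaces the height of `y` over the tangent plane by `c f(y)`. It therefore flattens the
  -- zero set of `f` into that plane, and its derivative at `x` is the identity; the graph is read
  -- off from the local inverse `G`.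
  set Ψ : Vec3 → Vec3 := fun y => y + g y • n with hΨ
  have hΨs : ContDiff ℝ 2 Ψ := contDiff_id.add (hgs.smul contDiff_const)
  have hgx : g x = 0 := by simp [hg, hf.apply_eq]
  have hdg : HasFDerivAt g (0 : Vec3 →L[ℝ] ℝ) x := by
    have h1 := ((hf.smooth.differentiable (by simp)) x).hasFDerivAt.const_mul c
    have h2 : HasFDerivAt (fun y => inner ℝ n (y - x)) (innerSL ℝ n) x :=
      (innerSL ℝ n).hasFDerivAt.comp x ((hasFDerivAt_id x).sub_const x)
    have h3 := h1.sub h2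
    have h4 : c • fderiv ℝ f x - innerSL ℝ n = 0 := by
      ext v
      change c * fderiv ℝ f x v - inner ℝ n v = 0
      rw [← hgrad, inner_smul_left, inner_gradient]
      simp
    rwa [h4] at h3
  have hdΨ : HasFDerivAt Ψ ((ContinuousLinearEquiv.refl ℝ Vec3 : Vec3 ≃L[ℝ] Vec3) :
      Vec3 →L[ℝ] Vec3) x := by
    have := (hasFDerivAt_id x).add (hdg.smul_const n)
    refine this.congr_fderiv ?_
    ext v
    simp
  have hΨx : Ψ x = x := by simp [hΨ, hgx]
  have hstrict := (hΨs.contDiffAt (x := x)).hasStrictFDerivAt' hdΨ (by simp)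
  set G := (hΨs.contDiffAt (x := x)).localInverse hdΨ (by simp) with hG
  have hGs : ContDiffAt ℝ 2 G x := by
    have := (hΨs.contDiffAt (x := x)).to_localInverse hdΨ (by simp)
    rwa [hΨx] at this
  have hGx : G x = x := by
    have := (hΨs.contDiffAt (x := x)).localInverse_apply_image hdΨ (by simp)
    rwa [hΨx] at this
  have hleft : ∀ᶠ y in 𝓝 x, G (Ψ y) = y := hstrict.eventually_left_inverse
  have hright : ∀ᶠ z in 𝓝 x, Ψ (G z) = z := by
    have := hstrict.eventually_right_inverse
    rwa [hΨx] at this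
  -- the graph function
  set ι : Vec2 → Vec3 := fun u => x + u 0 • b 0 + u 1 • b 1 with hι
  have hιs : ContDiff ℝ 2 ι := by
    have h0 : ContDiff ℝ 2 fun u : Vec2 => u 0 := by fun_prop
    have h1 : ContDiff ℝ 2 fun u : Vec2 => u 1 := by fun_prop
    exact (contDiff_const.add (h0.smul contDiff_const)).add (h1.smul contDiff_const)
  have hι0 : ι 0 = x := by simp [hι]
  have hιt : Tendsto ι (𝓝 0) (𝓝 x) := by
    have := hιs.continuous.tendsto 0
    rwa [hι0] at this
  have hh0 : ContDiffAt ℝ 2 (fun u => inner ℝ n (G (ι u) - x)) 0 := by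
    rw [← hι0] at hGs
    exact (innerSL ℝ n).contDiff.contDiffAt.comp _
      ((hGs.comp (0 : Vec2) hιs.contDiffAt).sub contDiffAt_const)
  obtain ⟨h, hhs, hsupp, hheq⟩ := exists_contDiff_eventuallyEq hh0
  set φ := graphMap x b h with hφ
  have hφs : ContDiff ℝ 2 φ := contDiff_graphMap x b hhs
  have hh00 : h 0 = 0 := by
    rw [hheq.self_of_nhds]
    simp [hι0, hGx]
  have hφ0 : φ 0 = x := by simp [hφ, graphMap, hh00]
  have hφt : Tendsto φ (𝓝 0) (𝓝 x) := by
    have := hφs.continuous.tendsto 0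
    rwa [hφ0] at this
  have hφι : ∀ u, φ u = ι u + h u • n := fun u => by simp [hφ, graphMap, hι, hb]
  -- near `0`, the graph lies on the boundary
  have hφG : ∀ᶠ u in 𝓝 (0 : Vec2), φ u = G (ι u) ∧ f (φ u) = 0 := by
    filter_upwards [hheq, hιt.eventually hright] with u hu1 hu2
    have e1 : G (ι u) + g (G (ι u)) • n = ι u := hu2
    have e2 : G (ι u) - x = (u 0 • b 0 + u 1 • b 1) - g (G (ι u)) • n := by
      generalize g (G (ι u)) = t at e1
      rw [eq_sub_of_add_eq e1]
      simp only [hι]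
      abel
    have e3 : h u = - g (G (ι u)) := by
      rw [hu1, e2, ← hb]
      simp [inner_sub_right, inner_add_right, inner_smul_right]
    have e4 : φ u = G (ι u) := by
      rw [hφι, e3]
      generalize g (G (ι u)) = t at e1
      rw [eq_sub_of_add_eq e1]
      module
    refine ⟨e4, ?_⟩
    rw [← e4] at e3
    have e5 : c * f (φ u) - inner ℝ n (φ u - x) = - h u := by rw [e3, neg_neg]
    have e6 : inner ℝ n (φ u - x) = h u := by rw [e4, hu1]
    have : c * f (φ u) = 0 := by linarith
    exact (mul_eq_zero.1 this).resolve_left hc0.ne'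
  have hφ' := fun u => fderiv_graphMap_single x b (hhs.differentiable (by simp) u)
  have htan : ∀ᶠ u in 𝓝 (0 : Vec2),
      inner ℝ (gradient f (φ u)) (b 0 + planeD 0 h u • b 2) = 0 ∧
      inner ℝ (gradient f (φ u)) (b 1 + planeD 1 h u • b 2) = 0 := by
    filter_upwards [hφG.eventually_nhds] with u hu
    have h1 : HasFDerivAt (f ∘ φ) ((fderiv ℝ f (φ u)).comp (fderiv ℝ φ u)) u :=
      ((hf.smooth.differentiable (by simp)) _).hasFDerivAt.comp u
        ((hφs.differentiable (by simp)) u).hasFDerivAt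
    have h2 : HasFDerivAt (f ∘ φ) (0 : Vec2 →L[ℝ] ℝ) u :=
      (hasFDerivAt_const (0 : ℝ) u).congr_of_eventuallyEq (hu.mono fun w hw => hw.2)
    have h3 := h1.unique h2
    rw [inner_gradient, inner_gradient, ← (hφ' u).1, ← (hφ' u).2]
    exact ⟨DFunLike.congr_fun h3 _, DFunLike.congr_fun h3 _⟩
  -- Positivity at `u = 0` persists nearby and fixes the sign of the normal computed from the
  -- tangent vectors.
  have hposN : ∀ᶠ u in 𝓝 (0 : Vec2), 0 < inner ℝ (b 2) (gradient f (φ u)) := by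
    have hcont : Continuous fun u => (inner ℝ (b 2) (gradient f (φ u)) : ℝ) :=
      continuous_const.inner ((continuous_gradient hf.smooth).comp hφs.continuous)
    refine hcont.continuousAt.eventually_const_lt ?_
    simp only [hφ0]
    rw [hb, ← hgrad, inner_smul_left, real_inner_self_eq_norm_sq]
    have := norm_pos_iff.2 hf.gradient_ne
    simp only [conj_trivial]
    positivity
  -- the neighbourhoods
  have hfront := hf.eventually_mem_frontier hΩ
  have hW : ∀ᶠ y in 𝓝 x, ((y ∈ frontier Ω ↔ f y = 0) ∧ (f y = 0 → IsDefiningFunctionAt Ω f y))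
      ∧ G (Ψ y) = y := hfront.and hleft
  obtain ⟨W, hWsub, hWo, hxW⟩ := eventually_nhds_iff.1 hW
  have hU : ∀ᶠ u in 𝓝 (0 : Vec2), (φ u = G (ι u) ∧ f (φ u) = 0) ∧
      (inner ℝ (gradient f (φ u)) (b 0 + planeD 0 h u • b 2) = 0 ∧
      inner ℝ (gradient f (φ u)) (b 1 + planeD 1 h u • b 2) = 0) ∧
      0 < inner ℝ (b 2) (gradient f (φ u)) ∧ φ u ∈ W :=
    hφG.and (htan.and (hposN.and (hφt.eventually (hWo.mem_nhds hxW))))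
  obtain ⟨ρ, hρ, hball⟩ := Metric.eventually_nhds_iff_ball.1 hU
  have hcp : Continuous fun y => planeProj b (y - x) :=
    (continuous_planeProj b).comp (continuous_id.sub continuous_const)
  refine ⟨b, h, W ∩ (fun y => planeProj b (y - x)) ⁻¹' Metric.ball 0 ρ, ρ, hb, hhs, hsupp, hh00, ?_,
    hWo.inter (Metric.isOpen_ball.preimage hcp), ⟨hxW, ?_⟩, hρ,
    fun y hy => hy.2, ?_, ?_⟩
  rotate_left
  · have : planeProj b (x - x) = 0 := by
      ext i
      fin_cases i <;> simp [planeProj]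
    rw [Set.mem_preimage, this]
    exact Metric.mem_ball_self hρ
  rotate_left 2
  · obtain ⟨h1, h2⟩ := htan.self_of_nhds
    have hcc : gradient f x = c⁻¹ • b 2 := by
      rw [hb, ← hgrad, smul_smul, inv_mul_cancel₀ hc0.ne', one_smul]
    rw [hφ0, hcc] at h1 h2
    have hci : c⁻¹ ≠ 0 := inv_ne_zero hc0.ne'
    simp [inner_smul_left, inner_add_right, inner_smul_right, hc0.ne'] at h1 h2
    refine ContinuousLinearMap.ext fun v => ?_
    have hv : v = v 0 • EuclideanSpace.single 0 (1 : ℝ) + v 1 • EuclideanSpace.single 1 (1 : ℝ) := by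
      ext i
      fin_cases i <;> simp
    rw [hv, map_add, map_smul, map_smul]
    change v 0 • planeD 0 h 0 + v 1 • planeD 1 h 0 = 0
    rw [h1, h2]
    simp
  · ext y
    constructor
    · rintro ⟨u, hu, rfl⟩
      obtain ⟨⟨-, h2⟩, -, -, h3⟩ := hball u hu
      refine ⟨(hWsub _ h3).1.1.2 h2, h3, ?_⟩
      simpa [planeProj_graphMap] using hu
    · rintro ⟨hy1, hy2, hy3⟩
      refine ⟨planeProj b (y - x), hy3, ?_⟩
      obtain ⟨⟨h1, -⟩, -⟩ := hball _ hy3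
      rw [← hφ, h1]
      have hfy : f y = 0 := (hWsub _ hy2).1.1.1 hy1
      -- Where `f` vanishes, `Ψ` erases exactly the normal component, so a boundary point is
      -- recovered by `G` from its projection to the tangent plane.
      have e1 : Ψ y = ι (planeProj b (y - x)) := by
        simp only [hΨ, hg, hfy, hι, planeProj, mul_zero, zero_sub]
        have := basis_expand b (y - x)
        rw [hb] at this
        have e2 : y = x + (y - x) := by abel
        conv_lhs => rw [e2]
        conv_lhs => enter [1, 2]; rw [this]
        simp
        module
      rw [← e1]
      exact (hWsub _ hy2).2
  · intro u hu
    obtain ⟨⟨-, h2⟩, ⟨h3, h4⟩, h5, h6⟩ := hball u hu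
    rw [← hφ, ((hWsub _ h6).1.2 h2).outwardNormal_eq]
    have e := eq_smul_of_inner_eq_zero h3 h4
    set N := gradient f (φ u)
    set m := b 2 - planeD 0 h u • b 0 - planeD 1 h u • b 1 with hm
    have hmn : ‖m‖ = √(1 + planeD 0 h u ^ 2 + planeD 1 h u ^ 2) := by
      rw [eq_comm, Real.sqrt_eq_iff_mul_self_eq (by positivity) (norm_nonneg _), ← sq,
        norm_sq_basis b]
      simp [hm, inner_sub_right, inner_smul_right]
      ring
    have hNn : ‖N‖ = inner ℝ (b 2) N * ‖m‖ := by
      conv_lhs => rw [e]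
      rw [norm_smul, Real.norm_of_nonneg h5.le]
    have hm0 : 0 < ‖m‖ := by rw [hmn]; positivity
    rw [← hmn, hNn]
    conv_lhs => rw [e]
    rw [smul_smul, smul_smul]
    rw [show inner ℝ (b 2) (inner ℝ (b 2) N • m) = inner ℝ (b 2) N from by rw [← e]]
    rw [show ‖m‖ * (inner ℝ (b 2) N * ‖m‖)⁻¹ * inner ℝ (b 2) N = 1 by field_simp, one_smul]

end

section

/-! ### Integration in graph charts -/

/-- The area density of a graph. -/
def graphDensity (h : Vec2 → ℝ) (u : Vec2) : ℝ := √(1 + planeD 0 h u ^ 2 + planeD 1 h u ^ 2)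

theorem graphDensity_nonneg (h : Vec2 → ℝ) (u : Vec2) : 0 ≤ graphDensity h u := Real.sqrt_nonneg _

theorem planeProj_sub (b : OrthonormalBasis (Fin 3) ℝ Vec3) (v w : Vec3) :
    planeProj b (v - w) = planeProj b v - planeProj b w := by
  ext i
  fin_cases i <;> simp [planeProj, inner_sub_right]

theorem continuous_planeD {h : Vec2 → ℝ} (hh : ContDiff ℝ 2 h) (i : Fin 2) :
    Continuous (planeD i h) :=
  (hh.continuous_fderiv (by simp)).clm_apply continuous_const

theorem continuous_graphDensity {h : Vec2 → ℝ} (hh : ContDiff ℝ 2 h) :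
    Continuous (graphDensity h) :=
  Real.continuous_sqrt.comp ((continuous_const.add ((continuous_planeD hh 0).pow 2)).add
    ((continuous_planeD hh 1).pow 2))

namespace IsGraphChart

variable {Ω : Set Vec3} {x : Vec3} {b : OrthonormalBasis (Fin 3) ℝ Vec3} {h : Vec2 → ℝ}
  {V : Set Vec3} {ρ : ℝ}

theorem graphMap_zero (hc : IsGraphChart Ω x b h V ρ) : graphMap x b h 0 = x := by
  simp [graphMap, hc.apply_zero]

theorem exists_lipschitzWith (hc : IsGraphChart Ω x b h V ρ) :
    ∃ K : ℝ≥0, LipschitzWith K (graphMap x b h) := by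
  obtain ⟨K, hK⟩ := hc.contDiff.lipschitzWith_of_hasCompactSupport hc.hasCompactSupport (by simp)
  refine ⟨1 + K, LipschitzWith.of_dist_le_mul fun u v => ?_⟩
  have h1 := hK.dist_le_mul u v
  rw [Real.dist_eq, dist_eq_norm] at h1
  rw [dist_eq_norm, dist_eq_norm]
  refine le_of_sq_le_sq ?_ (by positivity)
  rw [norm_sq_graphMap_sub, ← sq_abs (h u - h v)]
  have h2 : |h u - h v| ^ 2 ≤ (K * ‖u - v‖) ^ 2 := by gcongr
  push_cast
  have h3 : 0 ≤ (K : ℝ) * ‖u - v‖ ^ 2 := by positivity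
  nlinarith

theorem exists_fderiv_le (hc : IsGraphChart Ω x b h V ρ) :
    ∃ M : ℝ, 0 ≤ M ∧ ∀ u, ‖fderiv ℝ h u‖ ≤ M * ‖u‖ := by
  have h1 : ContDiff ℝ 1 (fderiv ℝ h) := hc.contDiff.fderiv_right (by norm_num)
  obtain ⟨K, hK⟩ := h1.lipschitzWith_of_hasCompactSupport (hc.hasCompactSupport.fderiv ℝ) (by simp)
  refine ⟨K, K.2, fun u => ?_⟩
  have := hK.dist_le_mul u 0
  rwa [hc.fderiv_zero, dist_zero_right, dist_zero_right] at this

/-- Mean value inequality with a derivative of size `O(‖u‖)`: the boundary leaves its tangent plane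
only to second order. -/
theorem exists_abs_le (hc : IsGraphChart Ω x b h V ρ) :
    ∃ M : ℝ, 0 ≤ M ∧ ∀ u, |h u| ≤ M * ‖u‖ ^ 2 := by
  obtain ⟨M, hM, hb⟩ := hc.exists_fderiv_le
  refine ⟨M, hM, fun u => ?_⟩
  have h1 : ∀ w ∈ Metric.closedBall (0 : Vec2) ‖u‖, ‖fderiv ℝ h w‖ ≤ M * ‖u‖ := fun w hw => by
    refine (hb w).trans ?_
    have : ‖w‖ ≤ ‖u‖ := by simpa using hw
    gcongr
  have h2 := (convex_closedBall (0 : Vec2) ‖u‖).norm_image_sub_le_of_norm_fderiv_le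
    (fun w _ => hc.contDiff.differentiable (by simp) w) h1
    (x := 0) (y := u) (by simp) (by simp)
  rw [hc.apply_zero, sub_zero, sub_zero, Real.norm_eq_abs] at h2
  rw [sq, ← mul_assoc]
  exact h2

theorem exists_planeD_le (hc : IsGraphChart Ω x b h V ρ) :
    ∃ M : ℝ, 0 ≤ M ∧ ∀ i u, |planeD i h u| ≤ M * ‖u‖ := by
  obtain ⟨M, hM, hb⟩ := hc.exists_fderiv_le
  refine ⟨M, hM, fun i u => ?_⟩
  have := (fderiv ℝ h u).le_opNorm (EuclideanSpace.single i (1 : ℝ))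
  rw [Real.norm_eq_abs] at this
  refine this.trans ?_
  simpa using hb u

/-- For `J ≥ 1` one has `J - 1 ≤ J² - 1`, and `J² - 1` is the sum of the squared partial derivatives
of `h`. -/
theorem exists_graphDensity_sub_one_le (hc : IsGraphChart Ω x b h V ρ) :
    ∃ M : ℝ, 0 ≤ M ∧ ∀ u, |graphDensity h u - 1| ≤ M * ‖u‖ ^ 2 := by
  obtain ⟨M, hM, hb⟩ := hc.exists_planeD_le
  refine ⟨2 * M ^ 2, by positivity, fun u => ?_⟩
  have h0 : planeD 0 h u ^ 2 ≤ (M * ‖u‖) ^ 2 := by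
    rw [← sq_abs (planeD 0 h u)]; gcongr; exact hb 0 u
  have h1 : planeD 1 h u ^ 2 ≤ (M * ‖u‖) ^ 2 := by
    rw [← sq_abs (planeD 1 h u)]; gcongr; exact hb 1 u
  have h2 : 1 ≤ graphDensity h u := by
    rw [graphDensity, Real.one_le_sqrt, add_assoc]
    exact le_add_of_nonneg_right (by positivity)
  have h3 : graphDensity h u ^ 2 = 1 + planeD 0 h u ^ 2 + planeD 1 h u ^ 2 :=
    Real.sq_sqrt (by positivity)
  rw [abs_of_nonneg (by linarith)]
  nlinarith

theorem image_preimage_inter (hc : IsGraphChart Ω x b h V ρ) (s : Set Vec3) :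
    graphMap x b h '' (graphMap x b h ⁻¹' s ∩ Metric.ball 0 ρ) = s ∩ V ∩ frontier Ω := by
  rw [Set.image_preimage_inter, hc.image_ball, Set.inter_assoc, Set.inter_comm V]

theorem measurableEmbedding (hc : IsGraphChart Ω x b h V ρ) :
    MeasurableEmbedding (graphMap x b h) := by
  refine (contDiff_graphMap x b hc.contDiff).continuous.measurableEmbedding fun u v huv => ?_
  have := dist_le_dist_graphMap x b h u v
  rw [huv, dist_self] at this
  exact dist_le_zero.1 this

/-- The surface measure in a graph chart. -/
theorem restrict_surfaceMeasure (hc : IsGraphChart Ω x b h V ρ) :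
    (surfaceMeasure (frontier Ω)).restrict V = Measure.map (graphMap x b h)
      ((volume.restrict (Metric.ball 0 ρ)).withDensity
        fun u => ENNReal.ofReal (graphDensity h u)) := by
  obtain ⟨K, hK⟩ := hc.exists_lipschitzWith
  have hφ := contDiff_graphMap x b (hc.contDiff.of_le one_le_two)
  have hdim : Module.finrank ℝ Vec2 = 2 := by simp
  ext s hs
  have hms : MeasurableSet (graphMap x b h ⁻¹' s) := hφ.continuous.measurable hs
  rw [Measure.restrict_apply hs, surfaceMeasure,
    Measure.restrict_apply (hs.inter hc.isOpen.measurableSet),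
    Measure.map_apply hφ.continuous.measurable hs, withDensity_apply _ hms,
    Measure.restrict_restrict hms, ← hc.image_preimage_inter]
  have := euclideanHausdorffMeasure_image_eq_lintegral hφ hK (dist_le_dist_graphMap x b h)
    (graphMap x b h ⁻¹' s ∩ Metric.ball 0 ρ) (hms.inter Metric.isOpen_ball.measurableSet)
  rw [hdim] at this
  rw [this]
  refine lintegral_congr fun u => ?_
  rw [normDet_graphMap x b (hc.contDiff.differentiable (by simp) u)]
  rfl

theorem aestronglyMeasurable_comp {E : Type*} [NormedAddCommGroup E]
    (hc : IsGraphChart Ω x b h V ρ) {F : Vec3 → E}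
    (hF : AEStronglyMeasurable F (surfaceMeasure (frontier Ω))) :
    AEStronglyMeasurable (fun u => F (graphMap x b h u)) (volume.restrict (Metric.ball 0 ρ)) := by
  have h1 := hF.mono_measure (Measure.restrict_le_self (s := V))
  rw [hc.restrict_surfaceMeasure, hc.measurableEmbedding.aestronglyMeasurable_map_iff] at h1
  refine h1.mono_ac ?_
  refine withDensity_absolutelyContinuous' ?_ ?_
  · exact (continuous_graphDensity hc.contDiff).measurable.ennreal_ofReal.aemeasurable
  · refine ae_of_all _ fun u => ?_
    rw [Ne, ENNReal.ofReal_eq_zero, not_le]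
    exact Real.sqrt_pos.2 (by positivity)

/-- Integration over the surface in a graph chart. -/
theorem setIntegral_eq {E : Type*} [NormedAddCommGroup E] [NormedSpace ℝ E]
    (hc : IsGraphChart Ω x b h V ρ) (F : Vec3 → E) :
    ∫ y in V, F y ∂surfaceMeasure (frontier Ω)
      = ∫ u in Metric.ball 0 ρ, graphDensity h u • F (graphMap x b h u) := by
  rw [hc.restrict_surfaceMeasure, hc.measurableEmbedding.integral_map,
    integral_withDensity_eq_integral_toReal_smul]
  · simp [ENNReal.toReal_ofReal (graphDensity_nonneg h _)]
  · exact (continuous_graphDensity hc.contDiff).measurable.ennreal_ofReal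
  · exact ae_of_all _ fun u => ENNReal.ofReal_lt_top

/-- Projection sends the part of the surface in a ball of radius `r` into a disc of radius `r`, and
the `K`-Lipschitz chart maps that disc back with area at most `K²` times its own. -/
theorem exists_measure_closedBall_le (hc : IsGraphChart Ω x b h V ρ) :
    ∃ C : ℝ, 0 ≤ C ∧ ∀ ξ r, 0 ≤ r → (μHE[2] : Measure Vec3)
      ((frontier Ω ∩ V) ∩ Metric.closedBall ξ r) ≤ ENNReal.ofReal (C * r ^ 2) := by
  obtain ⟨K, hK⟩ := hc.exists_lipschitzWith
  refine ⟨K ^ 2 * (volume (Metric.ball (0 : Vec2) 1)).toReal, by positivity, fun ξ r hr => ?_⟩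
  have hsub : (frontier Ω ∩ V) ∩ Metric.closedBall ξ r
      ⊆ graphMap x b h '' Metric.closedBall (planeProj b (ξ - x)) r := by
    rintro y ⟨hy, hyr⟩
    rw [← hc.image_ball] at hy
    obtain ⟨u, -, rfl⟩ := hy
    refine ⟨u, ?_, rfl⟩
    have h1 := planeProj_norm_le b (graphMap x b h u - ξ)
    rw [← sub_sub_sub_cancel_right _ _ x, planeProj_sub, planeProj_graphMap] at h1
    rw [Metric.mem_closedBall, dist_eq_norm] at hyr ⊢
    refine h1.trans ?_
    rwa [sub_sub_sub_cancel_right]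
  refine (measure_mono hsub).trans ?_
  have h2 := euclideanHausdorffMeasure_image_le_of_dist_le (f := graphMap x b h) (g := id)
    (s := Metric.closedBall (planeProj b (ξ - x)) r) 2 fun a _ b _ => hK.dist_le_mul a b
  have hvol : (μHE[2] : Measure Vec2) = volume :=
    EuclideanSpace.euclideanHausdorffMeasure_eq_volume 2
  refine h2.trans ?_
  have h3 : volume (Metric.closedBall (planeProj b (ξ - x)) r)
      = ENNReal.ofReal (r ^ 2) * volume (Metric.ball (0 : Vec2) 1) := by
    rw [Measure.addHaar_closedBall _ _ hr]
    simp
  rw [hvol, Set.image_id, h3]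
  rw [mul_right_comm, ENNReal.ofReal_mul (by positivity), ENNReal.ofReal_mul (by positivity),
    ENNReal.ofReal_toReal measure_ball_lt_top.ne, ← mul_assoc, ENNReal.ofReal_pow K.coe_nonneg 2,
    ENNReal.ofReal_coe_nnreal]

end IsGraphChart

end

section

/-! ### Global properties of the boundary -/

namespace IsSmoothBoundedDomain

variable {Ω : Set Vec3}

theorem isCompact_frontier (hΩ : IsSmoothBoundedDomain Ω) : IsCompact (frontier Ω) :=
  Metric.isCompact_of_isClosed_isBounded isClosed_frontier
    (hΩ.isBounded.closure.subset frontier_subset_closure)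

theorem exists_isGraphChart (hΩ : IsSmoothBoundedDomain Ω) {x : Vec3} (hx : x ∈ frontier Ω) :
    ∃ b h V ρ, IsGraphChart Ω x b h V ρ := by
  obtain ⟨f, hf⟩ := hΩ.smoothBoundary x hx
  exact Poroelastic.exists_isGraphChart hΩ.isOpen hf

theorem norm_outwardNormal (hΩ : IsSmoothBoundedDomain Ω) {x : Vec3} (hx : x ∈ frontier Ω) :
    ‖outwardNormal Ω x‖ = 1 := by
  obtain ⟨f, hf⟩ := hΩ.smoothBoundary x hx
  exact hf.norm_outwardNormal

/-- The surface measure of a ball grows at most quadratically. -/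
theorem exists_surfaceMeasure_closedBall_le (hΩ : IsSmoothBoundedDomain Ω) :
    ∃ C : ℝ, 0 ≤ C ∧ ∀ ξ r, 0 ≤ r →
      surfaceMeasure (frontier Ω) (Metric.closedBall ξ r) ≤ ENNReal.ofReal (C * r ^ 2) := by
  have key : ∃ C : ℝ, 0 ≤ C ∧ ∀ ξ r, 0 ≤ r → (μHE[2] : Measure Vec3)
      (frontier Ω ∩ Metric.closedBall ξ r) ≤ ENNReal.ofReal (C * r ^ 2) := by
    refine hΩ.isCompact_frontier.induction_on (p := fun S => ∃ C : ℝ, 0 ≤ C ∧ ∀ ξ r, 0 ≤ r →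
      (μHE[2] : Measure Vec3) (S ∩ Metric.closedBall ξ r) ≤ ENNReal.ofReal (C * r ^ 2)) ?_ ?_ ?_ ?_
    · exact ⟨0, le_rfl, fun ξ r _ => by simp⟩
    · rintro s t hst ⟨C, hC, h⟩
      exact ⟨C, hC, fun ξ r hr =>
        (measure_mono (Set.inter_subset_inter_left _ hst)).trans (h ξ r hr)⟩
    · rintro s t ⟨C, hC, h⟩ ⟨D, hD, h'⟩
      refine ⟨C + D, by positivity, fun ξ r hr => ?_⟩
      rw [Set.union_inter_distrib_right, add_mul, ENNReal.ofReal_add (by positivity)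
        (by positivity)]
      exact (measure_union_le _ _).trans (add_le_add (h ξ r hr) (h' ξ r hr))
    · intro x hx
      obtain ⟨b, h, V, ρ, hc⟩ := hΩ.exists_isGraphChart hx
      exact ⟨frontier Ω ∩ V, inter_mem_nhdsWithin _ (hc.isOpen.mem_nhds hc.mem),
        hc.exists_measure_closedBall_le⟩
  obtain ⟨C, hC, h⟩ := key
  refine ⟨C, hC, fun ξ r hr => ?_⟩
  rw [surfaceMeasure, Measure.restrict_apply Metric.isClosed_closedBall.measurableSet,
    Set.inter_comm]
  exact h ξ r hr

theorem ae_mem_frontier (Ω : Set Vec3) : ∀ᵐ y ∂surfaceMeasure (frontier Ω), y ∈ frontier Ω :=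
  ae_restrict_mem isClosed_frontier.measurableSet

theorem exists_norm_le (hΩ : IsSmoothBoundedDomain Ω) :
    ∃ M : ℝ, 0 < M ∧ ∀ y ∈ frontier Ω, ‖y‖ ≤ M :=
  hΩ.isCompact_frontier.isBounded.exists_pos_norm_le

theorem isFiniteMeasure (hΩ : IsSmoothBoundedDomain Ω) :
    IsFiniteMeasure (surfaceMeasure (frontier Ω)) := by
  obtain ⟨C, hC, h⟩ := hΩ.exists_surfaceMeasure_closedBall_le
  obtain ⟨M, hM, hb⟩ := hΩ.exists_norm_le
  refine ⟨?_⟩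
  have h1 : surfaceMeasure (frontier Ω) univ
      ≤ surfaceMeasure (frontier Ω) (Metric.closedBall 0 M) := by
    refine measure_mono_ae ?_
    filter_upwards [ae_mem_frontier Ω] with y hy _
    exact mem_closedBall_zero_iff.2 (hb y hy)
  exact (h1.trans (h 0 M hM.le)).trans_lt ENNReal.ofReal_lt_top

/-- Only `ξ` is confined to a neighbourhood of `x`; the other point runs over the whole surface, as
integration variables do. If `y` is farther than `r` from `x`, then `‖ξ - y‖ ≥ r / 2`, and the
trivial bound `2` for a difference of unit vectors is absorbed by the constant `4 / r`. -/
theorem exists_normal_lipschitz (hΩ : IsSmoothBoundedDomain Ω) {x : Vec3} (hx : x ∈ frontier Ω) :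
    ∃ C : ℝ, 0 ≤ C ∧ ∃ ρ > 0, ∀ ξ ∈ frontier Ω, ‖ξ - x‖ < ρ → ∀ y ∈ frontier Ω,
      ‖outwardNormal Ω ξ - outwardNormal Ω y‖ ≤ C * ‖ξ - y‖ := by
  obtain ⟨f, hf⟩ := hΩ.smoothBoundary x hx
  have hg : ContDiff ℝ 1 (gradient f) :=
    (InnerProductSpace.toDual ℝ Vec3).symm.contDiff.comp (hf.smooth.fderiv_right (m := 1)
      (WithTop.coe_le_coe.2 le_top))
  have hN : ContDiffAt ℝ 1 (fun y => ‖gradient f y‖⁻¹ • gradient f y) x :=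
    ((hg.contDiffAt.norm ℝ hf.gradient_ne).inv (norm_ne_zero_iff.2 hf.gradient_ne)).smul
      hg.contDiffAt
  obtain ⟨K, s, hs, hK⟩ := hN.exists_lipschitzOnWith
  have hW : ∀ᶠ y in 𝓝 x, y ∈ s ∧ (y ∈ frontier Ω →
      outwardNormal Ω y = ‖gradient f y‖⁻¹ • gradient f y) := by
    filter_upwards [hf.eventually_mem_frontier hΩ.isOpen, hs] with y hy hys
    exact ⟨hys, fun h => (hy.2 (hy.1.1 h)).outwardNormal_eq⟩
  obtain ⟨r, hr, hball⟩ := Metric.eventually_nhds_iff_ball.1 hW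
  refine ⟨K + 4 / r, by positivity, r / 2, by positivity, fun ξ hξ hξr y hy => ?_⟩
  have hξb : ξ ∈ Metric.ball x r := by
    rw [Metric.mem_ball, dist_eq_norm]
    linarith
  by_cases hyr : y ∈ Metric.ball x r
  · rw [(hball ξ hξb).2 hξ, (hball y hyr).2 hy, ← dist_eq_norm, ← dist_eq_norm]
    refine (hK.dist_le_mul ξ (hball ξ hξb).1 y (hball y hyr).1).trans ?_
    gcongr
    have : 0 ≤ 4 / r := by positivity
    linarith
  · have h1 : ‖outwardNormal Ω ξ - outwardNormal Ω y‖ ≤ 2 := by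
      refine (norm_sub_le _ _).trans ?_
      rw [hΩ.norm_outwardNormal hξ, hΩ.norm_outwardNormal hy]
      norm_num
    have h2 : r / 2 ≤ ‖ξ - y‖ := by
      rw [Metric.mem_ball, dist_eq_norm, not_lt] at hyr
      have := norm_sub_le_norm_sub_add_norm_sub y ξ x
      rw [norm_sub_rev y ξ] at this
      linarith
    have h3 : 2 ≤ 4 / r * ‖ξ - y‖ := by
      calc (2 : ℝ) = 4 / r * (r / 2) := by field_simp; norm_num
        _ ≤ _ := by gcongr
    have h4 : 0 ≤ K * ‖ξ - y‖ := by positivity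
    linarith

theorem continuousOn_outwardNormal (hΩ : IsSmoothBoundedDomain Ω) :
    ContinuousOn (outwardNormal Ω) (frontier Ω) := by
  intro x hx
  obtain ⟨C, hC, ρ, hρ, h⟩ := hΩ.exists_normal_lipschitz hx
  rw [ContinuousWithinAt, tendsto_iff_norm_sub_tendsto_zero]
  have h1 : Tendsto (fun y => C * ‖x - y‖) (𝓝[frontier Ω] x) (𝓝 0) := by
    have : Continuous fun y => C * ‖x - y‖ := by fun_prop
    simpa using (this.tendsto x).mono_left nhdsWithin_le_nhds
  refine squeeze_zero' (Eventually.of_forall fun y => norm_nonneg _) ?_ h1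
  filter_upwards [self_mem_nhdsWithin] with y hy
  rw [norm_sub_rev]
  exact h x hx (by simpa using hρ) y hy

theorem aestronglyMeasurable_of_continuousOn {E : Type*} [NormedAddCommGroup E]
    {F : Vec3 → E} (hF : ContinuousOn F (frontier Ω)) :
    AEStronglyMeasurable F (surfaceMeasure (frontier Ω)) :=
  hF.aestronglyMeasurable isClosed_frontier.measurableSet

theorem integrable_of_continuousOn (hΩ : IsSmoothBoundedDomain Ω) {E : Type*}
    [NormedAddCommGroup E] {F : Vec3 → E} (hF : ContinuousOn F (frontier Ω)) :
    Integrable F (surfaceMeasure (frontier Ω)) := by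
  have := hΩ.isFiniteMeasure
  obtain ⟨C, hC⟩ := hΩ.isCompact_frontier.exists_bound_of_continuousOn hF
  exact Integrable.of_bound (aestronglyMeasurable_of_continuousOn hF) C
    ((ae_mem_frontier Ω).mono hC)

/-- Near `x` this is the quadratic bound on the graph function. Outside the ball of radius `r` it
suffices that `‖y - x‖ ≤ ‖y - x‖² / r`. -/
theorem exists_inner_normal_le (hΩ : IsSmoothBoundedDomain Ω) {x : Vec3} (hx : x ∈ frontier Ω) :
    ∃ C : ℝ, 0 ≤ C ∧ ∀ y ∈ frontier Ω, |inner ℝ (outwardNormal Ω x) (y - x)| ≤ C * ‖y - x‖ ^ 2 := by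
  obtain ⟨b, h, V, ρ, hc⟩ := hΩ.exists_isGraphChart hx
  obtain ⟨M, hM, hb⟩ := hc.exists_abs_le
  obtain ⟨r, hr, hball⟩ := Metric.isOpen_iff.1 hc.isOpen x hc.mem
  refine ⟨M + 1 / r, by positivity, fun y hy => ?_⟩
  have hMn : 0 ≤ M * ‖y - x‖ ^ 2 := by positivity
  have hrn : 0 ≤ 1 / r * ‖y - x‖ ^ 2 := by positivity
  by_cases hyr : y ∈ Metric.ball x r
  · have hyV : y ∈ graphMap x b h '' Metric.ball 0 ρ := by
      rw [hc.image_ball]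
      exact ⟨hy, hball hyr⟩
    obtain ⟨u, -, rfl⟩ := hyV
    have h1 := (inner_graphMap_sub x b h u 0).2.2
    rw [hc.graphMap_zero, hc.apply_zero, sub_zero, hc.basis_two] at h1
    rw [h1]
    refine (hb u).trans ?_
    have h2 := dist_le_dist_graphMap x b h u 0
    rw [hc.graphMap_zero, dist_zero_right, dist_eq_norm] at h2
    have h3 : M * ‖u‖ ^ 2 ≤ M * ‖graphMap x b h u - x‖ ^ 2 := by gcongr
    rw [add_mul]
    linarith
  · rw [Metric.mem_ball, dist_eq_norm, not_lt] at hyr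
    refine (abs_real_inner_le_norm _ _).trans ?_
    rw [hΩ.norm_outwardNormal hx, one_mul]
    have : ‖y - x‖ ≤ 1 / r * ‖y - x‖ ^ 2 := by
      rw [one_div, inv_mul_eq_div, le_div_iff₀ hr]
      nlinarith [norm_nonneg (y - x)]
    rw [add_mul]
    linarith

end IsSmoothBoundedDomain

end

section

/-! ### Stokes' theorem on the boundary -/

theorem partialD_eq_basis (b : OrthonormalBasis (Fin 3) ℝ Vec3) (f : Vec3 → ℂ) (y : Vec3)
    (j : Fin 3) : partialD j f y = (b 0 j : ℂ) * fderiv ℝ f y (b 0) + (b 1 j : ℂ) * fderiv ℝ f y (b 1)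
      + (b 2 j : ℂ) * fderiv ℝ f y (b 2) := by
  have h := basis_expand b (EuclideanSpace.single j (1 : ℝ))
  simp only [EuclideanSpace.inner_single_right, one_mul, conj_trivial] at h
  rw [partialD, dirDeriv, h]
  simp only [map_add, map_smul, Complex.real_smul]

/-- Integration by parts against the constant function one. -/
theorem integral_fderiv_single_eq_zero {F : Vec2 → ℂ} (hF : ContDiff ℝ 1 F)
    (hs : HasCompactSupport F) (v : Vec2) :
    Integrable (fun u => fderiv ℝ F u v) ∧ ∫ u, fderiv ℝ F u v = 0 := by
  have hc : Continuous fun u => fderiv ℝ F u v :=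
    (hF.continuous_fderiv one_ne_zero).clm_apply continuous_const
  have hi : Integrable fun u => fderiv ℝ F u v :=
    hc.integrable_of_hasCompactSupport (hs.fderiv_apply ℝ v)
  refine ⟨hi, ?_⟩
  have := integral_smul_fderiv_eq_neg_fderiv_smul_of_integrable (μ := (volume : Measure Vec2))
    (f := fun _ : Vec2 => (1 : ℝ)) (g := F) (v := v) (by simp) (by simpa using hi)
    (by simpa using hF.continuous.integrable_of_hasCompactSupport hs)
    (fun x _ => differentiableAt_const _) (fun x _ => hF.differentiable one_ne_zero x)
  simpa using this

theorem contDiff_planeD {h : Vec2 → ℝ} (hh : ContDiff ℝ 2 h) (i : Fin 2) :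
    ContDiff ℝ 1 (planeD i h) :=
  (hh.fderiv_right (m := 1) (by norm_num)).clm_apply contDiff_const

theorem integral_planeD_smul_fderiv {h : Vec2 → ℝ} (hh : ContDiff ℝ 2 h) {F : Vec2 → ℂ}
    (hF : ContDiff ℝ 1 F) (hs : HasCompactSupport F) (i : Fin 2) (v : Vec2) :
    Integrable (fun u => planeD i h u • fderiv ℝ F u v) ∧
    ∫ u, planeD i h u • fderiv ℝ F u v = - ∫ u, fderiv ℝ (planeD i h) u v • F u := by
  have hd := contDiff_planeD hh i
  have hc : Continuous fun u => fderiv ℝ F u v :=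
    (hF.continuous_fderiv one_ne_zero).clm_apply continuous_const
  have hc' : Continuous fun u => fderiv ℝ (planeD i h) u v :=
    (hd.continuous_fderiv one_ne_zero).clm_apply continuous_const
  have hi : Integrable fun u => planeD i h u • fderiv ℝ F u v :=
    (hd.continuous.smul hc).integrable_of_hasCompactSupport ((hs.fderiv_apply ℝ v).smul_left)
  exact ⟨hi, integral_smul_fderiv_eq_neg_fderiv_smul_of_integrable
    ((hc'.smul hF.continuous).integrable_of_hasCompactSupport hs.smul_left) hi
    ((hd.continuous.smul hF.continuous).integrable_of_hasCompactSupport hs.smul_left)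
    (fun x _ => hd.differentiable one_ne_zero x) (fun x _ => hF.differentiable one_ne_zero x)⟩

theorem fderiv_planeD_comm {h : Vec2 → ℝ} (hh : ContDiff ℝ 2 h) (u : Vec2) :
    fderiv ℝ (planeD 0 h) u (EuclideanSpace.single 1 1)
      = fderiv ℝ (planeD 1 h) u (EuclideanSpace.single 0 1) := by
  have hsym : IsSymmSndFDerivAt ℝ h u := hh.contDiffAt.isSymmSndFDerivAt (by simp)
  have hd : DifferentiableAt ℝ (fderiv ℝ h) u :=
    (hh.fderiv_right (m := 1) (by norm_num)).differentiable one_ne_zero u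
  have key : ∀ (i : Fin 2) (v : Vec2), fderiv ℝ (planeD i h) u v
      = fderiv ℝ (fderiv ℝ h) u v (EuclideanSpace.single i 1) := fun i v => by
    have := (hd.hasFDerivAt.clm_apply (hasFDerivAt_const (EuclideanSpace.single i (1 : ℝ)) u)).fderiv
    change fderiv ℝ (fun y => fderiv ℝ h y (EuclideanSpace.single i 1)) u v = _
    rw [this]
    simp
  rw [key, key]
  exact hsym _ _

/-- The area density cancels the normalisation of `ν`, and the integrand becomes a combination of
derivatives of `F = f ∘ φ`: the derivative of `f` along `b₂` occurs only as the chain rule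
prescribes. The terms with constant coefficients integrate to zero. In `∂₁h ∂₀F - ∂₀h ∂₁F` an
integration by parts leaves the difference of the mixed second derivatives of `h`, which vanishes.
-/
theorem IsGraphChart.integral_normal_wedge_grad {Ω : Set Vec3} {x : Vec3}
    {b : OrthonormalBasis (Fin 3) ℝ Vec3} {h : Vec2 → ℝ} {V : Set Vec3} {ρ : ℝ}
    (hc : IsGraphChart Ω x b h V ρ) {f : Vec3 → ℂ} (hf : ContDiff ℝ 1 f) (hfs : tsupport f ⊆ V)
    (i j : Fin 3) :
    ∫ y, ((outwardNormal Ω y i : ℂ) * partialD j f y - (outwardNormal Ω y j : ℂ) * partialD i f y)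
      ∂surfaceMeasure (frontier Ω) = 0 := by
  have hφ : ContDiff ℝ 1 (graphMap x b h) := contDiff_graphMap x b (hc.contDiff.of_le one_le_two)
  have hfd : ∀ y ∉ tsupport f, fderiv ℝ f y = 0 := fun y hy =>
    image_eq_zero_of_notMem_tsupport fun hy' => hy (tsupport_fderiv_subset ℝ hy')
  have hpd : ∀ y ∉ tsupport f, ∀ k, partialD k f y = 0 := fun y hy k => by
    simp [partialD, dirDeriv, hfd y hy]
  set F : Vec2 → ℂ := fun u => f (graphMap x b h u) with hFdef
  have hF : ContDiff ℝ 1 F := hf.comp hφ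
  have hballsub : ∀ u, graphMap x b h u ∈ tsupport f → u ∈ Metric.ball (0 : Vec2) ρ := fun u hu => by
    have := hc.planeProj_mem _ (hfs hu)
    rwa [planeProj_graphMap] at this
  have hFs : HasCompactSupport F := by
    refine HasCompactSupport.of_support_subset_isCompact
      (K := graphMap x b h ⁻¹' tsupport f) ?_ fun u hu => subset_tsupport f hu
    refine Metric.isCompact_of_isClosed_isBounded
      ((isClosed_tsupport f).preimage hφ.continuous) ?_
    exact Metric.isBounded_ball.subset hballsub
  set D : Fin 2 → Vec2 → ℂ := fun k u => fderiv ℝ F u (EuclideanSpace.single k 1) with hD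
  have hDF : ∀ u, D 0 u = fderiv ℝ f (graphMap x b h u) (b 0)
        + planeD 0 h u * fderiv ℝ f (graphMap x b h u) (b 2) ∧
      D 1 u = fderiv ℝ f (graphMap x b h u) (b 1)
        + planeD 1 h u * fderiv ℝ f (graphMap x b h u) (b 2) := fun u => by
    have h1 : fderiv ℝ F u = (fderiv ℝ f (graphMap x b h u)).comp (fderiv ℝ (graphMap x b h) u) :=
      ((hf.differentiable one_ne_zero _).hasFDerivAt.comp u
        (hφ.differentiable one_ne_zero u).hasFDerivAt).fderiv
    obtain ⟨e0, e1⟩ := fderiv_graphMap_single x b (hc.contDiff.differentiable (by simp) u)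
    simp only [hD, h1, ContinuousLinearMap.comp_apply, e0, e1, map_add, map_smul,
      Complex.real_smul, and_self]
  rw [← setIntegral_eq_integral_of_forall_compl_eq_zero (s := V), hc.setIntegral_eq]
  swap
  · intro y hy
    have := hpd y fun h => hy (hfs h)
    simp [this]
  -- The `(i, j)` components of the bivectors `b₂ ∧ b₀`, `b₂ ∧ b₁` and `b₀ ∧ b₁`.
  set c0 : ℂ := (b 2 i : ℂ) * b 0 j - b 2 j * b 0 i
  set c1 : ℂ := (b 2 i : ℂ) * b 1 j - b 2 j * b 1 i
  set c2 : ℂ := (b 0 i : ℂ) * b 1 j - b 0 j * b 1 i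
  have hpt : ∀ u ∈ Metric.ball (0 : Vec2) ρ,
      graphDensity h u • ((outwardNormal Ω (graphMap x b h u) i : ℂ)
          * partialD j f (graphMap x b h u)
        - (outwardNormal Ω (graphMap x b h u) j : ℂ) * partialD i f (graphMap x b h u))
      = c0 * D 0 u + c1 * D 1 u + c2 * (planeD 1 h u • D 0 u - planeD 0 h u • D 1 u) := by
    intro u hu
    have hn := hc.normal u hu
    have hni : ∀ k, (graphDensity h u : ℂ) * (outwardNormal Ω (graphMap x b h u) k : ℂ)
        = b 2 k - planeD 0 h u * b 0 k - planeD 1 h u * b 1 k := fun k => by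
      have := congrArg (fun v : Vec3 => v k) hn
      simp only [PiLp.smul_apply, PiLp.sub_apply, smul_eq_mul] at this
      rw [graphDensity]
      exact_mod_cast this
    rw [partialD_eq_basis b, partialD_eq_basis b, Complex.real_smul, mul_sub, ← mul_assoc,
      ← mul_assoc, hni, hni, (hDF u).1, (hDF u).2]
    simp only [Complex.real_smul, c0, c1, c2]
    ring
  rw [setIntegral_congr_fun Metric.isOpen_ball.measurableSet hpt,
    setIntegral_eq_integral_of_forall_compl_eq_zero]
  swap
  · intro u hu
    have hu' : graphMap x b h u ∉ tsupport f := fun h => hu (hballsub u h)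
    rw [(hDF u).1, (hDF u).2, hfd _ hu']
    simp
  obtain ⟨i0, z0⟩ := integral_fderiv_single_eq_zero hF hFs (EuclideanSpace.single 0 1)
  obtain ⟨i1, z1⟩ := integral_fderiv_single_eq_zero hF hFs (EuclideanSpace.single 1 1)
  obtain ⟨i2, z2⟩ := integral_planeD_smul_fderiv hc.contDiff hF hFs 1 (EuclideanSpace.single 0 1)
  obtain ⟨i3, z3⟩ := integral_planeD_smul_fderiv hc.contDiff hF hFs 0 (EuclideanSpace.single 1 1)
  simp only [hD]
  have j0 : Integrable fun u => c0 * fderiv ℝ F u (EuclideanSpace.single 0 1)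
      + c1 * fderiv ℝ F u (EuclideanSpace.single 1 1) := (i0.const_mul _).add (i1.const_mul _)
  have j1 : Integrable fun u => c2 * (planeD 1 h u • fderiv ℝ F u (EuclideanSpace.single 0 1)
      - planeD 0 h u • fderiv ℝ F u (EuclideanSpace.single 1 1)) := (i2.sub i3).const_mul _
  rw [integral_add j0 j1,
    integral_add (i0.const_mul _) (i1.const_mul _), integral_const_mul, integral_const_mul,
    integral_const_mul, z0, z1, integral_sub i2 i3, z2, z3]
  simp only [fderiv_planeD_comm hc.contDiff]
  simp

/-- The sum must be one on a neighbourhood of each point of `Γ`, since gradients of functions are to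
be decomposed and not only their values. Hence the partition is built over a compact `K` whose
interior contains `Γ`. -/
theorem exists_finite_partition_of_unity {Γ : Set Vec3} (hΓ : IsCompact Γ) {U : Vec3 → Set Vec3}
    (hU : ∀ x ∈ Γ, IsOpen (U x) ∧ x ∈ U x) :
    ∃ (t : Finset Γ) (χ : t → Vec3 → ℝ), (∀ k, ContDiff ℝ 1 (χ k)) ∧
      (∀ k, tsupport (χ k) ⊆ U k) ∧ ∀ x ∈ Γ, ∀ᶠ y in 𝓝 x, ∑ k, χ k y = 1 := by
  obtain ⟨t, ht⟩ := hΓ.elim_finite_subcover (fun x : Γ => U x) (fun x => (hU x x.2).1)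
    fun x hx => Set.mem_iUnion.2 ⟨⟨x, hx⟩, (hU x hx).2⟩
  have ht' : Γ ⊆ ⋃ k : t, U k := fun x hx => by
    obtain ⟨k, hk, hx'⟩ := Set.mem_iUnion₂.1 (ht hx)
    exact Set.mem_iUnion.2 ⟨⟨k, hk⟩, hx'⟩
  have hopen : IsOpen (⋃ k : t, U k) := isOpen_iUnion fun k => (hU _ k.1.2).1
  obtain ⟨K, hK, hΓK, hKU⟩ := exists_compact_between hΓ hopen ht'
  obtain ⟨f, hf⟩ := SmoothPartitionOfUnity.exists_isSubordinate (modelWithCornersSelf ℝ Vec3)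
    hK.isClosed (fun k : t => U k) (fun k => (hU _ k.1.2).1) hKU
  refine ⟨t, fun k => f k, fun k => ?_, hf, fun x hx => ?_⟩
  · exact ((f k).contMDiff.contDiff).of_le (WithTop.coe_le_coe.2 le_top)
  · filter_upwards [mem_interior_iff_mem_nhds.1 (hΓK hx)] with y hy
    have := f.sum_eq_one hy
    rwa [finsum_eq_sum_of_fintype] at this

theorem continuous_partialD {f : Vec3 → ℂ} (hf : ContDiff ℝ 1 f) (i : Fin 3) :
    Continuous (partialD i f) :=
  (hf.continuous_fderiv one_ne_zero).clm_apply continuous_const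

/-- Stokes' theorem: `∫ (νᵢ ∂ⱼ f - νⱼ ∂ᵢ f) ds = 0` on a closed surface. -/
theorem IsSmoothBoundedDomain.integral_normal_wedge_grad {Ω : Set Vec3}
    (hΩ : IsSmoothBoundedDomain Ω) {f : Vec3 → ℂ} (hf : ContDiff ℝ 1 f) (i j : Fin 3) :
    ∫ y, ((outwardNormal Ω y i : ℂ) * partialD j f y - (outwardNormal Ω y j : ℂ) * partialD i f y)
      ∂surfaceMeasure (frontier Ω) = 0 := by
  classical
  choose! b h V ρ hc using fun (x : Vec3) (hx : x ∈ frontier Ω) => hΩ.exists_isGraphChart hx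
  obtain ⟨t, χ, hχs, hχV, hχ1⟩ := exists_finite_partition_of_unity hΩ.isCompact_frontier
    fun x hx => ⟨(hc x hx).isOpen, (hc x hx).mem⟩
  have hfs : ∀ k, ContDiff ℝ 1 fun y => (χ k y : ℂ) * f y := fun k =>
    (Complex.ofRealCLM.contDiff.comp (hχs k)).mul hf
  have hsum : ∀ l, ∀ y ∈ frontier Ω,
      partialD l f y = ∑ k, partialD l (fun y => (χ k y : ℂ) * f y) y := fun l y hy => by
    have h1 : f =ᶠ[𝓝 y] fun w => ∑ k, (χ k w : ℂ) * f w := by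
      filter_upwards [hχ1 y hy] with w hw
      rw [← Finset.sum_mul, ← Complex.ofReal_sum, hw, Complex.ofReal_one, one_mul]
    rw [partialD, dirDeriv, h1.fderiv_eq,
      fderiv_fun_sum fun k _ => (hfs k).differentiable one_ne_zero y]
    simp [partialD, dirDeriv]
  have hcn : ∀ l, ContinuousOn (fun y => (outwardNormal Ω y l : ℂ)) (frontier Ω) := fun l =>
    Complex.continuous_ofReal.comp_continuousOn
      ((EuclideanSpace.proj l : Vec3 →L[ℝ] ℝ).continuous.comp_continuousOn
        hΩ.continuousOn_outwardNormal)
  calc ∫ y, ((outwardNormal Ω y i : ℂ) * partialD j f y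
        - (outwardNormal Ω y j : ℂ) * partialD i f y) ∂surfaceMeasure (frontier Ω)
      = ∫ y, ∑ k, ((outwardNormal Ω y i : ℂ) * partialD j (fun y => (χ k y : ℂ) * f y) y
        - (outwardNormal Ω y j : ℂ) * partialD i (fun y => (χ k y : ℂ) * f y) y)
          ∂surfaceMeasure (frontier Ω) := by
        refine integral_congr_ae ?_
        filter_upwards [ae_mem_frontier Ω] with y hy
        rw [hsum j y hy, hsum i y hy, Finset.sum_sub_distrib, Finset.mul_sum, Finset.mul_sum]
    _ = ∑ k, ∫ y, ((outwardNormal Ω y i : ℂ) * partialD j (fun y => (χ k y : ℂ) * f y) y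
        - (outwardNormal Ω y j : ℂ) * partialD i (fun y => (χ k y : ℂ) * f y) y)
          ∂surfaceMeasure (frontier Ω) := by
        refine integral_finsetSum _ fun k _ => hΩ.integrable_of_continuousOn ?_
        exact ((hcn i).mul (continuous_partialD (hfs k) j).continuousOn).sub
          ((hcn j).mul (continuous_partialD (hfs k) i).continuousOn)
    _ = 0 := Finset.sum_eq_zero fun k _ => by
        refine (hc _ k.1.2).integral_normal_wedge_grad (hfs k) (subset_trans ?_ (hχV k)) i j
        refine (tsupport_mul_subset_left).trans ?_
        exact closure_mono fun y hy => by simpa using hy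

end

section

/-! ### Radial profiles of the Helmholtz kernel -/

/-- The profile `exp(i k ρ) / (4 π ρ)`. -/
def kG (k : ℂ) (ρ : ℝ) : ℂ := Complex.exp (Complex.I * k * ρ) / (4 * Real.pi * ρ)

/-- `kA k ρ = ρ⁻¹ d/dρ (kG k ρ)`. -/
def kA (k : ℂ) (ρ : ℝ) : ℂ :=
  (Complex.I * k * ρ - 1) * Complex.exp (Complex.I * k * ρ) / (4 * Real.pi * ρ ^ 3)

/-- `kB k ρ = ρ⁻¹ d/dρ (kA k ρ)`. -/
def kB (k : ℂ) (ρ : ℝ) : ℂ :=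
  ((Complex.I * k * ρ) ^ 2 - 3 * (Complex.I * k * ρ) + 3) * Complex.exp (Complex.I * k * ρ) /
    (4 * Real.pi * ρ ^ 5)

theorem helmholtz_eq (k : ℂ) (x y : Vec3) : helmholtz k x y = kG k ‖x - y‖ := rfl

theorem hasDerivAt_cexp_mul (k : ℂ) (ρ : ℝ) :
    HasDerivAt (fun ρ : ℝ => Complex.exp (Complex.I * k * ρ))
      (Complex.exp (Complex.I * k * ρ) * (Complex.I * k)) ρ := by
  have h1 : HasDerivAt (fun ρ : ℝ => Complex.I * k * (ρ : ℂ)) (Complex.I * k) ρ := by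
    simpa using (Complex.ofRealCLM.hasDerivAt (x := ρ)).const_mul (Complex.I * k)
  exact h1.cexp

theorem hasDerivAt_kG (k : ℂ) {ρ : ℝ} (hρ : ρ ≠ 0) : HasDerivAt (kG k) (kA k ρ * ρ) ρ := by
  have hρ' : (ρ : ℂ) ≠ 0 := by exact_mod_cast hρ
  have hpi : (Real.pi : ℂ) ≠ 0 := by exact_mod_cast Real.pi_ne_zero
  have h1 : HasDerivAt (fun ρ : ℝ => (ρ : ℂ)) 1 ρ := by
    simpa using (hasDerivAt_id ρ).ofReal_comp
  have h2 := (hasDerivAt_cexp_mul k ρ).div (h1.const_mul (4 * Real.pi : ℂ))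
    (mul_ne_zero (mul_ne_zero (by norm_num) hpi) hρ')
  refine h2.congr_deriv ?_
  simp only [kA]
  field_simp

theorem hasDerivAt_kA (k : ℂ) {ρ : ℝ} (hρ : ρ ≠ 0) : HasDerivAt (kA k) (kB k ρ * ρ) ρ := by
  have hρ' : (ρ : ℂ) ≠ 0 := by exact_mod_cast hρ
  have hpi : (Real.pi : ℂ) ≠ 0 := by exact_mod_cast Real.pi_ne_zero
  have h1 : HasDerivAt (fun ρ : ℝ => (ρ : ℂ)) 1 ρ := by
    simpa using (hasDerivAt_id ρ).ofReal_comp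
  have h2 := (((h1.const_mul (Complex.I * k)).sub_const 1).mul (hasDerivAt_cexp_mul k ρ)).div
    ((h1.pow 3).const_mul (4 * Real.pi : ℂ))
    (mul_ne_zero (mul_ne_zero (by norm_num) hpi) (pow_ne_zero 3 hρ'))
  refine h2.congr_deriv ?_
  simp only [kB]
  field_simp
  simp
  ring

/-- The Helmholtz equation for the profiles. -/
theorem three_kA_add (k : ℂ) {ρ : ℝ} (hρ : ρ ≠ 0) :
    3 * kA k ρ + kB k ρ * ρ ^ 2 = -(k ^ 2 * kG k ρ) := by
  have hρ' : (ρ : ℂ) ≠ 0 := by exact_mod_cast hρ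
  have hpi : (Real.pi : ℂ) ≠ 0 := by exact_mod_cast Real.pi_ne_zero
  simp only [kA, kB, kG]
  field_simp
  linear_combination (k ^ 2 * ρ ^ 2) * Complex.I_sq

/-- With `w = ikρ`, the products `(w - 1)(1 + w) = w² - 1` and `(w² - 3w + 3)(1 + w) = w³ - 2w² + 3`
have no linear term. Together with `e^w - 1 - w = O(w²)` this makes the error, once the static
singularity is removed, smaller by two powers of `ρ` instead of one. -/
theorem exists_profile_bounds (k : ℂ) (M : ℝ) : ∃ C : ℝ, 0 ≤ C ∧ ∀ ρ : ℝ, 0 < ρ → ρ ≤ M →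
    ‖kG k ρ‖ ≤ C / ρ ∧ ‖kA k ρ‖ ≤ C / ρ ^ 3 ∧ ‖kB k ρ‖ ≤ C / ρ ^ 5 ∧
      ‖kA k ρ + 1 / (4 * Real.pi * ρ ^ 3)‖ ≤ C / ρ ∧
      ‖kB k ρ - 3 / (4 * Real.pi * ρ ^ 5)‖ ≤ C / ρ ^ 3 := by
  set m := ‖k‖ * |M|
  set e := Real.exp m
  have he : 0 < e := Real.exp_pos _
  set K := ‖k‖ ^ 2
  -- Three nonnegative summands: the first serves the bounds on the profiles themselves, the second
  -- the error of `kA`, the third the error of `kB`.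
  set C : ℝ := (m ^ 2 + 3 * m + 3) * e + (K + (m + 1) * (K * e)) +
    (m * K + 2 * K + (m ^ 2 + 3 * m + 3) * (K * e))
  have hm : 0 ≤ m := by positivity
  have hK : 0 ≤ K := by positivity
  refine ⟨C, by positivity, fun ρ hρ hρM => ?_⟩
  set w : ℂ := Complex.I * k * ρ with hw
  have hwn : ‖w‖ = ‖k‖ * ρ := by
    simp [hw, abs_of_pos hρ]
  clear_value w
  have hwm : ‖w‖ ≤ m := by
    rw [hwn]
    exact mul_le_mul_of_nonneg_left (hρM.trans (le_abs_self M)) (norm_nonneg _)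
  have hw2 : ‖w‖ ^ 2 = K * ρ ^ 2 := by rw [hwn]; ring
  have hE : ‖Complex.exp w‖ ≤ e :=
    (Complex.norm_exp_le_exp_norm w).trans (Real.exp_le_exp.2 hwm)
  have hR : ‖Complex.exp w - (1 + w)‖ ≤ K * e * ρ ^ 2 := by
    have := Complex.norm_exp_sub_sum_le_norm_mul_exp w 2
    simp only [Finset.sum_range_succ, Finset.sum_range_zero, pow_zero, pow_one] at this
    norm_num at this
    refine this.trans ?_
    rw [hw2, mul_right_comm]
    gcongr
    exact Real.exp_le_exp.2 hwm
  have hpi : (1 : ℝ) ≤ 4 * Real.pi := by nlinarith [Real.pi_gt_three]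
  have hpi' : (Real.pi : ℂ) ≠ 0 := by exact_mod_cast Real.pi_ne_zero
  have hρ' : (ρ : ℂ) ≠ 0 := by exact_mod_cast hρ.ne'
  have hden : ∀ (a : ℂ) (n : ℕ), ‖a / (4 * Real.pi * ρ ^ n)‖ ≤ ‖a‖ / ρ ^ n := fun a n => by
    rw [norm_div]
    have : ‖(4 * Real.pi * ρ ^ n : ℂ)‖ = 4 * Real.pi * ρ ^ n := by
      simp [abs_of_pos Real.pi_pos, abs_of_pos hρ]
    rw [this]
    have : ρ ^ n ≤ 4 * Real.pi * ρ ^ n := le_mul_of_one_le_left (by positivity) hpi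
    gcongr
  have hp1 : ‖w - 1‖ ≤ m + 1 := (norm_sub_le _ _).trans (by simpa using hwm)
  have hp2 : ‖w ^ 2 - 3 * w + 3‖ ≤ m ^ 2 + 3 * m + 3 := by
    refine (norm_add_le _ _).trans (add_le_add ((norm_sub_le _ _).trans (add_le_add ?_ ?_)) ?_)
    · rw [norm_pow]; gcongr
    · rw [norm_mul]; simpa using hwm
    · simp
  have hle1 : e ≤ C := by
    have : 0 ≤ K + (m + 1) * (K * e) + (m * K + 2 * K + (m ^ 2 + 3 * m + 3) * (K * e)) := by
      positivity
    have : 0 ≤ (m ^ 2 + 3 * m) * e := by positivity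
    simp only [C]; nlinarith
  have hle2 : (m + 1) * e ≤ C := by
    have : 0 ≤ K + (m + 1) * (K * e) + (m * K + 2 * K + (m ^ 2 + 3 * m + 3) * (K * e)) := by
      positivity
    have : 0 ≤ (m ^ 2 + 2 * m) * e := by positivity
    simp only [C]; nlinarith
  have hle3 : (m ^ 2 + 3 * m + 3) * e ≤ C := by
    have : 0 ≤ K + (m + 1) * (K * e) + (m * K + 2 * K + (m ^ 2 + 3 * m + 3) * (K * e)) := by
      positivity
    simp only [C]; linarith
  have hle4 : K + (m + 1) * (K * e) ≤ C := by
    have : 0 ≤ (m ^ 2 + 3 * m + 3) * e := by positivity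
    have : 0 ≤ m * K + 2 * K + (m ^ 2 + 3 * m + 3) * (K * e) := by positivity
    simp only [C]; linarith
  have hle5 : m * K + 2 * K + (m ^ 2 + 3 * m + 3) * (K * e) ≤ C := by
    have : 0 ≤ (m ^ 2 + 3 * m + 3) * e := by positivity
    have : 0 ≤ K + (m + 1) * (K * e) := by positivity
    simp only [C]; linarith
  refine ⟨?_, ?_, ?_, ?_, ?_⟩
  · have := hden (Complex.exp w) 1
    rw [pow_one, pow_one] at this
    rw [kG, ← hw]
    exact this.trans (div_le_div_of_nonneg_right (hE.trans hle1) hρ.le)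
  · rw [kA, ← hw]
    refine (hden _ 3).trans ?_
    rw [norm_mul]
    gcongr
    exact (mul_le_mul hp1 hE (norm_nonneg _) (by positivity)).trans hle2
  · rw [kB, ← hw]
    refine (hden _ 5).trans ?_
    rw [norm_mul]
    gcongr
    exact (mul_le_mul hp2 hE (norm_nonneg _) (by positivity)).trans hle3
  · have e1 : kA k ρ + 1 / (4 * Real.pi * ρ ^ 3)
        = (w ^ 2 + (w - 1) * (Complex.exp w - (1 + w))) / (4 * Real.pi * ρ ^ 3) := by
      rw [kA, ← hw]
      field_simp
      ring
    rw [e1]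
    refine (hden _ 3).trans ?_
    have h1 : ‖w ^ 2 + (w - 1) * (Complex.exp w - (1 + w))‖ ≤ C * ρ ^ 2 := by
      refine (norm_add_le _ _).trans ?_
      rw [norm_pow, norm_mul, hw2]
      have := mul_le_mul hp1 hR (norm_nonneg _) (by positivity)
      nlinarith [sq_nonneg ρ]
    refine (div_le_div_of_nonneg_right h1 (by positivity)).trans (le_of_eq ?_)
    field_simp
  · have e1 : kB k ρ - 3 / (4 * Real.pi * ρ ^ 5)
        = (w ^ 3 - 2 * w ^ 2 + (w ^ 2 - 3 * w + 3) * (Complex.exp w - (1 + w))) /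
          (4 * Real.pi * ρ ^ 5) := by
      rw [kB, ← hw]
      field_simp
      ring
    rw [e1]
    refine (hden _ 5).trans ?_
    have h1 : ‖w ^ 3 - 2 * w ^ 2 + (w ^ 2 - 3 * w + 3) * (Complex.exp w - (1 + w))‖
        ≤ C * ρ ^ 2 := by
      have h3 : ‖w ^ 3‖ ≤ m * (K * ρ ^ 2) := by
        rw [pow_succ', norm_mul, norm_pow, hw2]
        gcongr
      have h4 : ‖2 * w ^ 2‖ = 2 * (K * ρ ^ 2) := by simp [hw2]
      have h5 := mul_le_mul hp2 hR (norm_nonneg _) (by positivity)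
      rw [← norm_mul] at h5
      have h6 := norm_add_le (w ^ 3 - 2 * w ^ 2)
        ((w ^ 2 - 3 * w + 3) * (Complex.exp w - (1 + w)))
      have h7 := norm_sub_le (w ^ 3) (2 * w ^ 2)
      nlinarith [sq_nonneg ρ]
    refine (div_le_div_of_nonneg_right h1 (by positivity)).trans (le_of_eq ?_)
    field_simp

/-! ### The regularised distance -/

/-- The regularised length `√(|z|² + δ²)`. -/
def regR (δ : ℝ) (z : Vec3) : ℝ := √(‖z‖ ^ 2 + δ ^ 2)

theorem regR_zero (z : Vec3) : regR 0 z = ‖z‖ := by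
  rw [regR, zero_pow two_ne_zero, add_zero, Real.sqrt_sq (norm_nonneg _)]

theorem regR_sq (δ : ℝ) (z : Vec3) : regR δ z ^ 2 = ‖z‖ ^ 2 + δ ^ 2 := Real.sq_sqrt (by positivity)

theorem norm_le_regR (δ : ℝ) (z : Vec3) : ‖z‖ ≤ regR δ z :=
  Real.le_sqrt_of_sq_le (le_add_of_nonneg_right (sq_nonneg δ))

theorem abs_le_regR (δ : ℝ) (z : Vec3) : |δ| ≤ regR δ z :=
  Real.abs_le_sqrt (le_add_of_nonneg_left (sq_nonneg _))

theorem regR_le (δ : ℝ) (z : Vec3) : regR δ z ≤ ‖z‖ + |δ| := by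
  refine Real.sqrt_le_iff.2 ⟨by positivity, ?_⟩
  rw [← sq_abs δ]
  nlinarith [norm_nonneg z, abs_nonneg δ]

theorem regR_pos_of_ne {δ : ℝ} (hδ : δ ≠ 0) (z : Vec3) : 0 < regR δ z :=
  (abs_pos.2 hδ).trans_le (abs_le_regR δ z)

theorem regR_pos (δ : ℝ) {z : Vec3} (hz : z ≠ 0) : 0 < regR δ z :=
  (norm_pos_iff.2 hz).trans_le (norm_le_regR δ z)

theorem hasFDerivAt_regR {δ : ℝ} {z : Vec3} (hz : 0 < regR δ z) :
    HasFDerivAt (regR δ) ((regR δ z)⁻¹ • innerSL ℝ z) z := by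
  have h1 : HasFDerivAt (fun z : Vec3 => ‖z‖ ^ 2 + δ ^ 2) (2 • innerSL ℝ z) z :=
    (hasStrictFDerivAt_norm_sq z).hasFDerivAt.add_const _
  have h2 := h1.sqrt (Real.sqrt_pos.1 hz).ne'
  refine h2.congr_fderiv ?_
  ext v
  simp only [_root_.smul_apply, smul_eq_mul, nsmul_eq_mul]
  change 1 / (2 * regR δ z) * (((2 : ℕ) : ℝ) * innerSL ℝ z v) = _
  push_cast
  field_simp

/-- The profiles are differentiated by `ρ⁻¹ d/dρ`. As the gradient of `ρ` is `z / ρ` for every `δ`,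
the gradient of a profile is then `F' z`, the same formula with and without regularisation. -/
theorem hasFDerivAt_comp_regR {F : ℝ → ℂ} {F' : ℂ} {δ : ℝ} {z : Vec3} (hz : 0 < regR δ z)
    (hF : HasDerivAt F (F' * regR δ z) (regR δ z)) :
    HasFDerivAt (fun z => F (regR δ z)) ((innerSL ℝ z).smulRight F') z := by
  have h := hF.hasFDerivAt.comp z (hasFDerivAt_regR hz)
  refine h.congr_fderiv ?_
  ext v
  have hz' : ((regR δ z : ℝ) : ℂ) ≠ 0 := by exact_mod_cast hz.ne'
  simp
  field_simp

theorem hasFDerivAt_kG_regR (k : ℂ) {δ : ℝ} {z : Vec3} (hz : 0 < regR δ z) :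
    HasFDerivAt (fun z => kG k (regR δ z)) ((innerSL ℝ z).smulRight (kA k (regR δ z))) z :=
  hasFDerivAt_comp_regR hz (hasDerivAt_kG k hz.ne')

theorem hasFDerivAt_kA_regR (k : ℂ) {δ : ℝ} {z : Vec3} (hz : 0 < regR δ z) :
    HasFDerivAt (fun z => kA k (regR δ z)) ((innerSL ℝ z).smulRight (kB k (regR δ z))) z :=
  hasFDerivAt_comp_regR hz (hasDerivAt_kA k hz.ne')

theorem contDiff_regR {δ : ℝ} (hδ : δ ≠ 0) {n : WithTop ℕ∞} : ContDiff ℝ n (regR δ) := by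
  have h1 : ContDiff ℝ n fun z : Vec3 => ‖z‖ ^ 2 + δ ^ 2 := (contDiff_norm_sq ℝ).add contDiff_const
  exact h1.sqrt fun z => by positivity

theorem contDiff_regR_ofReal {δ : ℝ} (hδ : δ ≠ 0) {n : WithTop ℕ∞} :
    ContDiff ℝ n fun z => ((regR δ z : ℝ) : ℂ) :=
  Complex.ofRealCLM.contDiff.comp (contDiff_regR hδ)

theorem contDiff_kG_regR (k : ℂ) {δ : ℝ} (hδ : δ ≠ 0) {n : WithTop ℕ∞} :
    ContDiff ℝ n fun z => kG k (regR δ z) := by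
  have hpi' : (Real.pi : ℂ) ≠ 0 := by exact_mod_cast Real.pi_ne_zero
  have h := contDiff_regR_ofReal (n := n) hδ
  unfold kG
  simp only [div_eq_mul_inv]
  refine ((contDiff_const.mul h).cexp).mul ((contDiff_const.mul h).inv fun z => ?_)
  have : ((regR δ z : ℝ) : ℂ) ≠ 0 := by exact_mod_cast (regR_pos_of_ne hδ z).ne'
  exact mul_ne_zero (mul_ne_zero (by norm_num) hpi') this

theorem contDiff_kA_regR (k : ℂ) {δ : ℝ} (hδ : δ ≠ 0) {n : WithTop ℕ∞} :
    ContDiff ℝ n fun z => kA k (regR δ z) := by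
  have hpi' : (Real.pi : ℂ) ≠ 0 := by exact_mod_cast Real.pi_ne_zero
  have h := contDiff_regR_ofReal (n := n) hδ
  unfold kA
  simp only [div_eq_mul_inv]
  refine ((((contDiff_const.mul h).sub contDiff_const).mul (contDiff_const.mul h).cexp)).mul
    ((contDiff_const.mul (h.pow 3)).inv fun z => ?_)
  have : ((regR δ z : ℝ) : ℂ) ≠ 0 := by exact_mod_cast (regR_pos_of_ne hδ z).ne'
  exact mul_ne_zero (mul_ne_zero (by norm_num) hpi') (pow_ne_zero 3 this)

theorem continuousAt_kG (k : ℂ) {ρ : ℝ} (hρ : ρ ≠ 0) : ContinuousAt (kG k) ρ :=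
  (hasDerivAt_kG k hρ).continuousAt

theorem continuousAt_kA (k : ℂ) {ρ : ℝ} (hρ : ρ ≠ 0) : ContinuousAt (kA k) ρ :=
  (hasDerivAt_kA k hρ).continuousAt

theorem continuousAt_kB (k : ℂ) {ρ : ℝ} (hρ : ρ ≠ 0) : ContinuousAt (kB k) ρ := by
  have hpi' : (Real.pi : ℂ) ≠ 0 := by exact_mod_cast Real.pi_ne_zero
  have hρ' : (ρ : ℂ) ≠ 0 := by exact_mod_cast hρ
  unfold kB
  refine ContinuousAt.div (by fun_prop) (by fun_prop) ?_
  exact mul_ne_zero (mul_ne_zero (by norm_num) hpi') (pow_ne_zero 5 hρ')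

theorem measurable_kG (k : ℂ) : Measurable (kG k) := by unfold kG; fun_prop

theorem measurable_kA (k : ℂ) : Measurable (kA k) := by unfold kA; fun_prop

theorem measurable_kB (k : ℂ) : Measurable (kB k) := by unfold kB; fun_prop

theorem measurable_regR (δ : ℝ) : Measurable (regR δ) := by unfold regR; fun_prop

/-! ### Derivatives of the Helmholtz kernel -/

theorem dirDeriv_helmholtz (k : ℂ) (n : Vec3) {x y : Vec3} (hxy : x ≠ y) :
    dirDeriv n (fun z => helmholtz k z y) x = kA k ‖x - y‖ * (inner ℝ (x - y) n : ℝ) := by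
  have h := (hasFDerivAt_kG_regR k (regR_pos 0 (sub_ne_zero.2 hxy))).comp x
    ((hasFDerivAt_id x).sub_const y)
  simp only [regR_zero] at h
  rw [dirDeriv]
  change (fderiv ℝ ((fun z => kG k ‖z‖) ∘ fun z => id z - y) x) n = _
  rw [HasFDerivAt.fderiv h]
  simp [inner_sub_left, mul_comm]

/-- The vector field `z ↦ kA(|z - y|) ⟨z - y, w⟩` and its derivatives. -/
theorem dirDeriv_kA_inner (k : ℂ) (n w : Vec3) {x y : Vec3} (hxy : x ≠ y) :
    DifferentiableAt ℝ (fun z => kA k ‖z - y‖ * (inner ℝ (z - y) w : ℝ)) x ∧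
    dirDeriv n (fun z => kA k ‖z - y‖ * (inner ℝ (z - y) w : ℝ)) x
      = kA k ‖x - y‖ * (inner ℝ n w : ℝ)
        + kB k ‖x - y‖ * (inner ℝ (x - y) n : ℝ) * (inner ℝ (x - y) w : ℝ) := by
  have h := (hasFDerivAt_kA_regR k (regR_pos 0 (sub_ne_zero.2 hxy))).comp x
    ((hasFDerivAt_id x).sub_const y)
  simp only [regR_zero] at h
  have h2 : HasFDerivAt (fun z : Vec3 => ((inner ℝ (z - y) w : ℝ) : ℂ))
      (Complex.ofRealCLM.comp (innerSL ℝ w)) x := by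
    have h3 := (Complex.ofRealCLM.comp (innerSL ℝ w)).hasFDerivAt.comp x
      ((hasFDerivAt_id x).sub_const y)
    have e : (fun z : Vec3 => ((inner ℝ (z - y) w : ℝ) : ℂ))
        = (Complex.ofRealCLM.comp (innerSL ℝ w)) ∘ fun z => id z - y := by
      funext z
      simp [real_inner_comm]
    rw [e]
    exact h3
  have h4 := HasFDerivAt.mul h h2
  refine ⟨h4.differentiableAt, ?_⟩
  rw [dirDeriv]
  have := congrArg (fun T : Vec3 →L[ℝ] ℂ => T n) h4.fderiv
  refine this.trans ?_
  rw [real_inner_comm w n, real_inner_comm w (x - y)]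
  simp [inner_sub_left, inner_sub_right]
  ring

theorem grad_helmholtz (k : ℂ) {x y : Vec3} (hxy : x ≠ y) (i : Fin 3) :
    grad (fun z => helmholtz k z y) x i = kA k ‖x - y‖ * ((x - y) i : ℝ) := by
  rw [grad, partialD, dirDeriv_helmholtz k _ hxy]
  simp [EuclideanSpace.inner_single_right]

theorem differentiableAt_helmholtz (k : ℂ) {x y : Vec3} (hxy : x ≠ y) :
    DifferentiableAt ℝ (fun z => helmholtz k z y) x := by
  have h := (hasFDerivAt_kG_regR k (regR_pos 0 (sub_ne_zero.2 hxy))).comp x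
    ((hasFDerivAt_id x).sub_const y)
  simp only [regR_zero] at h
  exact h.differentiableAt

end

section

/-! ### Weakly singular integrals -/

section WeaklySingular

variable {μ : Measure Vec3} {A a : ℝ}

theorem measure_singleton_eq_zero_of_growth
    (hμ : ∀ ξ r, 0 ≤ r → μ (Metric.closedBall ξ r) ≤ ENNReal.ofReal (A * r ^ 2)) (ξ : Vec3) :
    μ {ξ} = 0 := by
  have h := hμ ξ 0 le_rfl
  simpa using h

theorem ae_ne_of_growth
    (hμ : ∀ ξ r, 0 ≤ r → μ (Metric.closedBall ξ r) ≤ ENNReal.ofReal (A * r ^ 2)) (ξ : Vec3) :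
    ∀ᵐ y ∂μ, y ≠ ξ := by
  rw [ae_iff]
  simpa using measure_singleton_eq_zero_of_growth hμ ξ

/-- Dyadic decomposition. On the shell between the radii `η 2⁻ⁿ⁻¹` and `η 2⁻ⁿ` the integrand is at
most the power of the inner radius, and the measure is at most `A` times the square of the outer
one; the sum is geometric with ratio `2⁻ᵃ`. The constant does not depend on the centre, which
matters for moving singularities. -/
theorem exists_lintegral_closedBall_le (hA : 0 ≤ A) (ha : 0 < a) (ha1 : a ≤ 1)
    (hμ : ∀ ξ r, 0 ≤ r → μ (Metric.closedBall ξ r) ≤ ENNReal.ofReal (A * r ^ 2)) :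
    ∃ C : ℝ, 0 ≤ C ∧ ∀ ξ η, 0 < η → ∫⁻ y in Metric.closedBall ξ η,
      ENNReal.ofReal (‖y - ξ‖ ^ (a - 2)) ∂μ ≤ ENNReal.ofReal (C * η ^ a) := by
  set r : ℝ := 1 / 2
  have hr : 0 < r := by norm_num [r]
  have hr1 : r < 1 := by norm_num [r]
  have hra : r ^ a < 1 := Real.rpow_lt_one hr.le hr1 ha
  have hra0 : 0 ≤ r ^ a := by positivity
  refine ⟨A * r ^ (a - 2) * (1 - r ^ a)⁻¹, ?_, fun ξ η hη => ?_⟩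
  · have : 0 < 1 - r ^ a := by linarith
    positivity
  set c : ℕ → ENNReal := fun n => ENNReal.ofReal ((η * r ^ (n + 1)) ^ (a - 2))
  have hpt : ∀ y ∈ Metric.closedBall ξ η, ENNReal.ofReal (‖y - ξ‖ ^ (a - 2))
      ≤ ∑' n, (Metric.closedBall ξ (η * r ^ n)).indicator (fun _ => c n) y := by
    intro y hy
    by_cases hyξ : y = ξ
    -- A real power of zero with nonzero exponent is `0`, so the centre itself causes no trouble.
    · rw [hyξ, sub_self, norm_zero, Real.zero_rpow (by linarith)]
      simp
    have h0 : 0 < ‖y - ξ‖ := norm_pos_iff.2 (sub_ne_zero.2 hyξ)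
    have h1 : ‖y - ξ‖ / η ≤ 1 := by
      rw [Metric.mem_closedBall, dist_eq_norm] at hy
      rwa [div_le_one hη]
    obtain ⟨n, hn1, hn2⟩ := exists_nat_pow_near_of_lt_one (div_pos h0 hη) h1 hr hr1
    rw [lt_div_iff₀ hη, mul_comm] at hn1
    rw [div_le_iff₀ hη, mul_comm] at hn2
    refine le_trans ?_ (ENNReal.le_tsum n)
    rw [Set.indicator_of_mem (by rwa [Metric.mem_closedBall, dist_eq_norm])]
    refine ENNReal.ofReal_le_ofReal ?_
    exact Real.rpow_le_rpow_of_nonpos (by positivity) hn1.le (by linarith)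
  calc ∫⁻ y in Metric.closedBall ξ η, ENNReal.ofReal (‖y - ξ‖ ^ (a - 2)) ∂μ
      ≤ ∫⁻ y in Metric.closedBall ξ η,
          ∑' n, (Metric.closedBall ξ (η * r ^ n)).indicator (fun _ => c n) y ∂μ :=
        setLIntegral_mono' Metric.isClosed_closedBall.measurableSet hpt
    _ ≤ ∫⁻ y, ∑' n, (Metric.closedBall ξ (η * r ^ n)).indicator (fun _ => c n) y ∂μ :=
        setLIntegral_le_lintegral _ _
    _ = ∑' n, c n * μ (Metric.closedBall ξ (η * r ^ n)) := by
        rw [lintegral_tsum fun n =>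
          (measurable_const.indicator Metric.isClosed_closedBall.measurableSet).aemeasurable]
        congr 1
        funext n
        rw [lintegral_indicator_const Metric.isClosed_closedBall.measurableSet]
    _ ≤ ∑' n : ℕ, ENNReal.ofReal (A * r ^ (a - 2) * η ^ a * (r ^ a) ^ n) := by
        refine ENNReal.tsum_le_tsum fun n => ?_
        refine (mul_le_mul_right (hμ ξ (η * r ^ n) (by positivity)) _).trans (le_of_eq ?_)
        rw [← ENNReal.ofReal_mul (by positivity)]
        congr 1
        have e1 : (η * r ^ (n + 1)) ^ (a - 2) = r ^ (a - 2) * (η * r ^ n) ^ (a - 2) := by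
          rw [pow_succ, ← mul_assoc, Real.mul_rpow (by positivity) hr.le, mul_comm]
        have e2 : (η * r ^ n) ^ (a - 2) * (η * r ^ n) ^ 2 = (η * r ^ n) ^ a := by
          rw [← Real.rpow_natCast (η * r ^ n) 2, ← Real.rpow_add (by positivity)]
          norm_num
        have e3 : (η * r ^ n) ^ a = η ^ a * (r ^ a) ^ n := by
          rw [Real.mul_rpow hη.le (by positivity), ← Real.rpow_natCast, ← Real.rpow_natCast,
            ← Real.rpow_mul hr.le, ← Real.rpow_mul hr.le, mul_comm (n : ℝ)]
        rw [e1]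
        calc _ = A * r ^ (a - 2) * ((η * r ^ n) ^ (a - 2) * (η * r ^ n) ^ 2) := by ring
          _ = _ := by rw [e2, e3]; ring
    _ = ENNReal.ofReal (A * r ^ (a - 2) * (1 - r ^ a)⁻¹ * η ^ a) := by
        rw [← ENNReal.ofReal_tsum_of_nonneg (fun n => by positivity)
          ((summable_geometric_of_lt_one hra0 hra).mul_left _), tsum_mul_left,
          tsum_geometric_of_lt_one hra0 hra]
        congr 1
        ring

theorem measurable_norm_rpow (ξ : Vec3) (s : ℝ) : Measurable fun y : Vec3 => ‖y - ξ‖ ^ s := by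
  fun_prop

theorem integrable_norm_rpow [IsFiniteMeasure μ] (hA : 0 ≤ A) (ha : 0 < a) (ha1 : a ≤ 1)
    (hμ : ∀ ξ r, 0 ≤ r → μ (Metric.closedBall ξ r) ≤ ENNReal.ofReal (A * r ^ 2)) (ξ : Vec3) :
    Integrable (fun y => ‖y - ξ‖ ^ (a - 2)) μ := by
  obtain ⟨C, hC, h⟩ := exists_lintegral_closedBall_le hA ha ha1 hμ
  have hm := (measurable_norm_rpow ξ (a - 2)).aestronglyMeasurable (μ := μ)
  rw [← integrableOn_univ, ← Set.union_compl_self (Metric.closedBall ξ 1)]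
  refine IntegrableOn.union ⟨hm.restrict, ?_⟩ ?_
  · rw [hasFiniteIntegral_iff_ofReal (ae_of_all _ fun y => by positivity)]
    exact (h ξ 1 one_pos).trans_lt ENNReal.ofReal_lt_top
  · refine Integrable.of_bound hm.restrict 1 ?_
    filter_upwards [ae_restrict_mem Metric.isClosed_closedBall.measurableSet.compl] with y hy
    rw [Set.mem_compl_iff, Metric.mem_closedBall, dist_eq_norm, not_le] at hy
    rw [Real.norm_of_nonneg (by positivity)]
    exact Real.rpow_le_one_of_one_le_of_nonpos hy.le (by linarith)

theorem integrable_of_weaklySingular {E : Type*} [NormedAddCommGroup E]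
    [IsFiniteMeasure μ] (hA : 0 ≤ A) (ha : 0 < a) (ha1 : a ≤ 1)
    (hμ : ∀ ξ r, 0 ≤ r → μ (Metric.closedBall ξ r) ≤ ENNReal.ofReal (A * r ^ 2)) {F : Vec3 → E}
    {C : ℝ} {ξ : Vec3} (hF : AEStronglyMeasurable F μ)
    (hb : ∀ᵐ y ∂μ, ‖F y‖ ≤ C * ‖y - ξ‖ ^ (a - 2)) : Integrable F μ :=
  ((integrable_norm_rpow hA ha ha1 hμ ξ).const_mul C).mono' hF hb

/-- Continuity of weakly singular integrals with a moving singularity. -/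
theorem tendsto_integral_of_weaklySingular {ι : Type*} {l : Filter ι} [l.NeBot]
    [l.IsCountablyGenerated] [IsFiniteMeasure μ] (hA : 0 ≤ A) (ha : 0 < a) (ha1 : a ≤ 1)
    (hμ : ∀ ξ r, 0 ≤ r → μ (Metric.closedBall ξ r) ≤ ENNReal.ofReal (A * r ^ 2))
    {K : ι → Vec3 → ℂ} {K₀ : Vec3 → ℂ} {ξ : ι → Vec3} {x : Vec3} {C : ℝ} (hC : 0 ≤ C)
    (hξ : Tendsto ξ l (𝓝 x)) (hm : ∀ᶠ θ in l, AEStronglyMeasurable (K θ) μ)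
    (hb : ∀ᶠ θ in l, ∀ᵐ y ∂μ, ‖K θ y‖ ≤ C * ‖y - ξ θ‖ ^ (a - 2))
    (hm₀ : AEStronglyMeasurable K₀ μ)
    (hb₀ : ∀ᵐ y ∂μ, ‖K₀ y‖ ≤ C * ‖y - x‖ ^ (a - 2))
    (hlim : ∀ᵐ y ∂μ, Tendsto (fun θ => K θ y) l (𝓝 (K₀ y))) :
    Tendsto (fun θ => ∫ y, K θ y ∂μ) l (𝓝 (∫ y, K₀ y ∂μ)) := by
  obtain ⟨D, hD, hball⟩ := exists_lintegral_closedBall_le hA ha ha1 hμ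
  -- Smallness near `x`, uniform in the position `ζ` of the singularity: the ball of radius `η`
  -- about `x` lies in the ball of radius `2η` about `ζ`.
  have hnear : ∀ (F : Vec3 → ℂ) (ζ : Vec3) (η : ℝ), 0 < η → ‖ζ - x‖ ≤ η →
      (∀ᵐ y ∂μ, ‖F y‖ ≤ C * ‖y - ζ‖ ^ (a - 2)) →
      ‖∫ y in Metric.closedBall x η, F y ∂μ‖ ≤ C * (D * (2 * η) ^ a) := by
    intro F ζ η hη hζ hF
    refine (norm_integral_le_lintegral_norm _).trans ?_
    refine ENNReal.toReal_le_of_le_ofReal (by positivity) ?_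
    calc ∫⁻ y in Metric.closedBall x η, ENNReal.ofReal ‖F y‖ ∂μ
        ≤ ∫⁻ y in Metric.closedBall x η, ENNReal.ofReal (C * ‖y - ζ‖ ^ (a - 2)) ∂μ :=
          lintegral_mono_ae (ae_restrict_of_ae (hF.mono fun y hy => ENNReal.ofReal_le_ofReal hy))
      _ ≤ ∫⁻ y in Metric.closedBall ζ (2 * η), ENNReal.ofReal (C * ‖y - ζ‖ ^ (a - 2)) ∂μ := by
          refine lintegral_mono_set (Metric.closedBall_subset_closedBall' ?_)
          rw [dist_comm, dist_eq_norm]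
          linarith
      _ = ENNReal.ofReal C * ∫⁻ y in Metric.closedBall ζ (2 * η),
            ENNReal.ofReal (‖y - ζ‖ ^ (a - 2)) ∂μ := by
          simp_rw [ENNReal.ofReal_mul hC]
          rw [lintegral_const_mul' _ _ ENNReal.ofReal_ne_top]
      _ ≤ ENNReal.ofReal (C * (D * (2 * η) ^ a)) := by
          rw [ENNReal.ofReal_mul hC]
          gcongr
          exact hball ζ (2 * η) (by positivity)
  have hint₀ : Integrable K₀ μ := integrable_of_weaklySingular hA ha ha1 hμ hm₀ hb₀
  rw [Metric.tendsto_nhds]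
  intro ε hε
  have hsmall : Tendsto (fun η : ℝ => C * (D * (2 * η) ^ a)) (𝓝[>] 0) (𝓝 0) := by
    have : ContinuousAt (fun η : ℝ => C * (D * (2 * η) ^ a)) 0 := by
      refine continuousAt_const.mul (continuousAt_const.mul ?_)
      exact (continuousAt_const.mul continuousAt_id).rpow_const (Or.inr ha.le)
    have h2 := this.tendsto.mono_left (nhdsWithin_le_nhds (s := Ioi 0))
    simpa [Real.zero_rpow ha.ne'] using h2
  obtain ⟨η, hη1, hη⟩ := ((hsmall.eventually (gt_mem_nhds (show 0 < ε / 4 by positivity))).and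
    self_mem_nhdsWithin).exists
  have hη' : (0 : ℝ) < η := hη
  have hξη : ∀ᶠ θ in l, ‖ξ θ - x‖ ≤ η / 2 := by
    filter_upwards [Metric.tendsto_nhds.1 hξ (η / 2) (by positivity)] with θ hθ
    rw [dist_eq_norm] at hθ
    exact hθ.le
  -- Outside the ball of radius `η` the singularity eventually stays at distance at least `η / 2`,
  -- and a constant dominates.
  have hfar : Tendsto (fun θ => ∫ y in (Metric.closedBall x η)ᶜ, K θ y ∂μ) l
      (𝓝 (∫ y in (Metric.closedBall x η)ᶜ, K₀ y ∂μ)) := by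
    refine tendsto_integral_filter_of_dominated_convergence (fun _ => C * (η / 2) ^ (a - 2))
      (hm.mono fun θ h => h.restrict) ?_ (integrable_const _) (ae_restrict_of_ae hlim)
    filter_upwards [hb, hξη] with θ h1 h2
    filter_upwards [ae_restrict_of_ae h1,
      ae_restrict_mem Metric.isClosed_closedBall.measurableSet.compl] with y hy hyc
    refine hy.trans ?_
    rw [Set.mem_compl_iff, Metric.mem_closedBall, dist_eq_norm, not_le] at hyc
    have h3 : η / 2 ≤ ‖y - ξ θ‖ := by
      have := norm_sub_le_norm_sub_add_norm_sub y (ξ θ) x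
      linarith
    exact mul_le_mul_of_nonneg_left
      (Real.rpow_le_rpow_of_nonpos (by positivity) h3 (by linarith)) hC
  filter_upwards [Metric.tendsto_nhds.1 hfar (ε / 2) (by positivity), hm, hb, hξη]
    with θ h1 h2 h3 h4
  have hint : Integrable (K θ) μ := integrable_of_weaklySingular hA ha ha1 hμ h2 h3
  have e1 := integral_add_compl (Metric.isClosed_closedBall (x := x) (ε := η)).measurableSet hint
  have e2 := integral_add_compl (Metric.isClosed_closedBall (x := x) (ε := η)).measurableSet hint₀
  have n1 := hnear (K θ) (ξ θ) η hη' (h4.trans (by linarith)) h3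
  have n2 := hnear K₀ x η hη' (by simpa using hη'.le) hb₀
  rw [dist_eq_norm] at h1 ⊢
  rw [← e1, ← e2, add_sub_add_comm]
  refine (norm_add_le _ _).trans_lt ?_
  have n3 := norm_sub_le (∫ y in Metric.closedBall x η, K θ y ∂μ)
    (∫ y in Metric.closedBall x η, K₀ y ∂μ)
  linarith

end WeaklySingular

end

section

/-! ### Finite parts in the plane -/

/-- The regularisation `ρ⁻³ - 3 δ² ρ⁻⁵`, `ρ² = r² + δ²`, of `r⁻³`. -/
def regCube (δ r : ℝ) : ℝ := (√(r ^ 2 + δ ^ 2) ^ 3)⁻¹ - 3 * δ ^ 2 * (√(r ^ 2 + δ ^ 2) ^ 5)⁻¹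

/-- The truncation of `r⁻³` at `ε`. -/
def truncCube (ε r : ℝ) : ℝ := if ε ≤ r then (r ^ 3)⁻¹ else 0

theorem measurable_regCube (δ : ℝ) : Measurable (regCube δ) := by unfold regCube; fun_prop

theorem measurable_truncCube (ε : ℝ) : Measurable (truncCube ε) := by
  unfold truncCube
  exact Measurable.ite (measurableSet_le measurable_const measurable_id) (by fun_prop)
    measurable_const

theorem regCube_zero {r : ℝ} (hr : 0 ≤ r) : regCube 0 r = (r ^ 3)⁻¹ := by
  simp [regCube, Real.sqrt_sq hr]

theorem abs_truncCube_le {ε r : ℝ} (hε : 0 < ε) : |truncCube ε r| ≤ (ε ^ 3)⁻¹ := by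
  unfold truncCube
  split_ifs with h
  · have : 0 < r := hε.trans_le h
    rw [abs_of_nonneg (by positivity)]
    gcongr
  · rw [abs_zero]; positivity

/-- As `δ² ≤ ρ²`, the second term is at most `3ρ⁻³`; hence the factor `4 = 1 + 3`. -/
theorem abs_regCube_le_of_le {δ r s : ℝ} (hs : 0 < s) (h : s ≤ √(r ^ 2 + δ ^ 2)) :
    |regCube δ r| ≤ 4 * (s ^ 3)⁻¹ := by
  set ρ := √(r ^ 2 + δ ^ 2) with hρ
  have hρ0 : 0 < ρ := hs.trans_le h
  have hρ2 : ρ ^ 2 = r ^ 2 + δ ^ 2 := Real.sq_sqrt (by positivity)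
  have h1 : δ ^ 2 * (ρ ^ 5)⁻¹ ≤ (ρ ^ 3)⁻¹ := by
    have : (ρ ^ 3)⁻¹ = ρ ^ 2 * (ρ ^ 5)⁻¹ := by field_simp
    rw [this, hρ2]
    gcongr
    exact le_add_of_nonneg_left (sq_nonneg r)
  have h2 : (ρ ^ 3)⁻¹ ≤ (s ^ 3)⁻¹ := by gcongr
  have h3 : 0 ≤ δ ^ 2 * (ρ ^ 5)⁻¹ := by positivity
  have h4 : 0 ≤ (ρ ^ 3)⁻¹ := by positivity
  rw [regCube, ← hρ, mul_assoc, abs_le]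
  constructor <;> linarith

theorem abs_regCube_le (δ : ℝ) {r s : ℝ} (hs : 0 < s) (hr : s ≤ r) :
    |regCube δ r| ≤ 4 * (s ^ 3)⁻¹ :=
  abs_regCube_le_of_le hs (hr.trans (Real.le_sqrt_of_sq_le (le_add_of_nonneg_right (sq_nonneg δ))))

theorem abs_regCube_le_delta {δ : ℝ} (hδ : 0 < δ) (r : ℝ) : |regCube δ r| ≤ 4 * (δ ^ 3)⁻¹ :=
  abs_regCube_le_of_le hδ (Real.le_sqrt_of_sq_le (le_add_of_nonneg_left (sq_nonneg r)))

/-- Bernoulli's inequality for `(s / r)ⁿ`, and `1 - s / r ≤ (r² - s²) / s²`. The bound is expressed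
by `r² - s²` because this difference is unchanged when `δ²` is added to both squares. -/
theorem inv_pow_sub_inv_pow_le {s r : ℝ} (hs : 0 < s) (hsr : s ≤ r) (n : ℕ) :
    (s ^ n)⁻¹ - (r ^ n)⁻¹ ≤ n * (r ^ 2 - s ^ 2) * (s ^ (n + 2))⁻¹ := by
  have hr : 0 < r := hs.trans_le hsr
  have h1 : 1 + (n : ℝ) * (s / r - 1) ≤ (1 + (s / r - 1)) ^ n :=
    one_add_mul_le_pow (by have : 0 ≤ s / r := by positivity
                           linarith) n
  rw [add_sub_cancel, div_pow] at h1
  have h2 : 1 - s / r ≤ (r ^ 2 - s ^ 2) / s ^ 2 := by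
    rw [le_div_iff₀ (by positivity), one_sub_div hr.ne', div_mul_eq_mul_div, div_le_iff₀ hr]
    nlinarith [mul_nonneg (sub_nonneg.2 hsr) hs.le, mul_nonneg (sub_nonneg.2 hsr) (sq_nonneg s),
      mul_nonneg (sub_nonneg.2 hsr) (sq_nonneg r), mul_pos hs hr, mul_nonneg
      (mul_nonneg (sub_nonneg.2 hsr) hs.le) hr.le]
  have h3 : 1 - s ^ n / r ^ n ≤ n * ((r ^ 2 - s ^ 2) / s ^ 2) := by
    have : (n : ℝ) * (1 - s / r) ≤ n * ((r ^ 2 - s ^ 2) / s ^ 2) := by gcongr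
    linarith
  have e1 : (s ^ n)⁻¹ - (r ^ n)⁻¹ = (s ^ n)⁻¹ * (1 - s ^ n / r ^ n) := by
    field_simp
  have e2 : n * (r ^ 2 - s ^ 2) * (s ^ (n + 2))⁻¹
      = (s ^ n)⁻¹ * (n * ((r ^ 2 - s ^ 2) / s ^ 2)) := by
    rw [pow_add]
    field_simp
  rw [e1, e2]
  gcongr

/-- The powers `ρ⁻³` and `ρ⁻⁵` contribute `3` and `3 · 5`, whence `18`; the factor `δ²` is absorbed
by `δ² ≤ σ²`. The bound is uniform in `δ` and so can serve as a dominating function. -/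
theorem abs_regCube_sub_le (δ : ℝ) {s r : ℝ} (hs : 0 < s) (hsr : s ≤ r) :
    |regCube δ r - regCube δ s| ≤ 18 * (r ^ 2 - s ^ 2) * (s ^ 5)⁻¹ := by
  set ρ := √(r ^ 2 + δ ^ 2) with hρ
  set σ := √(s ^ 2 + δ ^ 2) with hσ
  have hρ2 : ρ ^ 2 = r ^ 2 + δ ^ 2 := Real.sq_sqrt (by positivity)
  have hσ2 : σ ^ 2 = s ^ 2 + δ ^ 2 := Real.sq_sqrt (by positivity)
  have hsσ : s ≤ σ := Real.le_sqrt_of_sq_le (le_add_of_nonneg_right (sq_nonneg δ))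
  have hσ0 : 0 < σ := hs.trans_le hsσ
  have hσρ : σ ≤ ρ := Real.sqrt_le_sqrt (by gcongr)
  have h3 := inv_pow_sub_inv_pow_le hσ0 hσρ 3
  have h5 := inv_pow_sub_inv_pow_le hσ0 hσρ 5
  have hd : ρ ^ 2 - σ ^ 2 = r ^ 2 - s ^ 2 := by rw [hρ2, hσ2]; ring
  have hD : 0 ≤ r ^ 2 - s ^ 2 := by
    have : s ^ 2 ≤ r ^ 2 := by gcongr
    linarith
  rw [hd] at h3 h5
  push_cast at h3 h5
  have h3' : 0 ≤ (σ ^ 3)⁻¹ - (ρ ^ 3)⁻¹ := sub_nonneg.2 (by gcongr)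
  have h5' : 0 ≤ (σ ^ 5)⁻¹ - (ρ ^ 5)⁻¹ := sub_nonneg.2 (by gcongr)
  have h7 : δ ^ 2 * (σ ^ 7)⁻¹ ≤ (σ ^ 5)⁻¹ := by
    have : (σ ^ 5)⁻¹ = σ ^ 2 * (σ ^ 7)⁻¹ := by field_simp
    rw [this, hσ2]
    gcongr
    exact le_add_of_nonneg_left (sq_nonneg s)
  have h8 : (σ ^ 5)⁻¹ ≤ (s ^ 5)⁻¹ := by gcongr
  have h9 : δ ^ 2 * ((σ ^ 5)⁻¹ - (ρ ^ 5)⁻¹) ≤ 5 * (r ^ 2 - s ^ 2) * (s ^ 5)⁻¹ := by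
    calc _ ≤ δ ^ 2 * (5 * (r ^ 2 - s ^ 2) * (σ ^ 7)⁻¹) := by gcongr
      _ = 5 * (r ^ 2 - s ^ 2) * (δ ^ 2 * (σ ^ 7)⁻¹) := by ring
      _ ≤ _ := by
        have := h7.trans h8
        gcongr
  have h10 : (σ ^ 3)⁻¹ - (ρ ^ 3)⁻¹ ≤ 3 * (r ^ 2 - s ^ 2) * (s ^ 5)⁻¹ :=
    h3.trans (by gcongr)
  have h11 : 0 ≤ δ ^ 2 * ((σ ^ 5)⁻¹ - (ρ ^ 5)⁻¹) := mul_nonneg (sq_nonneg δ) h5'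
  have e : regCube δ r - regCube δ s
      = 3 * (δ ^ 2 * ((σ ^ 5)⁻¹ - (ρ ^ 5)⁻¹)) - ((σ ^ 3)⁻¹ - (ρ ^ 3)⁻¹) := by
    rw [regCube, regCube, ← hρ, ← hσ]
    ring
  have h12 : 0 ≤ (r ^ 2 - s ^ 2) * (s ^ 5)⁻¹ := by positivity
  rw [e, abs_le]
  constructor <;> linarith

/-- Polar coordinates; twice the area of the unit disc is the length of the unit circle. -/
theorem setIntegral_ball_norm {R : ℝ} (g : ℝ → ℝ) :
    ∫ u in Metric.ball (0 : Vec2) R, g ‖u‖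
      = 2 * volume.real (Metric.ball (0 : Vec2) 1) * ∫ s in Ioo 0 R, s * g s := by
  have h := integral_fun_norm_addHaar (volume : Measure Vec2) ((Iio R).indicator g)
  have e1 : ∫ u in Metric.ball (0 : Vec2) R, g ‖u‖ = ∫ u : Vec2, (Iio R).indicator g ‖u‖ := by
    rw [← integral_indicator Metric.isOpen_ball.measurableSet]
    refine integral_congr_ae (ae_of_all _ fun u => ?_)
    simp [Set.indicator]
  have e2 : ∫ y in Ioi (0 : ℝ), y ^ (Module.finrank ℝ Vec2 - 1) • (Iio R).indicator g y
      = ∫ s in Ioo 0 R, s * g s := by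
    rw [← Set.Ioi_inter_Iio, Set.inter_comm, ← Measure.restrict_restrict measurableSet_Iio,
      ← integral_indicator measurableSet_Iio]
    refine integral_congr_ae (ae_of_all _ fun s => ?_)
    simp [Set.indicator]
  rw [e1, h, e2]
  simp
  ring

/-- Integration of a radial kernel against an affine function over a disc. -/
theorem setIntegral_ball_norm_smul_affine {R N : ℝ} {g : ℝ → ℝ} (hg : Measurable g)
    (hN : ∀ s, |g s| ≤ N) (q₀ : ℂ) (l : Vec2 →L[ℝ] ℂ) :
    IntegrableOn (fun u => g ‖u‖ • (q₀ + l u)) (Metric.ball (0 : Vec2) R) ∧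
    ∫ u in Metric.ball (0 : Vec2) R, g ‖u‖ • (q₀ + l u)
      = ((2 * volume.real (Metric.ball (0 : Vec2) 1) * ∫ s in Ioo 0 R, s * g s : ℝ) : ℂ) * q₀ := by
  have hfin : IsFiniteMeasure (volume.restrict (Metric.ball (0 : Vec2) R)) :=
    ⟨by simpa using measure_ball_lt_top (μ := volume) (x := (0 : Vec2)) (r := R)⟩
  have hN0 : 0 ≤ N := (abs_nonneg _).trans (hN 0)
  have hgm : Measurable fun u : Vec2 => g ‖u‖ := hg.comp measurable_norm
  have hl : Continuous fun u => l u := l.continuous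
  have i1 : IntegrableOn (fun u => g ‖u‖ • q₀) (Metric.ball (0 : Vec2) R) :=
    Integrable.of_bound (hgm.smul_const q₀).aestronglyMeasurable (N * ‖q₀‖) (ae_of_all _ fun u => by
      rw [norm_smul, Real.norm_eq_abs]
      gcongr
      exact hN _)
  have i2 : IntegrableOn (fun u => g ‖u‖ • l u) (Metric.ball (0 : Vec2) R) := by
    refine Integrable.of_bound (hgm.smul hl.measurable).aestronglyMeasurable (N * (‖l‖ * R)) ?_
    filter_upwards [ae_restrict_mem Metric.isOpen_ball.measurableSet] with u hu
    rw [norm_smul, Real.norm_eq_abs]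
    have hu' : ‖u‖ ≤ R := by
      rw [mem_ball_zero_iff] at hu
      exact hu.le
    have h1 := (l.le_opNorm u).trans (mul_le_mul_of_nonneg_left hu' (norm_nonneg l))
    exact mul_le_mul (hN _) h1 (norm_nonneg _) hN0
  have i3 := i1.add i2
  simp_rw [smul_add]
  refine ⟨i3, ?_⟩
  rw [integral_add i1 i2]
  -- The reflection `u ↦ -u` changes the sign of the linear part.
  have odd : ∫ u in Metric.ball (0 : Vec2) R, g ‖u‖ • l u = 0 := by
    rw [← integral_indicator Metric.isOpen_ball.measurableSet]
    have h := integral_neg_eq_self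
      ((Metric.ball (0 : Vec2) R).indicator fun u => g ‖u‖ • l u) volume
    have e : ∀ u : Vec2, (Metric.ball (0 : Vec2) R).indicator (fun u => g ‖u‖ • l u) (-u)
        = - (Metric.ball (0 : Vec2) R).indicator (fun u => g ‖u‖ • l u) u := fun u => by
      by_cases hu : u ∈ Metric.ball (0 : Vec2) R
      · rw [Set.indicator_of_mem hu, Set.indicator_of_mem (by simpa using hu)]
        simp
      · rw [Set.indicator_of_notMem hu, Set.indicator_of_notMem (by simpa using hu), neg_zero]
    simp_rw [e] at h
    rw [integral_neg] at h
    exact self_eq_neg.1 h.symm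
  rw [odd, add_zero, integral_smul_const, setIntegral_ball_norm, Complex.real_smul]

theorem integral_truncCube {ε R : ℝ} (hε : 0 < ε) (hεR : ε ≤ R) :
    ∫ s in Ioo 0 R, s * truncCube ε s = 1 / ε - 1 / R := by
  have hR : 0 < R := hε.trans_le hεR
  have e : ∀ s, s * truncCube ε s = (Ici ε).indicator (fun s => s * (s ^ 3)⁻¹) s := fun s => by
    by_cases h : ε ≤ s <;> simp [truncCube, Set.indicator, h]
  simp_rw [e]
  have e2 : Ici ε ∩ Ioo 0 R = Ico ε R := by
    ext s
    simp only [mem_inter_iff, mem_Ici, mem_Ioo, mem_Ico]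
    exact ⟨fun h => ⟨h.1, h.2.2⟩, fun h => ⟨h.1, hε.trans_le h.1, h.2⟩⟩
  rw [integral_indicator measurableSet_Ici, Measure.restrict_restrict measurableSet_Ici, e2,
    integral_Ico_eq_integral_Ioo, ← integral_Ioc_eq_integral_Ioo,
    ← intervalIntegral.integral_of_le hεR]
  have hpos : ∀ s ∈ uIcc ε R, 0 < s := fun s hs => by
    rw [uIcc_of_le hεR] at hs
    exact hε.trans_le hs.1
  have hd : ∀ s ∈ uIcc ε R, HasDerivAt (fun s : ℝ => -s⁻¹) (s * (s ^ 3)⁻¹) s := fun s hs => by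
    have hs0 := (hpos s hs).ne'
    refine (hasDerivAt_inv hs0).neg.congr_deriv ?_
    field_simp
  have hcont : ContinuousOn (fun s : ℝ => s * (s ^ 3)⁻¹) (uIcc ε R) := by
    refine continuousOn_id.mul (ContinuousOn.inv₀ (by fun_prop) fun s hs => ?_)
    exact pow_ne_zero 3 (hpos s hs).ne'
  rw [intervalIntegral.integral_eq_sub_of_hasDerivAt hd hcont.intervalIntegrable]
  simp only [one_div]
  ring

/-- The antiderivative `-ρ⁻¹ + δ²ρ⁻³` vanishes at `s = 0`, where `ρ = δ`. So no term of order `1/δ`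
appears, and this regularisation converges to the finite part without a correction. -/
theorem integral_regCube {δ R : ℝ} (hδ : 0 < δ) (hR : 0 < R) :
    ∫ s in Ioo 0 R, s * regCube δ s
      = -(√(R ^ 2 + δ ^ 2))⁻¹ + δ ^ 2 * (√(R ^ 2 + δ ^ 2) ^ 3)⁻¹ := by
  rw [← integral_Ioc_eq_integral_Ioo, ← intervalIntegral.integral_of_le hR.le]
  have hpos : ∀ s : ℝ, 0 < s ^ 2 + δ ^ 2 := fun s => by positivity
  have hsq : ∀ s : ℝ, HasDerivAt (fun s => √(s ^ 2 + δ ^ 2)) (s * (√(s ^ 2 + δ ^ 2))⁻¹) s :=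
    fun s => by
      have h1 : HasDerivAt (fun s : ℝ => s ^ 2 + δ ^ 2) (2 * s) s := by
        simpa using (hasDerivAt_pow 2 s).add_const (δ ^ 2)
      refine (h1.sqrt (hpos s).ne').congr_deriv ?_
      have := (Real.sqrt_pos.2 (hpos s)).ne'
      field_simp
  have hd : ∀ s ∈ uIcc 0 R, HasDerivAt
      (fun s => -(√(s ^ 2 + δ ^ 2))⁻¹ + δ ^ 2 * (√(s ^ 2 + δ ^ 2) ^ 3)⁻¹)
      (s * regCube δ s) s := fun s _ => by
    have h0 := (Real.sqrt_pos.2 (hpos s)).ne'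
    refine (((hsq s).inv h0).neg.add
      ((((hsq s).pow 3).inv (pow_ne_zero 3 h0)).const_mul (δ ^ 2))).congr_deriv ?_
    rw [regCube]
    simp only [Pi.pow_apply]
    field_simp
    ring
  have hcont : ContinuousOn (fun s : ℝ => s * regCube δ s) (uIcc 0 R) := by
    unfold regCube
    refine continuousOn_id.mul (ContinuousOn.sub ?_ (continuousOn_const.mul ?_))
    · exact ContinuousOn.inv₀ (by fun_prop) fun s _ =>
        pow_ne_zero 3 (Real.sqrt_pos.2 (hpos s)).ne'
    · exact ContinuousOn.inv₀ (by fun_prop) fun s _ =>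
        pow_ne_zero 5 (Real.sqrt_pos.2 (hpos s)).ne'
  rw [intervalIntegral.integral_eq_sub_of_hasDerivAt hd hcont.intervalIntegrable]
  have : √((0 : ℝ) ^ 2 + δ ^ 2) = δ := by
    rw [zero_pow two_ne_zero, zero_add, Real.sqrt_sq hδ.le]
  rw [this]
  field_simp
  ring

theorem integrableOn_ball_rpow {a R : ℝ} (ha : 0 < a) (hR : 0 < R) :
    IntegrableOn (fun u : Vec2 => ‖u‖ ^ (a - 2)) (Metric.ball 0 R) := by
  rw [integrableOn_fun_norm_addHaar (volume : Measure Vec2) (f := fun s => s ^ (a - 2))]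
  have h := (intervalIntegral.integrableOn_Ioo_rpow_iff (s := a - 1) hR).2 (by linarith)
  refine h.congr_fun (fun s hs => ?_) measurableSet_Ioo
  simp only [finrank_euclideanSpace, Fintype.card_fin, Nat.add_one_sub_one, pow_one, smul_eq_mul]
  rw [show a - 1 = 1 + (a - 2) by ring, Real.rpow_add hs.1, Real.rpow_one]

end

/-! ### Limits of truncated and regularised integrals over a disc -/

section

theorem ae_ne_zero_ball (R : ℝ) : ∀ᵐ u ∂volume.restrict (Metric.ball (0 : Vec2) R), u ≠ 0 :=
  ae_restrict_of_ae (by simp [ae_iff])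

theorem norm_affine_le {R : ℝ} (q₀ : ℂ) (l : Vec2 →L[ℝ] ℂ) {u : Vec2}
    (hu : u ∈ Metric.ball (0 : Vec2) R) : ‖q₀ + l u‖ ≤ ‖q₀‖ + ‖l‖ * R := by
  have hu' : ‖u‖ ≤ R := by
    rw [mem_ball_zero_iff] at hu
    exact hu.le
  exact (norm_add_le _ _).trans (add_le_add le_rfl
    ((l.le_opNorm u).trans (mul_le_mul_of_nonneg_left hu' (norm_nonneg l))))

theorem integrableOn_ball_smul_affine {R N : ℝ} {g : Vec2 → ℝ} (hg : Measurable g)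
    (hN : ∀ u, |g u| ≤ N) (q₀ : ℂ) (l : Vec2 →L[ℝ] ℂ) :
    IntegrableOn (fun u => g u • (q₀ + l u)) (Metric.ball (0 : Vec2) R) := by
  have hfin : IsFiniteMeasure (volume.restrict (Metric.ball (0 : Vec2) R)) :=
    ⟨by simpa using measure_ball_lt_top (μ := volume) (x := (0 : Vec2)) (r := R)⟩
  have hN0 : 0 ≤ N := (abs_nonneg _).trans (hN 0)
  have hl : Continuous fun u => q₀ + l u := continuous_const.add l.continuous
  refine Integrable.of_bound (hg.smul hl.measurable).aestronglyMeasurable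
    (N * (‖q₀‖ + ‖l‖ * R)) ?_
  filter_upwards [ae_restrict_mem Metric.isOpen_ball.measurableSet] with u hu
  rw [norm_smul, Real.norm_eq_abs]
  exact mul_le_mul (hN _) (norm_affine_le q₀ l hu) (norm_nonneg _) hN0

/-- The part of a strongly singular integral in the plane that converges, for an approximation
`k` of `r⁻³`. -/
theorem tendsto_planar_integral {ι : Type*} {f : Filter ι} [f.IsCountablyGenerated]
    {R C a : ℝ} (ha : 0 < a) (hR : 0 < R) {k : ι → ℝ → ℝ}
    (hkm : ∀ t, Measurable (k t)) (hkb : ∀ᶠ t in f, ∃ N, ∀ s, |k t s| ≤ N)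
    (hk : ∀ t s s', 0 < s → s ≤ s' → |k t s'| ≤ 4 * (s ^ 3)⁻¹)
    (hkl : ∀ s, 0 < s → Tendsto (fun t => k t s) f (𝓝 (s ^ 3)⁻¹))
    {r : Vec2 → ℝ} (hr : Measurable r) (hr1 : ∀ u, ‖u‖ ≤ r u) {Q : Vec2 → ℂ}
    (hQ : AEStronglyMeasurable Q (volume.restrict (Metric.ball 0 R)))
    (q₀ : ℂ) (l : Vec2 →L[ℝ] ℂ)
    (hb : ∀ u ∈ Metric.ball (0 : Vec2) R, ‖Q u - (q₀ + l u)‖ ≤ C * ‖u‖ ^ (1 + a)) {T : ℂ}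
    (hT : Tendsto (fun t => ∫ u in Metric.ball (0 : Vec2) R,
      (k t (r u) - k t ‖u‖) • (q₀ + l u)) f (𝓝 T)) :
    Tendsto (fun t => (∫ u in Metric.ball (0 : Vec2) R, k t (r u) • Q u)
        - ((2 * volume.real (Metric.ball (0 : Vec2) 1) * ∫ s in Ioo 0 R, s * k t s : ℝ) : ℂ) * q₀) f
      (𝓝 ((∫ u in Metric.ball (0 : Vec2) R, (r u ^ 3)⁻¹ • (Q u - (q₀ + l u))) + T)) := by
  have hfin : IsFiniteMeasure (volume.restrict (Metric.ball (0 : Vec2) R)) :=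
    ⟨by simpa using measure_ball_lt_top (μ := volume) (x := (0 : Vec2)) (r := R)⟩
  have hl : Continuous fun u => q₀ + l u := continuous_const.add l.continuous
  have hD : AEStronglyMeasurable (fun u => Q u - (q₀ + l u))
      (volume.restrict (Metric.ball 0 R)) := hQ.sub hl.aestronglyMeasurable
  -- Since `‖u‖ ≤ r u`, the kernel is at most `4 ‖u‖⁻³`; against the error `O(‖u‖^(1+a))` this
  -- leaves `‖u‖^(a-2)`, which is integrable in the plane.
  have hdom : ∀ t, ∀ᵐ u ∂volume.restrict (Metric.ball (0 : Vec2) R),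
      ‖k t (r u) • (Q u - (q₀ + l u))‖ ≤ 4 * C * ‖u‖ ^ (a - 2) := fun t => by
    filter_upwards [ae_ne_zero_ball R, ae_restrict_mem Metric.isOpen_ball.measurableSet]
      with u hu huB
    have hu0 : 0 < ‖u‖ := norm_pos_iff.2 hu
    rw [norm_smul, Real.norm_eq_abs]
    refine (mul_le_mul (hk t _ _ hu0 (hr1 u)) (hb u huB) (norm_nonneg _)
      (by positivity)).trans_eq ?_
    rw [show 1 + a = (a - 2) + 3 by ring, Real.rpow_add hu0]
    have : ‖u‖ ^ (3 : ℝ) = ‖u‖ ^ 3 := by exact_mod_cast Real.rpow_natCast ‖u‖ 3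
    rw [this]
    field_simp
  have hm : ∀ t, AEStronglyMeasurable (fun u => k t (r u) • (Q u - (q₀ + l u)))
      (volume.restrict (Metric.ball 0 R)) := fun t =>
    ((hkm t).comp hr).aestronglyMeasurable.smul hD
  have h1 : Tendsto (fun t => ∫ u in Metric.ball (0 : Vec2) R, k t (r u) • (Q u - (q₀ + l u))) f
      (𝓝 (∫ u in Metric.ball (0 : Vec2) R, (r u ^ 3)⁻¹ • (Q u - (q₀ + l u)))) := by
    refine tendsto_integral_filter_of_dominated_convergence
      (fun u => 4 * C * ‖u‖ ^ (a - 2)) (Eventually.of_forall hm) (Eventually.of_forall hdom)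
      ((integrableOn_ball_rpow ha hR).const_mul _) ?_
    filter_upwards [ae_ne_zero_ball R] with u hu
    exact (hkl _ ((norm_pos_iff.2 hu).trans_le (hr1 u))).smul_const _
  refine (h1.add hT).congr' ?_
  filter_upwards [hkb] with t ht
  obtain ⟨N, hN⟩ := ht
  have i1 : IntegrableOn (fun u => k t (r u) • (Q u - (q₀ + l u))) (Metric.ball (0 : Vec2) R) :=
    ((integrableOn_ball_rpow ha hR).const_mul _).mono' (hm t) (hdom t)
  have i2 : IntegrableOn (fun u => k t (r u) • (q₀ + l u)) (Metric.ball (0 : Vec2) R) :=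
    integrableOn_ball_smul_affine ((hkm t).comp hr) (fun u => hN _) q₀ l
  obtain ⟨i3, e3⟩ := setIntegral_ball_norm_smul_affine (R := R) (hkm t) hN q₀ l
  rw [← e3]
  -- The integral is split into three: the kernel against the non-affine error, the change of kernel
  -- from `r u` to `‖u‖` against the affine part, and the radial kernel against the affine part,
  -- which is explicit.
  have e4 : ∫ u in Metric.ball (0 : Vec2) R, (k t (r u) - k t ‖u‖) • (q₀ + l u)
      = (∫ u in Metric.ball (0 : Vec2) R, k t (r u) • (q₀ + l u))
        - ∫ u in Metric.ball (0 : Vec2) R, k t ‖u‖ • (q₀ + l u) := by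
    rw [← integral_sub i2 i3]
    simp_rw [sub_smul]
  have e5 : ∫ u in Metric.ball (0 : Vec2) R, k t (r u) • Q u
      = (∫ u in Metric.ball (0 : Vec2) R, k t (r u) • (Q u - (q₀ + l u)))
        + ∫ u in Metric.ball (0 : Vec2) R, k t (r u) • (q₀ + l u) := by
    rw [← integral_add i1 i2]
    refine integral_congr_ae (ae_of_all _ fun u => ?_)
    simp only
    rw [← smul_add, sub_add_cancel]
  rw [e4, e5]
  ring

/-- Dominated convergence with a multiple of `‖u‖⁻¹`, integrable in the plane. -/
theorem tendsto_setIntegral_of_diff_le {ι : Type*} {f : Filter ι} [f.IsCountablyGenerated]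
    {R N : ℝ} (hR : 0 < R) {g : ι → Vec2 → ℝ} {g₀ : Vec2 → ℝ}
    (hgm : ∀ t, Measurable (g t)) (hb : ∀ t u, u ≠ 0 → u ∈ Metric.ball 0 R → |g t u| ≤ N * ‖u‖⁻¹)
    (hlim : ∀ u, u ≠ 0 → Tendsto (fun t => g t u) f (𝓝 (g₀ u))) (q₀ : ℂ) (l : Vec2 →L[ℝ] ℂ) :
    (∀ t, IntegrableOn (fun u => g t u • (q₀ + l u)) (Metric.ball (0 : Vec2) R)) ∧
    Tendsto (fun t => ∫ u in Metric.ball (0 : Vec2) R, g t u • (q₀ + l u)) f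
      (𝓝 (∫ u in Metric.ball (0 : Vec2) R, g₀ u • (q₀ + l u))) := by
  have hl : Continuous fun u => q₀ + l u := continuous_const.add l.continuous
  have hi := ((integrableOn_ball_rpow one_pos hR).const_mul (N * (‖q₀‖ + ‖l‖ * R)))
  have hm : ∀ t, AEStronglyMeasurable (fun u => g t u • (q₀ + l u))
      (volume.restrict (Metric.ball 0 R)) := fun t =>
    ((hgm t).smul hl.measurable).aestronglyMeasurable
  have hdom : ∀ t, ∀ᵐ u ∂volume.restrict (Metric.ball (0 : Vec2) R),
      ‖g t u • (q₀ + l u)‖ ≤ N * (‖q₀‖ + ‖l‖ * R) * ‖u‖ ^ ((1 : ℝ) - 2) := fun t => by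
    filter_upwards [ae_ne_zero_ball R, ae_restrict_mem Metric.isOpen_ball.measurableSet]
      with u hu huB
    rw [norm_smul, Real.norm_eq_abs, show (1 : ℝ) - 2 = -1 by norm_num, Real.rpow_neg_one]
    have h1 := hb t u hu huB
    refine (mul_le_mul h1 (norm_affine_le q₀ l huB) (norm_nonneg _)
      ((abs_nonneg _).trans h1)).trans_eq (by ring)
  refine ⟨fun t => hi.mono' (hm t) (hdom t), ?_⟩
  refine tendsto_integral_filter_of_dominated_convergence _ (Eventually.of_forall hm)
    (Eventually.of_forall hdom) hi ?_
  filter_upwards [ae_ne_zero_ball R] with u hu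
  exact (hlim u hu).smul_const _

section

variable {R M : ℝ} {r : Vec2 → ℝ}

theorem tendsto_regCube {s : ℝ} (hs : 0 < s) :
    Tendsto (fun δ => regCube δ s) (𝓝[>] 0) (𝓝 (s ^ 3)⁻¹) := by
  have h0 : √(s ^ 2 + 0 ^ 2) ≠ 0 := by
    rw [zero_pow two_ne_zero, add_zero, Real.sqrt_sq hs.le]; exact hs.ne'
  have c1 : ContinuousAt (fun δ : ℝ => √(s ^ 2 + δ ^ 2)) 0 := by fun_prop
  have h : ContinuousAt (fun δ => regCube δ s) 0 :=
    ((c1.pow 3).inv₀ (pow_ne_zero 3 h0)).sub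
      (ContinuousAt.mul (by fun_prop) ((c1.pow 5).inv₀ (pow_ne_zero 5 h0)))
  rw [← regCube_zero hs.le]
  exact h.tendsto.mono_left nhdsWithin_le_nhds

theorem abs_inv_cube_sub_le {s ρ : ℝ} (hs : 0 < s) (hsρ : s ≤ ρ)
    (h2 : ρ ^ 2 ≤ s ^ 2 + M * s ^ 4) : |(ρ ^ 3)⁻¹ - (s ^ 3)⁻¹| ≤ 3 * M * s⁻¹ := by
  have h := inv_pow_sub_inv_pow_le hs hsρ 3
  have h0 : (ρ ^ 3)⁻¹ ≤ (s ^ 3)⁻¹ := by gcongr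
  rw [abs_sub_comm, abs_of_nonneg (sub_nonneg.2 h0)]
  refine h.trans ?_
  have : ρ ^ 2 - s ^ 2 ≤ M * s ^ 4 := by linarith
  calc _ ≤ (3 : ℕ) * (M * s ^ 4) * (s ^ (3 + 2))⁻¹ := by gcongr
    _ = _ := by push_cast; field_simp

/-- A graph that is flat to second order has `r² - ‖u‖² = O(‖u‖⁴)`. Replacing the spatial distance
by the planar one thus changes the regularised kernel by `O(‖u‖⁻¹)`, uniformly in `δ`. -/
theorem tendsto_planar_reg (hR : 0 < R) (hr : Measurable r) (hr1 : ∀ u, ‖u‖ ≤ r u)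
    (hr2 : ∀ u ∈ Metric.ball 0 R, r u ^ 2 ≤ ‖u‖ ^ 2 + M * ‖u‖ ^ 4) (q₀ : ℂ) (l : Vec2 →L[ℝ] ℂ) :
    Tendsto (fun δ => ∫ u in Metric.ball (0 : Vec2) R,
      (regCube δ (r u) - regCube δ ‖u‖) • (q₀ + l u)) (𝓝[>] 0)
      (𝓝 (∫ u in Metric.ball (0 : Vec2) R, ((r u ^ 3)⁻¹ - (‖u‖ ^ 3)⁻¹) • (q₀ + l u))) := by
  refine (tendsto_setIntegral_of_diff_le (N := 18 * M) hR
    (g := fun δ u => regCube δ (r u) - regCube δ ‖u‖) (fun δ =>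
    ((measurable_regCube δ).comp hr).sub ((measurable_regCube δ).comp measurable_norm))
    (fun δ u hu huB => ?_) (fun u hu => ?_) q₀ l).2
  · have hs := norm_pos_iff.2 hu
    refine (abs_regCube_sub_le δ hs (hr1 u)).trans ?_
    have : r u ^ 2 - ‖u‖ ^ 2 ≤ M * ‖u‖ ^ 4 := by linarith [hr2 u huB]
    calc _ ≤ 18 * (M * ‖u‖ ^ 4) * (‖u‖ ^ 5)⁻¹ := by gcongr
      _ = _ := by field_simp
  · have hs := norm_pos_iff.2 hu
    exact (tendsto_regCube (hs.trans_le (hr1 u))).sub (tendsto_regCube hs)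

/-- If `‖u‖ < ε ≤ r u`, then `‖u‖² ≥ ε² - Mε⁴`. So this annulus contains all points on which
truncation in space and truncation in the plane disagree. -/
theorem volume_real_annulus_le {ε : ℝ} (hM : 0 ≤ M) (hε : 0 < ε) :
    volume.real (Metric.ball (0 : Vec2) ε \ Metric.ball 0 (√(ε ^ 2 - M * ε ^ 4)))
      ≤ M * ε ^ 4 * volume.real (Metric.ball (0 : Vec2) 1) := by
  set t := √(ε ^ 2 - M * ε ^ 4)
  have ht : t ≤ ε := Real.sqrt_le_iff.2 ⟨hε.le, by
    have : 0 ≤ M * ε ^ 4 := by positivity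
    linarith⟩
  have ht2 : ε ^ 2 - t ^ 2 ≤ M * ε ^ 4 := by
    have : ε ^ 2 - M * ε ^ 4 ≤ t ^ 2 := (Real.sqrt_le_left (Real.sqrt_nonneg _)).1 le_rfl
    linarith
  have h1 : ∀ s : ℝ, 0 ≤ s → volume.real (Metric.ball (0 : Vec2) s)
      = s ^ 2 * volume.real (Metric.ball (0 : Vec2) 1) := fun s hs => by
    rw [measureReal_def, Measure.addHaar_ball _ _ hs]
    simp [measureReal_def, hs]
  rw [measureReal_sdiff (Metric.ball_subset_ball ht) Metric.isOpen_ball.measurableSet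
    measure_ball_lt_top.ne, h1 ε hε.le, h1 t (Real.sqrt_nonneg _), ← sub_mul]
  gcongr

/-- Where `ε ≤ ‖u‖` both kernels are present and differ by `O(‖u‖⁻¹)`. Where the truncations
disagree the kernel is at most `ε⁻³` on a set of area `O(ε⁴)`, which contributes `O(ε)`. -/
theorem tendsto_planar_trunc (hM : 0 ≤ M) (hR : 0 < R) (hr : Measurable r) (hr1 : ∀ u, ‖u‖ ≤ r u)
    (hr2 : ∀ u ∈ Metric.ball 0 R, r u ^ 2 ≤ ‖u‖ ^ 2 + M * ‖u‖ ^ 4) (q₀ : ℂ) (l : Vec2 →L[ℝ] ℂ) :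
    Tendsto (fun ε => ∫ u in Metric.ball (0 : Vec2) R,
      (truncCube ε (r u) - truncCube ε ‖u‖) • (q₀ + l u)) (𝓝[>] 0)
      (𝓝 (∫ u in Metric.ball (0 : Vec2) R, ((r u ^ 3)⁻¹ - (‖u‖ ^ 3)⁻¹) • (q₀ + l u))) := by
  have hr' : Measurable fun u => (r u ^ 3)⁻¹ := (hr.pow_const 3).inv
  set g : ℝ → Vec2 → ℝ := fun ε u => if ε ≤ ‖u‖ then (r u ^ 3)⁻¹ - (‖u‖ ^ 3)⁻¹ else 0 with hg
  set A : ℝ → Set Vec2 := fun ε => {u | ‖u‖ < ε ∧ ε ≤ r u} with hA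
  have hAm : ∀ ε, MeasurableSet (A ε) := fun ε =>
    (measurableSet_lt measurable_norm measurable_const).inter
      (measurableSet_le measurable_const hr)
  obtain ⟨i1, t1⟩ := tendsto_setIntegral_of_diff_le (f := 𝓝[>] (0 : ℝ)) (N := 3 * M) hR (g := g)
    (g₀ := fun u => (r u ^ 3)⁻¹ - (‖u‖ ^ 3)⁻¹) (fun ε =>
    Measurable.ite (measurableSet_le measurable_const measurable_norm)
      (hr'.sub (measurable_norm.pow_const 3).inv) measurable_const)
    (fun ε u hu huB => by
      have hs := norm_pos_iff.2 hu
      simp only [hg]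
      split_ifs
      · exact abs_inv_cube_sub_le hs (hr1 u) (hr2 u huB)
      · rw [abs_zero]; positivity)
    (fun u hu => by
      refine tendsto_const_nhds.congr' ?_
      filter_upwards [nhdsWithin_le_nhds (Iio_mem_nhds (norm_pos_iff.2 hu))] with ε hε
      simp only [hg]
      rw [if_pos (le_of_lt hε)]) q₀ l
  have t2 : Tendsto (fun ε => ∫ u in Metric.ball (0 : Vec2) R,
      ((A ε).indicator (fun u => (r u ^ 3)⁻¹) u) • (q₀ + l u)) (𝓝[>] 0) (𝓝 0) := by
    set K := volume.real (Metric.ball (0 : Vec2) 1) with hK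
    have h0 : Tendsto (fun ε : ℝ => (‖q₀‖ + ‖l‖ * R) * (M * K) * ε) (𝓝[>] 0) (𝓝 0) := by
      have : Continuous fun ε : ℝ => (‖q₀‖ + ‖l‖ * R) * (M * K) * ε := by fun_prop
      simpa using (this.tendsto 0).mono_left nhdsWithin_le_nhds
    refine squeeze_zero_norm' ?_ h0
    filter_upwards [self_mem_nhdsWithin] with ε hε
    rw [mem_Ioi] at hε
    set B := Metric.ball (0 : Vec2) ε \ Metric.ball 0 (√(ε ^ 2 - M * ε ^ 4))
    have hB : MeasurableSet B :=
      Metric.isOpen_ball.measurableSet.diff Metric.isOpen_ball.measurableSet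
    have hBfin : volume B < ⊤ := (measure_mono sdiff_subset).trans_lt measure_ball_lt_top
    have hd : ∀ᵐ u ∂volume.restrict (Metric.ball (0 : Vec2) R),
        ‖((A ε).indicator (fun u => (r u ^ 3)⁻¹) u) • (q₀ + l u)‖
          ≤ B.indicator (fun _ => (ε ^ 3)⁻¹ * (‖q₀‖ + ‖l‖ * R)) u := by
      filter_upwards [ae_restrict_mem Metric.isOpen_ball.measurableSet] with u huB
      by_cases hu : u ∈ A ε
      · have hρ : 0 < r u := hε.trans_le hu.2
        have huB' : u ∈ B := by
          refine ⟨by simpa using hu.1, ?_⟩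
          rw [mem_ball_zero_iff, not_lt]
          refine Real.sqrt_le_iff.2 ⟨norm_nonneg _, ?_⟩
          have h1 : ε ^ 2 ≤ r u ^ 2 := by have := hu.2; gcongr
          have h2 : M * ‖u‖ ^ 4 ≤ M * ε ^ 4 := by have := hu.1.le; gcongr
          linarith [hr2 u huB]
        rw [Set.indicator_of_mem hu, Set.indicator_of_mem huB', norm_smul, Real.norm_eq_abs,
          abs_of_nonneg (by positivity)]
        have h3 := hu.2
        exact mul_le_mul (by gcongr) (norm_affine_le q₀ l huB) (norm_nonneg _) (by positivity)
      · rw [Set.indicator_of_notMem hu, zero_smul, norm_zero]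
        exact Set.indicator_nonneg (fun _ _ => by positivity) _
    have hBi : Integrable (B.indicator fun _ => (ε ^ 3)⁻¹ * (‖q₀‖ + ‖l‖ * R))
        (volume : Measure Vec2) := by
      rw [integrable_indicator_iff hB]
      exact integrableOn_const hBfin.ne
    refine (norm_integral_le_of_norm_le hBi.integrableOn hd).trans ?_
    refine (setIntegral_le_integral hBi (ae_of_all _ fun u =>
      Set.indicator_nonneg (fun _ _ => by positivity) _)).trans ?_
    rw [integral_indicator_const _ hB, smul_eq_mul]
    refine (mul_le_mul_of_nonneg_right (volume_real_annulus_le hM hε) (by positivity)).trans_eq ?_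
    rw [← hK]
    field_simp
  have t3 := t1.add t2
  rw [add_zero] at t3
  refine t3.congr' ?_
  filter_upwards [self_mem_nhdsWithin] with ε hε
  rw [mem_Ioi] at hε
  have i2 : IntegrableOn (fun u => ((A ε).indicator (fun u => (r u ^ 3)⁻¹) u) • (q₀ + l u))
      (Metric.ball (0 : Vec2) R) := by
    refine integrableOn_ball_smul_affine (N := (ε ^ 3)⁻¹) (hr'.indicator (hAm ε)) (fun u => ?_) q₀ l
    by_cases hu : u ∈ A ε
    · rw [Set.indicator_of_mem hu]
      have hρ : 0 < r u := hε.trans_le hu.2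
      have h3 := hu.2
      rw [abs_of_nonneg (by positivity)]
      gcongr
    · rw [Set.indicator_of_notMem hu, abs_zero]
      positivity
  rw [← integral_add (i1 ε) i2]
  refine integral_congr_ae (ae_of_all _ fun u => ?_)
  simp only
  rw [← add_smul]
  congr 1
  simp only [hg, hA, truncCube, Set.indicator, mem_ofPred_eq]
  have := hr1 u
  by_cases h1 : ε ≤ ‖u‖
  · simp [h1, h1.trans this]
  · by_cases h2 : ε ≤ r u <;> simp [h1, h2, not_le.1 h1]

/-- The finite part of a strongly singular integral in the plane, by truncation and by
regularisation. -/
theorem exists_planar_finitePart (hM : 0 ≤ M) (hR : 0 < R) (hr : Measurable r)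
    (hr1 : ∀ u, ‖u‖ ≤ r u)
    (hr2 : ∀ u ∈ Metric.ball 0 R, r u ^ 2 ≤ ‖u‖ ^ 2 + M * ‖u‖ ^ 4) {C a : ℝ} (ha : 0 < a)
    {Q : Vec2 → ℂ} (hQ : AEStronglyMeasurable Q (volume.restrict (Metric.ball 0 R)))
    (q₀ : ℂ) (l : Vec2 →L[ℝ] ℂ)
    (hb : ∀ u ∈ Metric.ball (0 : Vec2) R, ‖Q u - (q₀ + l u)‖ ≤ C * ‖u‖ ^ (1 + a)) :
    ∃ c L : ℂ, Tendsto (fun ε : ℝ => (∫ u in Metric.ball (0 : Vec2) R, truncCube ε (r u) • Q u)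
        - c / (ε : ℂ)) (𝓝[>] 0) (𝓝 L) ∧
      Tendsto (fun δ => ∫ u in Metric.ball (0 : Vec2) R, regCube δ (r u) • Q u)
        (𝓝[>] 0) (𝓝 L) := by
  set K := volume.real (Metric.ball (0 : Vec2) 1) with hK
  have h1 := tendsto_planar_integral (f := 𝓝[>] (0 : ℝ)) ha hR measurable_truncCube
    (by filter_upwards [self_mem_nhdsWithin] with ε hε using ⟨_, fun s => abs_truncCube_le hε⟩)
    (fun ε s s' hs hss => by
      have : 0 < s' := hs.trans_le hss
      have h3 : (s' ^ 3)⁻¹ ≤ (s ^ 3)⁻¹ := by gcongr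
      have h4 : 0 < (s' ^ 3)⁻¹ := by positivity
      unfold truncCube
      split_ifs
      · rw [abs_of_pos h4]; linarith
      · rw [abs_zero]; positivity)
    (fun s hs => by
      refine tendsto_const_nhds.congr' ?_
      filter_upwards [nhdsWithin_le_nhds (Iio_mem_nhds hs)] with ε hε
      rw [truncCube, if_pos (le_of_lt hε)])
    hr hr1 hQ q₀ l hb (tendsto_planar_trunc hM hR hr hr1 hr2 q₀ l)
  have h2 := tendsto_planar_integral (f := 𝓝[>] (0 : ℝ)) ha hR measurable_regCube
    (by filter_upwards [self_mem_nhdsWithin] with ε hε using ⟨_, abs_regCube_le_delta hε⟩)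
    (fun δ s s' hs hss => abs_regCube_le δ hs hss)
    (fun s hs => tendsto_regCube hs)
    hr hr1 hQ q₀ l hb (tendsto_planar_reg hR hr hr1 hr2 q₀ l)
  set T : ℂ := _ + _ with hT
  clear_value T
  -- `T` is the convergent part, the same for both kernels; `K` is the area of the unit disc. The
  -- truncated radial integral `1/ε - 1/R` yields the divergent coefficient `2Kq₀`, and the
  -- regularised one tends to the same finite part `-1/R`.
  refine ⟨2 * K * q₀, T - 2 * K * q₀ / R, ?_, ?_⟩
  · refine (h1.sub_const (2 * K * q₀ / R)).congr' ?_
    filter_upwards [Ioo_mem_nhdsGT hR] with ε hε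
    rw [integral_truncCube hε.1 hε.2.le]
    push_cast
    ring
  · have h3 : Tendsto (fun δ : ℝ => ((2 * K * ∫ s in Ioo 0 R, s * regCube δ s : ℝ) : ℂ) * q₀)
        (𝓝[>] 0) (𝓝 (((2 * K * (-R⁻¹ + 0 ^ 2 * (R ^ 3)⁻¹) : ℝ) : ℂ) * q₀)) := by
      have hc : ContinuousAt (fun δ : ℝ => ((2 * K * (-(√(R ^ 2 + δ ^ 2))⁻¹
          + δ ^ 2 * (√(R ^ 2 + δ ^ 2) ^ 3)⁻¹) : ℝ) : ℂ) * q₀) 0 := by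
        have h0 : √(R ^ 2 + 0 ^ 2) ≠ 0 := by
          rw [zero_pow two_ne_zero, add_zero, Real.sqrt_sq hR.le]; exact hR.ne'
        have c1 : ContinuousAt (fun δ : ℝ => √(R ^ 2 + δ ^ 2)) 0 := by fun_prop
        refine ContinuousAt.mul (Complex.continuous_ofReal.continuousAt.comp
          (continuousAt_const.mul ((c1.inv₀ h0).neg.add
          (ContinuousAt.mul (by fun_prop) ((c1.pow 3).inv₀ (pow_ne_zero 3 h0)))))) continuousAt_const
      have h4 := hc.tendsto.mono_left (nhdsWithin_le_nhds (s := Ioi (0 : ℝ)))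
      have h5 : √(R ^ 2 + 0 ^ 2) = R := by
        rw [zero_pow two_ne_zero, add_zero, Real.sqrt_sq hR.le]
      rw [h5] at h4
      refine h4.congr' ?_
      filter_upwards [self_mem_nhdsWithin] with δ hδ
      rw [integral_regCube hδ hR]
    have h6 := h2.add h3
    refine (h6.congr fun δ => sub_add_cancel _ _).trans_eq ?_
    congr 1
    push_cast
    ring

end

end

section

/-! ### Finite parts on the surface -/

variable {Ω : Set Vec3} {x : Vec3}

/-- In the chart `L (φ(u) - x)` is linear in `u` up to `h(u) L(b₂)`, and the area density is one up
to `O(‖u‖²)`. On a bounded disc quadratic errors are `O(‖u‖^(1+a))` because `a ≤ 1`. -/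
theorem IsGraphChart.exists_density_sub_affine_le {b : OrthonormalBasis (Fin 3) ℝ Vec3}
    {h : Vec2 → ℝ} {V : Set Vec3} {ρ : ℝ} (hc : IsGraphChart Ω x b h V ρ) {q : Vec3 → ℂ}
    {q₀ : ℂ} {L : Vec3 →L[ℝ] ℂ} {C a : ℝ} (ha : 0 < a) (ha1 : a ≤ 1)
    (hb : ∀ y ∈ frontier Ω, ‖q y - (q₀ + L (y - x))‖ ≤ C * ‖y - x‖ ^ (1 + a)) :
    ∃ l : Vec2 →L[ℝ] ℂ, ∃ C', ∀ u ∈ Metric.ball (0 : Vec2) ρ,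
      ‖graphDensity h u • q (graphMap x b h u) - (q₀ + l u)‖ ≤ C' * ‖u‖ ^ (1 + a) := by
  obtain ⟨K, hK⟩ := hc.exists_lipschitzWith
  obtain ⟨M, hM, hJ⟩ := hc.exists_graphDensity_sub_one_le
  obtain ⟨N, hN, hh⟩ := hc.exists_abs_le
  set C₀ := max C 0
  have hC₀ : 0 ≤ C₀ := le_max_right _ _
  refine ⟨L.comp ((EuclideanSpace.proj (𝕜 := ℝ) (0 : Fin 2)).smulRight (b 0)
    + (EuclideanSpace.proj (𝕜 := ℝ) (1 : Fin 2)).smulRight (b 1)),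
    (1 + M * ρ ^ 2) * (C₀ * K ^ (1 + a))
      + ρ ^ (1 - a) * (M * (‖q₀‖ + ‖L‖ * (K * ρ)) + N * ‖L (b 2)‖), fun u hu => ?_⟩
  have hu' : ‖u‖ < ρ := by simpa using hu
  have hρ : 0 < ρ := hc.pos
  have hφ : ‖graphMap x b h u - x‖ ≤ K * ‖u‖ := by
    have := hK.dist_le_mul u 0
    rwa [hc.graphMap_zero, dist_eq_norm, dist_zero_right] at this
  have hmem : graphMap x b h u ∈ frontier Ω := by
    have : graphMap x b h u ∈ graphMap x b h '' Metric.ball 0 ρ := mem_image_of_mem _ hu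
    rw [hc.image_ball] at this
    exact this.1
  have e1 : graphDensity h u • q (graphMap x b h u) - (q₀ + (L.comp
      ((EuclideanSpace.proj (𝕜 := ℝ) (0 : Fin 2)).smulRight (b 0)
        + (EuclideanSpace.proj (𝕜 := ℝ) (1 : Fin 2)).smulRight (b 1))) u)
      = graphDensity h u • (q (graphMap x b h u) - (q₀ + L (graphMap x b h u - x)))
        + ((graphDensity h u - 1) • (q₀ + L (graphMap x b h u - x)) + h u • L (b 2)) := by
    have : L (graphMap x b h u - x) = u 0 • L (b 0) + u 1 • L (b 1) + h u • L (b 2) := by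
      simp only [graphMap, ← map_smul, ← map_add]
      congr 1
      abel
    rw [this]
    simp only [ContinuousLinearMap.comp_apply, add_apply,
      ContinuousLinearMap.smulRight_apply, PiLp.proj_apply, map_add, map_smul, sub_smul,
      smul_sub, one_smul]
    abel
  have hsq : ‖u‖ ^ 2 ≤ ρ ^ (1 - a) * ‖u‖ ^ (1 + a) := by
    rcases eq_or_ne u 0 with rfl | hu0
    · rw [norm_zero, zero_pow two_ne_zero]; positivity
    have hpos := norm_pos_iff.2 hu0
    have h2 : ‖u‖ ^ 2 = ‖u‖ ^ (1 - a) * ‖u‖ ^ (1 + a) := by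
      rw [← Real.rpow_add hpos]
      norm_num
    rw [h2]
    gcongr
  have hJ1 : |graphDensity h u| ≤ 1 + M * ρ ^ 2 := by
    have h1 := hJ u
    have h2 : M * ‖u‖ ^ 2 ≤ M * ρ ^ 2 := by gcongr
    have h3 := abs_sub_abs_le_abs_sub (graphDensity h u) 1
    rw [abs_one] at h3
    linarith
  have h1 : ‖graphDensity h u • (q (graphMap x b h u) - (q₀ + L (graphMap x b h u - x)))‖
      ≤ (1 + M * ρ ^ 2) * (C₀ * K ^ (1 + a)) * ‖u‖ ^ (1 + a) := by
    rw [norm_smul, Real.norm_eq_abs, mul_assoc, mul_assoc,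
      ← Real.mul_rpow K.coe_nonneg (norm_nonneg u)]
    refine mul_le_mul hJ1 ((hb _ hmem).trans ?_) (norm_nonneg _) (by positivity)
    calc _ ≤ C₀ * ‖graphMap x b h u - x‖ ^ (1 + a) := by
          gcongr
          exact le_max_left _ _
      _ ≤ _ := by gcongr
  have h2 : ‖(graphDensity h u - 1) • (q₀ + L (graphMap x b h u - x))‖
      ≤ M * ‖u‖ ^ 2 * (‖q₀‖ + ‖L‖ * (K * ρ)) := by
    rw [norm_smul, Real.norm_eq_abs]
    refine mul_le_mul (hJ u) ((norm_add_le _ _).trans ?_) (norm_nonneg _) (by positivity)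
    gcongr
    refine (L.le_opNorm _).trans ?_
    gcongr
    exact hφ.trans (by gcongr)
  have h3 : ‖h u • L (b 2)‖ ≤ N * ‖u‖ ^ 2 * ‖L (b 2)‖ := by
    rw [norm_smul, Real.norm_eq_abs]
    gcongr
    exact hh u
  rw [e1]
  refine (norm_add_le _ _).trans ((add_le_add h1 ((norm_add_le _ _).trans
    (add_le_add h2 h3))).trans ?_)
  have h4 : M * ‖u‖ ^ 2 * (‖q₀‖ + ‖L‖ * (K * ρ)) + N * ‖u‖ ^ 2 * ‖L (b 2)‖
      = ‖u‖ ^ 2 * (M * (‖q₀‖ + ‖L‖ * (K * ρ)) + N * ‖L (b 2)‖) := by ring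
  have h5 : ‖u‖ ^ 2 * (M * (‖q₀‖ + ‖L‖ * (K * ρ)) + N * ‖L (b 2)‖)
      ≤ ρ ^ (1 - a) * ‖u‖ ^ (1 + a) * (M * (‖q₀‖ + ‖L‖ * (K * ρ)) + N * ‖L (b 2)‖) := by gcongr
  rw [h4]
  refine (add_le_add le_rfl h5).trans_eq ?_
  ring

/-- The finite part of a strongly singular integral on the surface, by truncation and by
regularisation. -/
theorem IsSmoothBoundedDomain.exists_finitePart (hΩ : IsSmoothBoundedDomain Ω)
    (hx : x ∈ frontier Ω) {q : Vec3 → ℂ}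
    (hq : AEStronglyMeasurable q (surfaceMeasure (frontier Ω)))
    {q₀ : ℂ} {L : Vec3 →L[ℝ] ℂ} {C a : ℝ} (ha : 0 < a) (ha1 : a ≤ 1)
    (hb : ∀ y ∈ frontier Ω, ‖q y - (q₀ + L (y - x))‖ ≤ C * ‖y - x‖ ^ (1 + a)) :
    (∀ ε, 0 < ε → Integrable (fun y => truncCube ε ‖y - x‖ • q y)
      (surfaceMeasure (frontier Ω))) ∧
    ∃ c l : ℂ, Tendsto (fun ε : ℝ => (∫ y, truncCube ε ‖y - x‖ • q y
        ∂surfaceMeasure (frontier Ω)) - c / (ε : ℂ)) (𝓝[>] 0) (𝓝 l) ∧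
      Tendsto (fun δ => ∫ y, regCube δ ‖y - x‖ • q y ∂surfaceMeasure (frontier Ω))
        (𝓝[>] 0) (𝓝 l) := by
  have hfin := hΩ.isFiniteMeasure
  obtain ⟨b, h, V, ρ, hc⟩ := hΩ.exists_isGraphChart hx
  obtain ⟨B, hB⟩ : ∃ B, ∀ y ∈ frontier Ω, ‖q y‖ ≤ B := by
    obtain ⟨M, hM, hMb⟩ := hΩ.exists_norm_le
    set C₀ := max C 0
    have hC₀ : 0 ≤ C₀ := le_max_right _ _
    refine ⟨C₀ * (2 * M) ^ (1 + a) + (‖q₀‖ + ‖L‖ * (2 * M)), fun y hy => ?_⟩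
    have hyx : ‖y - x‖ ≤ 2 * M := by
      have := norm_sub_le y x
      linarith [hMb y hy, hMb x hx]
    have h1 : ‖q y‖ ≤ ‖q y - (q₀ + L (y - x))‖ + ‖q₀ + L (y - x)‖ := by
      simpa using norm_add_le (q y - (q₀ + L (y - x))) (q₀ + L (y - x))
    refine h1.trans (add_le_add ((hb y hy).trans ?_) ((norm_add_le _ _).trans ?_))
    · calc _ ≤ C₀ * ‖y - x‖ ^ (1 + a) := by
            gcongr
            exact le_max_left _ _
        _ ≤ _ := by gcongr
    · gcongr
      exact (L.le_opNorm _).trans (by gcongr)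
  have hB0 : 0 ≤ B := (norm_nonneg _).trans (hB x hx)
  have hnm : Measurable fun y : Vec3 => ‖y - x‖ := (measurable_id.sub_const x).norm
  have hqi : ∀ {k : ℝ → ℝ} {N : ℝ}, Measurable k → (∀ s, |k s| ≤ N) →
      Integrable (fun y => k ‖y - x‖ • q y) (surfaceMeasure (frontier Ω)) := fun {k N} hk hN => by
    refine Integrable.of_bound ((hk.comp hnm).aestronglyMeasurable.smul hq) (N * B) ?_
    filter_upwards [ae_mem_frontier Ω] with y hy
    rw [norm_smul, Real.norm_eq_abs]
    exact mul_le_mul (hN _) (hB y hy) (norm_nonneg _) ((abs_nonneg _).trans (hN 0))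
  refine ⟨fun ε hε => hqi (measurable_truncCube ε) fun s => abs_truncCube_le hε, ?_⟩
  obtain ⟨l, C', hl⟩ := hc.exists_density_sub_affine_le ha ha1 hb
  obtain ⟨N, hN, hh⟩ := hc.exists_abs_le
  set r : Vec2 → ℝ := fun u => ‖graphMap x b h u - x‖ with hrdef
  have hrm : Measurable r :=
    ((contDiff_graphMap x b hc.contDiff).continuous.sub continuous_const).norm.measurable
  have hr2 : ∀ u, r u ^ 2 = ‖u‖ ^ 2 + h u ^ 2 := fun u => by
    have := norm_sq_graphMap_sub x b h u 0
    rwa [hc.graphMap_zero, sub_zero, hc.apply_zero, sub_zero] at this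
  have hr1 : ∀ u, ‖u‖ ≤ r u := fun u => by
    refine le_of_sq_le_sq ?_ (norm_nonneg _)
    rw [hr2]
    exact le_add_of_nonneg_right (sq_nonneg _)
  have hQ : AEStronglyMeasurable (fun u => graphDensity h u • q (graphMap x b h u))
      (volume.restrict (Metric.ball 0 ρ)) :=
    (continuous_graphDensity hc.contDiff).aestronglyMeasurable.smul (hc.aestronglyMeasurable_comp hq)
  obtain ⟨c, T, h1, h2⟩ := exists_planar_finitePart (M := N ^ 2) (sq_nonneg N) hc.pos hrm hr1
    (fun u _ => by
      rw [hr2]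
      have : h u ^ 2 ≤ (N * ‖u‖ ^ 2) ^ 2 := by
        rw [← sq_abs (h u)]
        gcongr
        exact hh u
      linarith [show (N * ‖u‖ ^ 2) ^ 2 = N ^ 2 * ‖u‖ ^ 4 by ring]) ha hQ q₀ l hl
  have hchart : ∀ k : ℝ → ℝ, ∫ y in V, k ‖y - x‖ • q y ∂surfaceMeasure (frontier Ω)
      = ∫ u in Metric.ball 0 ρ, k (r u) • (graphDensity h u • q (graphMap x b h u)) := fun k => by
    rw [hc.setIntegral_eq]
    simp_rw [hrdef, smul_comm (graphDensity h _)]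
  have hVm := hc.isOpen.measurableSet
  obtain ⟨s, hs, hball⟩ := Metric.isOpen_iff.1 hc.isOpen x hc.mem
  have hfar : ∀ y ∈ Vᶜ, s ≤ ‖y - x‖ := fun y hy => by
    by_contra! hlt
    exact hy (hball (by rwa [mem_ball_iff_norm]))
  -- Off the chart the distance to `x` is at least `s`, so both approximations converge there to the
  -- same ordinary integral, the truncated one being constant once `ε < s`.
  refine ⟨c, T + ∫ y in Vᶜ, (‖y - x‖ ^ 3)⁻¹ • q y ∂surfaceMeasure (frontier Ω), ?_, ?_⟩
  · refine (h1.add_const _).congr' ?_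
    filter_upwards [Ioo_mem_nhdsGT hs] with ε hε
    rw [← integral_add_compl hVm (hqi (measurable_truncCube ε) fun s => abs_truncCube_le hε.1),
      hchart]
    have : ∫ y in Vᶜ, truncCube ε ‖y - x‖ • q y ∂surfaceMeasure (frontier Ω)
        = ∫ y in Vᶜ, (‖y - x‖ ^ 3)⁻¹ • q y ∂surfaceMeasure (frontier Ω) := by
      refine setIntegral_congr_fun hVm.compl fun y hy => ?_
      rw [truncCube, if_pos (hε.2.le.trans (hfar y hy))]
    rw [this]
    ring
  · have h3 : Tendsto (fun δ => ∫ y in Vᶜ, regCube δ ‖y - x‖ • q y ∂surfaceMeasure (frontier Ω))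
        (𝓝[>] 0) (𝓝 (∫ y in Vᶜ, (‖y - x‖ ^ 3)⁻¹ • q y ∂surfaceMeasure (frontier Ω))) := by
      refine tendsto_integral_filter_of_dominated_convergence (fun _ => 4 * (s ^ 3)⁻¹ * B)
        (Eventually.of_forall fun δ => ?_) (Eventually.of_forall fun δ => ?_)
        (integrable_const _) ?_
      · exact (((measurable_regCube δ).comp hnm).aestronglyMeasurable.smul hq).restrict
      · filter_upwards [ae_restrict_mem hVm.compl, ae_restrict_of_ae (ae_mem_frontier Ω)]
          with y hy hyΓ
        rw [norm_smul, Real.norm_eq_abs]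
        exact mul_le_mul (abs_regCube_le δ hs (hfar y hy)) (hB y hyΓ) (norm_nonneg _)
          (by positivity)
      · filter_upwards [ae_restrict_mem hVm.compl] with y hy
        exact (tendsto_regCube (hs.trans_le (hfar y hy))).smul_const _
    refine (h2.add h3).congr' ?_
    filter_upwards [self_mem_nhdsWithin] with δ hδ
    rw [← integral_add_compl hVm (hqi (measurable_regCube δ) fun s => abs_regCube_le_delta hδ s),
      hchart]

end

section

/-! ### Tangential derivatives of single-layer potentials -/

variable {Ω : Set Vec3} {x : Vec3}

theorem dirDeriv_eq_sum (f : Vec3 → ℂ) (c y : Vec3) :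
    dirDeriv c f y = ∑ j, (c j : ℂ) * partialD j f y := by
  have h : c = ∑ j, c j • EuclideanSpace.single j (1 : ℝ) := by
    ext i
    simp [Finset.sum_apply, Pi.single_apply]
  rw [dirDeriv]
  conv_lhs => rw [h]
  simp [partialD, dirDeriv, map_sum]

theorem inner_eq_sum (a c : Vec3) : inner ℝ a c = ∑ i, a i * c i := by
  simp [PiLp.inner_apply, mul_comm]

/-- Stokes' theorem for the surface, in invariant form. -/
theorem IsSmoothBoundedDomain.integral_normal_wedge_dirDeriv (hΩ : IsSmoothBoundedDomain Ω)
    {f : Vec3 → ℂ} (hf : ContDiff ℝ 1 f) (a c : Vec3) :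
    Integrable (fun y => ((inner ℝ (outwardNormal Ω y) a : ℝ) : ℂ) * dirDeriv c f y
      - ((inner ℝ (outwardNormal Ω y) c : ℝ) : ℂ) * dirDeriv a f y)
      (surfaceMeasure (frontier Ω)) ∧
    ∫ y, (((inner ℝ (outwardNormal Ω y) a : ℝ) : ℂ) * dirDeriv c f y
      - ((inner ℝ (outwardNormal Ω y) c : ℝ) : ℂ) * dirDeriv a f y)
      ∂surfaceMeasure (frontier Ω) = 0 := by
  have hn : ∀ i, ContinuousOn (fun y => (outwardNormal Ω y i : ℂ)) (frontier Ω) := fun i =>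
    Complex.continuous_ofReal.comp_continuousOn
      ((EuclideanSpace.proj (𝕜 := ℝ) i).continuous.comp_continuousOn hΩ.continuousOn_outwardNormal)
  have hi : ∀ i j, Integrable (fun y => (a i : ℂ) * (c j : ℂ) * ((outwardNormal Ω y i : ℂ)
      * partialD j f y - (outwardNormal Ω y j : ℂ) * partialD i f y))
      (surfaceMeasure (frontier Ω)) := fun i j => by
    refine (hΩ.integrable_of_continuousOn ?_).const_mul _
    exact ((hn i).mul (continuous_partialD hf j).continuousOn).sub
      ((hn j).mul (continuous_partialD hf i).continuousOn)
  have e : ∀ y, ((inner ℝ (outwardNormal Ω y) a : ℝ) : ℂ) * dirDeriv c f y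
      - ((inner ℝ (outwardNormal Ω y) c : ℝ) : ℂ) * dirDeriv a f y
      = ∑ i, ∑ j, (a i : ℂ) * (c j : ℂ) * ((outwardNormal Ω y i : ℂ)
      * partialD j f y - (outwardNormal Ω y j : ℂ) * partialD i f y) := fun y => by
    rw [dirDeriv_eq_sum f c, dirDeriv_eq_sum f a, inner_eq_sum, inner_eq_sum]
    simp only [Fin.sum_univ_three]
    push_cast
    ring
  simp_rw [e]
  refine ⟨integrable_finsetSum _ fun i _ => integrable_finsetSum _ fun j _ => hi i j, ?_⟩
  rw [integral_finsetSum _ fun i _ => integrable_finsetSum _ fun j _ => hi i j]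
  refine Finset.sum_eq_zero fun i _ => ?_
  rw [integral_finsetSum _ fun j _ => hi i j]
  refine Finset.sum_eq_zero fun j _ => ?_
  rw [integral_const_mul, hΩ.integral_normal_wedge_grad hf, mul_zero]

namespace IsGraphChart

variable {b : OrthonormalBasis (Fin 3) ℝ Vec3} {h : Vec2 → ℝ} {V : Set Vec3} {ρ : ℝ}

/-- The tangent vector `∂ᵢ φ` of a graph chart. -/
def _root_.Poroelastic.graphTangent (b : OrthonormalBasis (Fin 3) ℝ Vec3) (h : Vec2 → ℝ)
    (i : Fin 2) (u : Vec2) : Vec3 := b (Fin.castSucc i) + planeD i h u • b 2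

theorem graphMap_mem (hc : IsGraphChart Ω x b h V ρ) {u : Vec2} (hu : u ∈ Metric.ball 0 ρ) :
    graphMap x b h u ∈ frontier Ω := by
  have : graphMap x b h u ∈ graphMap x b h '' Metric.ball 0 ρ := mem_image_of_mem _ hu
  rw [hc.image_ball] at this
  exact this.1

theorem graphMap_planeProj (hc : IsGraphChart Ω x b h V ρ) {y : Vec3} (hy : y ∈ frontier Ω ∩ V) :
    graphMap x b h (planeProj b (y - x)) = y := by
  rw [← hc.image_ball] at hy
  obtain ⟨u, -, rfl⟩ := hy
  rw [planeProj_graphMap]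

theorem inner_normal_graphTangent (hc : IsGraphChart Ω x b h V ρ) {u : Vec2}
    (hu : u ∈ Metric.ball 0 ρ) (i : Fin 2) :
    inner ℝ (outwardNormal Ω (graphMap x b h u)) (graphTangent b h i u) = 0 := by
  have hpos : 0 < √(1 + planeD 0 h u ^ 2 + planeD 1 h u ^ 2) := Real.sqrt_pos.2 (by positivity)
  have h1 : inner ℝ (√(1 + planeD 0 h u ^ 2 + planeD 1 h u ^ 2) • outwardNormal Ω
      (graphMap x b h u)) (graphTangent b h i u) = 0 := by
    rw [hc.normal u hu]
    fin_cases i <;>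
    simp [graphTangent, inner_sub_left, inner_add_right, inner_smul_left, inner_smul_right]
  rw [real_inner_smul_left] at h1
  exact (mul_eq_zero.1 h1).resolve_left hpos.ne'

theorem fderiv_graphMap_apply (hc : IsGraphChart Ω x b h V ρ) (u w : Vec2) :
    fderiv ℝ (graphMap x b h) u w = ∑ i, w i • graphTangent b h i u := by
  have hd : DifferentiableAt ℝ h u := (hc.contDiff.differentiable (by simp)) u
  have hw : w = ∑ i, w i • EuclideanSpace.single i (1 : ℝ) := by
    ext i
    fin_cases i <;> simp
  obtain ⟨e0, e1⟩ := fderiv_graphMap_single x b hd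
  conv_lhs => rw [hw]
  simp only [Fin.sum_univ_two, map_add, map_smul, e0, e1]
  rfl

/-- A function on the surface is differentiable if it is so in a graph chart. -/
theorem hasFDerivWithinAt (hc : IsGraphChart Ω x b h V ρ) {E : Type*} [NormedAddCommGroup E]
    [NormedSpace ℝ E] {F : Vec3 → E} {l : Vec2 →L[ℝ] E}
    (hF : HasFDerivAt (fun u => F (graphMap x b h u)) l 0) :
    DifferentiableWithinAt ℝ F (frontier Ω) x := by
  have h1 : DifferentiableAt ℝ (fun y => planeProj b (y - x)) x := by
    rw [differentiableAt_euclidean]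
    intro i
    fin_cases i <;> simp [planeProj] <;>
    exact (differentiableAt_const _).inner ℝ (differentiableAt_id.sub_const x)
  have h2 : DifferentiableAt ℝ (fun u => F (graphMap x b h u)) (planeProj b (x - x)) := by
    have : planeProj b (x - x) = 0 := by
      ext i
      fin_cases i <;> simp [planeProj]
    rw [this]
    exact hF.differentiableAt
  have h3 := (DifferentiableAt.comp x (f := fun y => planeProj b (y - x)) h2 h1).differentiableWithinAt
    (s := frontier Ω)
  have hev : ∀ᶠ y in 𝓝[frontier Ω] x, F y
      = ((fun u => F (graphMap x b h u)) ∘ fun y => planeProj b (y - x)) y := by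
    filter_upwards [self_mem_nhdsWithin, nhdsWithin_le_nhds (hc.isOpen.mem_nhds hc.mem)] with y hy hV
    simp only [Function.comp]
    rw [hc.graphMap_planeProj ⟨hy, hV⟩]
  refine h3.congr_of_eventuallyEq hev ?_
  simp only [Function.comp]
  rw [hc.graphMap_planeProj ⟨?_, hc.mem⟩]
  have := hc.graphMap_mem (Metric.mem_ball_self hc.pos)
  rwa [hc.graphMap_zero] at this

theorem hasFDerivAt_comp (hc : IsGraphChart Ω x b h V ρ) {E : Type*} [NormedAddCommGroup E]
    [NormedSpace ℝ E] {F : Vec3 → E} {F' : Vec3 →L[ℝ] E}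
    (hF : HasFDerivWithinAt F F' (frontier Ω) x) :
    HasFDerivAt (fun u => F (graphMap x b h u)) (F'.comp (fderiv ℝ (graphMap x b h) 0)) 0 := by
  have hd : HasFDerivAt (graphMap x b h) (fderiv ℝ (graphMap x b h) 0) 0 :=
    (((contDiff_graphMap x b hc.contDiff).differentiable (by simp)) 0).hasFDerivAt
  rw [← hc.graphMap_zero] at hF
  have := HasFDerivWithinAt.comp (0 : Vec2) hF hd.hasFDerivWithinAt
    (s := Metric.ball 0 ρ) (fun u hu => hc.graphMap_mem hu)
  exact this.hasFDerivAt (Metric.ball_mem_nhds _ hc.pos)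

theorem graphTangent_zero (hc : IsGraphChart Ω x b h V ρ) (i : Fin 2) :
    graphTangent b h i 0 = b (Fin.castSucc i) := by
  simp [graphTangent, planeD, hc.fderiv_zero]

theorem tangent_eq_sum (hc : IsGraphChart Ω x b h V ρ) {t : Vec3}
    (ht : inner ℝ (outwardNormal Ω x) t = 0) :
    t = ∑ i : Fin 2, (inner ℝ (b (Fin.castSucc i)) t : ℝ) • b (Fin.castSucc i) := by
  conv_lhs => rw [basis_expand b t]
  rw [hc.basis_two, ht, zero_smul, add_zero, Fin.sum_univ_two]
  rfl

/-- The derivative along the surface, computed in a graph chart. -/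
theorem fderivWithin_apply (hc : IsGraphChart Ω x b h V ρ) {E : Type*} [NormedAddCommGroup E]
    [NormedSpace ℝ E] {F : Vec3 → E} {F' : Vec3 →L[ℝ] E} {l : Vec2 →L[ℝ] E}
    (hF : HasFDerivWithinAt F F' (frontier Ω) x)
    (hl : HasFDerivAt (fun u => F (graphMap x b h u)) l 0)
    {t : Vec3} (ht : inner ℝ (outwardNormal Ω x) t = 0) :
    F' t = l (planeProj b t) := by
  rw [hl.unique (hc.hasFDerivAt_comp hF), ContinuousLinearMap.comp_apply, hc.fderiv_graphMap_apply]
  simp_rw [hc.graphTangent_zero]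
  conv_lhs => rw [hc.tangent_eq_sum ht]
  congr 1

end IsGraphChart

/-- A derivative along the surface is determined only on tangent vectors; in the normal direction
`fderivWithin` depends on a choice. On tangent vectors every admissible derivative is the one
computed in a chart. -/
theorem IsSmoothBoundedDomain.fderivWithin_eq (hΩ : IsSmoothBoundedDomain Ω)
    (hx : x ∈ frontier Ω) {E : Type*} [NormedAddCommGroup E] [NormedSpace ℝ E] {F : Vec3 → E}
    {F' : Vec3 →L[ℝ] E} (hF : HasFDerivWithinAt F F' (frontier Ω) x)
    {t : Vec3} (ht : inner ℝ (outwardNormal Ω x) t = 0) :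
    fderivWithin ℝ F (frontier Ω) x t = F' t := by
  obtain ⟨b, h, V, ρ, hc⟩ := hΩ.exists_isGraphChart hx
  rw [hc.fderivWithin_apply hF (hc.hasFDerivAt_comp hF) ht,
    hc.fderivWithin_apply hF.differentiableWithinAt.hasFDerivWithinAt (hc.hasFDerivAt_comp hF) ht]

end

/-! ### Regularised single-layer potentials and their tangential derivatives -/

section

variable {Ω : Set Vec3} {x : Vec3} {k : ℂ} {v : Vec3 → ℂ}

/-- The single-layer potential with the regularised kernel. -/
def regSingleLayer (k : ℂ) (Ω : Set Vec3) (v : Vec3 → ℂ) (δ : ℝ) (ξ : Vec3) : ℂ :=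
  ∫ y, kG k (regR δ (ξ - y)) * v y ∂surfaceMeasure (frontier Ω)

/-- The derivative of the regularised single-layer potential in the direction `t`. -/
def regSingleLayerDeriv (k : ℂ) (Ω : Set Vec3) (v : Vec3 → ℂ) (δ : ℝ) (ξ t : Vec3) : ℂ :=
  ∫ y, v y * (kA k (regR δ (ξ - y)) * (inner ℝ (ξ - y) t : ℝ)) ∂surfaceMeasure (frontier Ω)

/-- The weakly singular form of the kernel of the tangential derivative. -/
def tanKernel (k : ℂ) (Ω : Set Vec3) (v : Vec3 → ℂ) (δ : ℝ) (ξ t y : Vec3) : ℂ :=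
  kA k (regR δ (ξ - y)) * ((v y - v ξ) * (inner ℝ (ξ - y) t : ℝ)
    + v ξ * (inner ℝ (outwardNormal Ω ξ) (outwardNormal Ω ξ - outwardNormal Ω y)
        * inner ℝ (ξ - y) t
      - inner ℝ (outwardNormal Ω ξ - outwardNormal Ω y) t
        * inner ℝ (ξ - y) (outwardNormal Ω ξ) : ℝ))

theorem continuous_kA_regR_sub (k : ℂ) {δ : ℝ} (hδ : δ ≠ 0) :
    Continuous fun p : Vec3 × Vec3 => kA k (regR δ (p.1 - p.2)) :=
  (contDiff_kA_regR k hδ (n := 0)).continuous.comp (continuous_fst.sub continuous_snd)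

theorem continuous_kA_regR_const_sub (k : ℂ) {δ : ℝ} (hδ : δ ≠ 0) (ξ : Vec3) :
    Continuous fun y => kA k (regR δ (ξ - y)) := by
  have h1 : Continuous fun z => kA k (regR δ z) := (contDiff_kA_regR k hδ (n := 0)).continuous
  have h2 : Continuous fun y : Vec3 => ξ - y := continuous_const.sub continuous_id
  exact h1.comp h2

theorem contDiff_kG_regR_const_sub (k : ℂ) {δ : ℝ} (hδ : δ ≠ 0) (ξ : Vec3) :
    ContDiff ℝ 1 fun y => kG k (regR δ (ξ - y)) := by
  have h1 : ContDiff ℝ 1 fun z => kG k (regR δ z) := contDiff_kG_regR k hδ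
  have h2 : ContDiff ℝ 1 fun y : Vec3 => ξ - y := contDiff_const.sub contDiff_id
  exact h1.comp h2

theorem hasFDerivAt_kG_regR_sub_const (k : ℂ) {δ : ℝ} (hδ : δ ≠ 0) (ξ y : Vec3) :
    HasFDerivAt (fun ξ => kG k (regR δ (ξ - y)))
      (kA k (regR δ (ξ - y)) • (Complex.ofRealCLM.comp (innerSL ℝ (ξ - y)))) ξ := by
  have h1 := hasFDerivAt_kG_regR k (regR_pos_of_ne hδ (ξ - y))
  have h2 : HasFDerivAt (fun ξ : Vec3 => ξ - y) (ContinuousLinearMap.id ℝ Vec3) ξ :=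
    (hasFDerivAt_id ξ).sub_const y
  refine (h1.comp ξ h2).congr_fderiv ?_
  ext t
  simp [-map_sub]
  ring

theorem dirDeriv_kG_regR_const_sub (k : ℂ) {δ : ℝ} (hδ : δ ≠ 0) (ξ c y : Vec3) :
    dirDeriv c (fun y => kG k (regR δ (ξ - y))) y
      = -(kA k (regR δ (ξ - y)) * (inner ℝ (ξ - y) c : ℝ)) := by
  have h1 := hasFDerivAt_kG_regR k (regR_pos_of_ne hδ (ξ - y))
  have h2 : HasFDerivAt (fun y : Vec3 => ξ - y) (-ContinuousLinearMap.id ℝ Vec3) y :=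
    (hasFDerivAt_id y).const_sub ξ
  have h3 : HasFDerivAt (fun y => kG k (regR δ (ξ - y))) _ y := h1.comp y h2
  rw [dirDeriv, h3.fderiv]
  simp [-map_sub]
  ring

/-- Differentiation under the integral sign: for `δ ≠ 0` the gradient of the kernel is continuous,
hence bounded for base points in a unit ball and `y` on the compact surface. -/
theorem IsSmoothBoundedDomain.hasFDerivAt_regSingleLayer (hΩ : IsSmoothBoundedDomain Ω)
    (hv : ContinuousOn v (frontier Ω)) {δ : ℝ} (hδ : δ ≠ 0) (ξ : Vec3) :
    ∃ D : Vec3 →L[ℝ] ℂ, HasFDerivAt (regSingleLayer k Ω v δ) D ξ ∧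
      ∀ t, D t = regSingleLayerDeriv k Ω v δ ξ t := by
  have hfin := hΩ.isFiniteMeasure
  set F' : Vec3 → Vec3 → Vec3 →L[ℝ] ℂ := fun ξ y =>
    (v y * kA k (regR δ (ξ - y))) • (Complex.ofRealCLM.comp (innerSL ℝ (ξ - y))) with hF'
  have hcA := continuous_kA_regR_const_sub k hδ
  have hcG := fun ξ => (contDiff_kG_regR_const_sub k hδ ξ).continuous
  have hcontF' : ∀ ξ, ContinuousOn (F' ξ) (frontier Ω) := fun ξ => by
    have h1 : Continuous fun y : Vec3 => innerSL ℝ (ξ - y) :=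
      (innerSL ℝ).continuous.comp (continuous_const.sub continuous_id)
    exact (hv.mul (hcA ξ).continuousOn).smul (continuous_const.clm_comp h1).continuousOn
  obtain ⟨Bv, hBv⟩ := hΩ.isCompact_frontier.exists_bound_of_continuousOn hv
  obtain ⟨N, hN⟩ := ((isCompact_closedBall ξ 1).prod hΩ.isCompact_frontier).exists_bound_of_continuousOn
    ((continuous_kA_regR_sub k hδ).mul (Complex.continuous_ofReal.comp
      (continuous_fst.sub continuous_snd).norm)).continuousOn
  have hd := hasFDerivAt_integral_of_dominated_of_fderiv_le (𝕜 := ℝ)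
    (μ := surfaceMeasure (frontier Ω)) (F := fun ξ y => kG k (regR δ (ξ - y)) * v y)
    (F' := F') (x₀ := ξ) (bound := fun _ => N * Bv) (Metric.ball_mem_nhds ξ one_pos)
    (Eventually.of_forall fun ξ => aestronglyMeasurable_of_continuousOn
      ((hcG ξ).continuousOn.mul hv))
    (hΩ.integrable_of_continuousOn ((hcG ξ).continuousOn.mul hv))
    (aestronglyMeasurable_of_continuousOn (hcontF' ξ))
    (by
      filter_upwards [ae_mem_frontier Ω] with y hy ξ' hξ'
      have h1 : ‖kA k (regR δ (ξ' - y)) * ((‖ξ' - y‖ : ℝ) : ℂ)‖ ≤ N :=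
        hN (ξ', y) ⟨Metric.ball_subset_closedBall hξ', hy⟩
      have h2 := hBv y hy
      rw [norm_mul, Complex.norm_real, norm_norm] at h1
      have h3 : ‖Complex.ofRealCLM.comp (innerSL ℝ (ξ' - y))‖ ≤ ‖ξ' - y‖ := by
        refine (ContinuousLinearMap.opNorm_comp_le _ _).trans ?_
        rw [Complex.ofRealCLM_norm, one_mul, innerSL_apply_norm]
      simp only [hF']
      rw [norm_smul, norm_mul]
      calc ‖v y‖ * ‖kA k (regR δ (ξ' - y))‖ * ‖Complex.ofRealCLM.comp (innerSL ℝ (ξ' - y))‖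
          ≤ ‖v y‖ * ‖kA k (regR δ (ξ' - y))‖ * ‖ξ' - y‖ := by gcongr
        _ = ‖kA k (regR δ (ξ' - y))‖ * ‖ξ' - y‖ * ‖v y‖ := by ring
        _ ≤ N * Bv := mul_le_mul h1 h2 (norm_nonneg _) ((by positivity : 0 ≤
            ‖kA k (regR δ (ξ' - y))‖ * ‖ξ' - y‖).trans h1))
    (integrable_const _)
    (ae_of_all _ fun y ξ' _ => by
      refine ((hasFDerivAt_kG_regR_sub_const k hδ ξ' y).mul_const (v y)).congr_fderiv ?_
      exact (mul_smul _ _ _).symm)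
  refine ⟨_, hd, fun t => ?_⟩
  rw [ContinuousLinearMap.integral_apply (hΩ.integrable_of_continuousOn (hcontF' ξ))]
  refine integral_congr_ae (ae_of_all _ fun y => ?_)
  simp [hF', -map_sub]
  ring

/-- Stokes' theorem turns the derivative of the regularised single-layer potential into a weakly
singular integral. -/
theorem IsSmoothBoundedDomain.regSingleLayerDeriv_eq (hΩ : IsSmoothBoundedDomain Ω)
    (hv : ContinuousOn v (frontier Ω)) {δ : ℝ} (hδ : δ ≠ 0) {ξ t : Vec3} (hξ : ξ ∈ frontier Ω)
    (ht : inner ℝ (outwardNormal Ω ξ) t = 0) :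
    regSingleLayerDeriv k Ω v δ ξ t
      = ∫ y, tanKernel k Ω v δ ξ t y ∂surfaceMeasure (frontier Ω) := by
  have hf := contDiff_kG_regR_const_sub k hδ ξ
  have hdir := dirDeriv_kG_regR_const_sub k hδ ξ
  obtain ⟨hi, h0⟩ := hΩ.integral_normal_wedge_dirDeriv hf (outwardNormal Ω ξ) t
  have hcA := continuous_kA_regR_const_sub k hδ ξ
  have hi2 : Integrable (fun y => v y * (kA k (regR δ (ξ - y)) * (inner ℝ (ξ - y) t : ℝ)))
      (surfaceMeasure (frontier Ω)) := by
    refine hΩ.integrable_of_continuousOn (hv.mul (Continuous.continuousOn (hcA.mul ?_)))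
    exact Complex.continuous_ofReal.comp ((continuous_const.sub continuous_id).inner continuous_const)
  -- The added bracket is the Stokes integrand for the vectors `ν(ξ)` and `t`, of total integral
  -- zero. The factor `v ξ` turns the density into the difference `v y - v ξ`, and since `t` is
  -- tangent at `ξ` only differences of normals remain besides.
  have e : ∀ y, tanKernel k Ω v δ ξ t y
      = v y * (kA k (regR δ (ξ - y)) * (inner ℝ (ξ - y) t : ℝ))
        + v ξ * (((inner ℝ (outwardNormal Ω y) (outwardNormal Ω ξ) : ℝ) : ℂ)
            * dirDeriv t (fun y => kG k (regR δ (ξ - y))) y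
          - ((inner ℝ (outwardNormal Ω y) t : ℝ) : ℂ)
            * dirDeriv (outwardNormal Ω ξ) (fun y => kG k (regR δ (ξ - y))) y) := fun y => by
    rw [tanKernel, hdir, hdir, inner_sub_right,
      inner_sub_left (outwardNormal Ω ξ), ht, real_inner_self_eq_norm_sq,
      hΩ.norm_outwardNormal hξ, real_inner_comm (outwardNormal Ω ξ) (outwardNormal Ω y)]
    push_cast
    ring
  rw [regSingleLayerDeriv, integral_congr_ae (ae_of_all _ e), integral_add hi2 (hi.const_mul _), integral_const_mul, h0, mul_zero, add_zero]

end

/-! ### Joint convergence of the tangential derivatives -/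

section

variable {Ω : Set Vec3} {x : Vec3} {k : ℂ} {v : Vec3 → ℂ}

/-- Hölder continuity on the surface near `x`, uniformly with respect to all of the surface. -/
def IsHolderNear (Ω : Set Vec3) (v : Vec3 → ℂ) (x : Vec3) (a : ℝ) : Prop :=
  ∃ C : ℝ, 0 ≤ C ∧ ∃ ρ > 0, ∀ ξ ∈ frontier Ω, ‖ξ - x‖ < ρ → ∀ y ∈ frontier Ω,
    ‖v y - v ξ‖ ≤ C * ‖ξ - y‖ ^ a

theorem tendsto_regR {ι : Type*} {l : Filter ι} {δ : ι → ℝ} {z : ι → Vec3} {δ₀ : ℝ} {z₀ : Vec3}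
    (hδ : Tendsto δ l (𝓝 δ₀)) (hz : Tendsto z l (𝓝 z₀)) :
    Tendsto (fun p => regR (δ p) (z p)) l (𝓝 (regR δ₀ z₀)) :=
  (((hz.norm.pow 2).add (hδ.pow 2)).sqrt :)

namespace IsSmoothBoundedDomain

theorem exists_norm_sub_le (hΩ : IsSmoothBoundedDomain Ω) :
    ∃ M : ℝ, 0 < M ∧ ∀ ξ ∈ frontier Ω, ∀ y ∈ frontier Ω, ‖ξ - y‖ ≤ M := by
  obtain ⟨M, hM, h⟩ := hΩ.exists_norm_le
  refine ⟨2 * M, by positivity, fun ξ hξ y hy => ?_⟩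
  have := norm_sub_le ξ y
  linarith [h ξ hξ, h y hy]

/-- The factor `kA` is `O(d⁻³)` in the distance `d`. It multiplies a Hölder difference times `d`, of
order `d^(1+a)`, and products of a normal difference with `d`, of order `d²`, which on a bounded
surface is also `O(d^(1+a))`. The bound is uniform in `δ` and in base points near `x`, as the joint
limit demands. -/
theorem exists_tanKernel_le (hΩ : IsSmoothBoundedDomain Ω) (hx : x ∈ frontier Ω)
    (hv : ContinuousOn v (frontier Ω)) {a : ℝ} (ha1 : a ≤ 1)
    (hvH : IsHolderNear Ω v x a) :
    ∃ C : ℝ, 0 ≤ C ∧ ∃ ρ > 0, ∀ δ, |δ| ≤ 1 → ∀ ξ ∈ frontier Ω, ‖ξ - x‖ < ρ → ∀ t,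
      ∀ y ∈ frontier Ω, y ≠ ξ → ‖tanKernel k Ω v δ ξ t y‖ ≤ C * ‖t‖ * ‖y - ξ‖ ^ (a - 2) := by
  obtain ⟨Cv, hCv, ρ₁, hρ₁, h1⟩ := hvH
  obtain ⟨Cn, hCn, ρ₂, hρ₂, h2⟩ := hΩ.exists_normal_lipschitz hx
  obtain ⟨M, hM, hMb⟩ := hΩ.exists_norm_sub_le
  obtain ⟨Bv, hBv⟩ := hΩ.isCompact_frontier.exists_bound_of_continuousOn hv
  -- For `|δ| ≤ 1` the regularised distance is at most `M + 1`.
  obtain ⟨Ck, hCk, hk⟩ := exists_profile_bounds k (M + 1)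
  have hBv0 : 0 ≤ Bv := (norm_nonneg _).trans (hBv x hx)
  refine ⟨Ck * (Cv + Bv * (2 * Cn) * M ^ (1 - a)), by positivity, min ρ₁ ρ₂, lt_min hρ₁ hρ₂,
    fun δ hδ ξ hξ hξx t y hy hyξ => ?_⟩
  rw [norm_sub_rev y ξ]
  set d := ‖ξ - y‖ with hd
  have hd0 : 0 < d := norm_pos_iff.2 (sub_ne_zero.2 hyξ.symm)
  have hdM : d ≤ M := hMb ξ hξ y hy
  have hR1 : d ≤ regR δ (ξ - y) := norm_le_regR δ _
  have hA : ‖kA k (regR δ (ξ - y))‖ ≤ Ck / d ^ 3 := by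
    refine (hk _ (hd0.trans_le hR1) ((regR_le δ _).trans (add_le_add hdM hδ))).2.1.trans ?_
    gcongr
  have hnn : ‖outwardNormal Ω ξ‖ = 1 := hΩ.norm_outwardNormal hξ
  have hn : ‖outwardNormal Ω ξ - outwardNormal Ω y‖ ≤ Cn * d :=
    h2 ξ hξ (hξx.trans_le (min_le_right _ _)) y hy
  have hvd : ‖v y - v ξ‖ ≤ Cv * d ^ a := h1 ξ hξ (hξx.trans_le (min_le_left _ _)) y hy
  have i1 : |inner ℝ (ξ - y) t| ≤ d * ‖t‖ := abs_real_inner_le_norm _ _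
  have i2 : |inner ℝ (outwardNormal Ω ξ) (outwardNormal Ω ξ - outwardNormal Ω y)| ≤ Cn * d := by
    refine (abs_real_inner_le_norm _ _).trans ?_
    rwa [hnn, one_mul]
  have i3 : |inner ℝ (outwardNormal Ω ξ - outwardNormal Ω y) t| ≤ Cn * d * ‖t‖ :=
    (abs_real_inner_le_norm _ _).trans (by gcongr)
  have i4 : |inner ℝ (ξ - y) (outwardNormal Ω ξ)| ≤ d := by
    refine (abs_real_inner_le_norm _ _).trans_eq ?_
    rw [hnn, mul_one]
  have hsq : d ^ 2 ≤ M ^ (1 - a) * d ^ (1 + a) := by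
    have h2 : d ^ 2 = d ^ (1 - a) * d ^ (1 + a) := by
      rw [← Real.rpow_add hd0]
      norm_num
    rw [h2]
    gcongr
  have hda : d ^ (1 + a) = d * d ^ a := by rw [Real.rpow_add hd0, Real.rpow_one]
  have hb1 : ‖(v y - v ξ) * ((inner ℝ (ξ - y) t : ℝ) : ℂ)‖ ≤ Cv * ‖t‖ * d ^ (1 + a) := by
    rw [norm_mul, Complex.norm_real, Real.norm_eq_abs, hda]
    calc _ ≤ Cv * d ^ a * (d * ‖t‖) := mul_le_mul hvd i1 (abs_nonneg _) (by positivity)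
      _ = _ := by ring
  have hb2 : ‖v ξ * ((inner ℝ (outwardNormal Ω ξ) (outwardNormal Ω ξ - outwardNormal Ω y)
        * inner ℝ (ξ - y) t
      - inner ℝ (outwardNormal Ω ξ - outwardNormal Ω y) t
        * inner ℝ (ξ - y) (outwardNormal Ω ξ) : ℝ) : ℂ)‖
      ≤ Bv * (2 * Cn) * ‖t‖ * (M ^ (1 - a) * d ^ (1 + a)) := by
    rw [norm_mul, Complex.norm_real, Real.norm_eq_abs]
    have h3 : |inner ℝ (outwardNormal Ω ξ) (outwardNormal Ω ξ - outwardNormal Ω y)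
        * inner ℝ (ξ - y) t
      - inner ℝ (outwardNormal Ω ξ - outwardNormal Ω y) t
        * inner ℝ (ξ - y) (outwardNormal Ω ξ)| ≤ 2 * Cn * ‖t‖ * d ^ 2 := by
      refine (abs_sub _ _).trans ?_
      rw [abs_mul, abs_mul]
      calc _ ≤ Cn * d * (d * ‖t‖) + Cn * d * ‖t‖ * d := by gcongr
        _ = _ := by ring
    calc _ ≤ Bv * (2 * Cn * ‖t‖ * d ^ 2) :=
          mul_le_mul (hBv ξ hξ) h3 (abs_nonneg _) hBv0
      _ = Bv * (2 * Cn) * ‖t‖ * d ^ 2 := by ring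
      _ ≤ _ := by gcongr
  rw [tanKernel, norm_mul]
  calc _ ≤ Ck / d ^ 3 * (Cv * ‖t‖ * d ^ (1 + a)
        + Bv * (2 * Cn) * ‖t‖ * (M ^ (1 - a) * d ^ (1 + a))) :=
        mul_le_mul hA ((norm_add_le _ _).trans (add_le_add hb1 hb2)) (norm_nonneg _)
          (by positivity)
    _ = Ck * (Cv + Bv * (2 * Cn) * M ^ (1 - a)) * ‖t‖ * (d ^ (1 + a) / d ^ 3) := by ring
    _ = _ := by
      congr 1
      rw [show a - 2 = (1 + a) - 3 by ring, Real.rpow_sub hd0]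
      congr 1
      exact_mod_cast (Real.rpow_natCast d 3).symm

theorem aestronglyMeasurable_tanKernel (hΩ : IsSmoothBoundedDomain Ω)
    (hv : ContinuousOn v (frontier Ω)) (δ : ℝ) (ξ t : Vec3) :
    AEStronglyMeasurable (tanKernel k Ω v δ ξ t) (surfaceMeasure (frontier Ω)) := by
  have h1 : Measurable fun y => kA k (regR δ (ξ - y)) :=
    (measurable_kA k).comp ((measurable_regR δ).comp (measurable_const.sub measurable_id))
  refine h1.aestronglyMeasurable.mul (aestronglyMeasurable_of_continuousOn ?_)
  have hz : ContinuousOn (fun y => ξ - y) (frontier Ω) := by fun_prop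
  have hn : ContinuousOn (fun y => outwardNormal Ω ξ - outwardNormal Ω y) (frontier Ω) :=
    continuousOn_const.sub hΩ.continuousOn_outwardNormal
  have hof := fun {f : Vec3 → ℝ} (hf : ContinuousOn f (frontier Ω)) =>
    Complex.continuous_ofReal.comp_continuousOn hf
  have e1 := hz.inner (𝕜 := ℝ) (continuousOn_const (c := t))
  have e2 := hz.inner (𝕜 := ℝ) (continuousOn_const (c := outwardNormal Ω ξ))
  have e3 := (continuousOn_const (c := outwardNormal Ω ξ)).inner (𝕜 := ℝ) hn
  have e4 := hn.inner (𝕜 := ℝ) (continuousOn_const (c := t))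
  exact ((hv.sub continuousOn_const).mul (hof e1)).add
    (continuousOn_const.mul (hof ((e3.mul e1).sub (e4.mul e2))))

theorem tendsto_tanKernel (hΩ : IsSmoothBoundedDomain Ω) (hx : x ∈ frontier Ω)
    (hv : ContinuousOn v (frontier Ω)) {y : Vec3} (hxy : x ≠ y) {ι : Type*} {l : Filter ι}
    {δ : ι → ℝ} {ξ T : ι → Vec3} {t : Vec3} (hδ : Tendsto δ l (𝓝 0))
    (hξ : Tendsto ξ l (𝓝[frontier Ω] x)) (hT : Tendsto T l (𝓝 t)) :
    Tendsto (fun p => tanKernel k Ω v (δ p) (ξ p) (T p) y) l (𝓝 (tanKernel k Ω v 0 x t y)) := by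
  have hz : Tendsto (fun p => ξ p - y) l (𝓝 (x - y)) :=
    (tendsto_nhds_of_tendsto_nhdsWithin hξ).sub_const y
  have hA : Tendsto (fun p => kA k (regR (δ p) (ξ p - y))) l (𝓝 (kA k (regR 0 (x - y)))) :=
    (continuousAt_kA k (regR_pos 0 (sub_ne_zero.2 hxy)).ne').tendsto.comp (tendsto_regR hδ hz)
  have hv' : Tendsto (fun p => v (ξ p)) l (𝓝 (v x)) := (hv x hx).tendsto.comp hξ
  have hn : Tendsto (fun p => outwardNormal Ω (ξ p)) l (𝓝 (outwardNormal Ω x)) :=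
    (hΩ.continuousOn_outwardNormal x hx).tendsto.comp hξ
  have e1 := hz.inner (𝕜 := ℝ) hT
  have e2 := hz.inner (𝕜 := ℝ) hn
  have hn' := hn.sub_const (outwardNormal Ω y)
  have e3 := hn.inner (𝕜 := ℝ) hn'
  have e4 := hn'.inner (𝕜 := ℝ) hT
  have h1 : Tendsto (fun p => ((inner ℝ (ξ p - y) (T p) : ℝ) : ℂ)) l
      (𝓝 ((inner ℝ (x - y) t : ℝ) : ℂ)) := (Complex.continuous_ofReal.tendsto _).comp e1
  have h2 := (Complex.continuous_ofReal.tendsto _).comp ((e3.mul e1).sub (e4.mul e2))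
  unfold tanKernel
  exact hA.mul (((tendsto_const_nhds.sub hv').mul h1).add (hv'.mul h2))

end IsSmoothBoundedDomain

/-- The limit is joint in `δ` and the point of the chart. This supplies the uniformity that permits
differentiation and `δ → 0` to be interchanged. -/
theorem IsGraphChart.tendsto_integral_tanKernel (hΩ : IsSmoothBoundedDomain Ω)
    (hx : x ∈ frontier Ω) {b : OrthonormalBasis (Fin 3) ℝ Vec3} {h : Vec2 → ℝ} {V : Set Vec3}
    {ρ : ℝ} (hc : IsGraphChart Ω x b h V ρ) (hv : ContinuousOn v (frontier Ω)) {a : ℝ}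
    (ha : 0 < a) (ha1 : a ≤ 1) (hvH : IsHolderNear Ω v x a) (i : Fin 2) :
    Tendsto (fun p : ℝ × Vec2 => ∫ y, tanKernel k Ω v p.1 (graphMap x b h p.2)
        (graphTangent b h i p.2) y ∂surfaceMeasure (frontier Ω)) (𝓝[>] 0 ×ˢ 𝓝 0)
      (𝓝 (∫ y, tanKernel k Ω v 0 x (b (Fin.castSucc i)) y ∂surfaceMeasure (frontier Ω))) := by
  have hfin := hΩ.isFiniteMeasure
  obtain ⟨A, hA, hμ⟩ := hΩ.exists_surfaceMeasure_closedBall_le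
  obtain ⟨C, hC, ρ₁, hρ₁, hb⟩ := hΩ.exists_tanKernel_le (k := k) hx hv ha1 hvH
  set l : Filter (ℝ × Vec2) := 𝓝[>] 0 ×ˢ 𝓝 0
  have hδ : Tendsto (fun p : ℝ × Vec2 => p.1) l (𝓝 0) :=
    tendsto_fst.mono_right nhdsWithin_le_nhds
  have hu : Tendsto (fun p : ℝ × Vec2 => p.2) l (𝓝 0) := tendsto_snd
  have hξ : Tendsto (fun p : ℝ × Vec2 => graphMap x b h p.2) l (𝓝 x) := by
    have h1 := ((contDiff_graphMap x b hc.contDiff).continuous.tendsto 0).comp hu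
    rwa [hc.graphMap_zero] at h1
  have hΓ : ∀ᶠ p in l, graphMap x b h p.2 ∈ frontier Ω :=
    (hu.eventually (Metric.ball_mem_nhds _ hc.pos)).mono fun p hp => hc.graphMap_mem hp
  have hξΓ : Tendsto (fun p : ℝ × Vec2 => graphMap x b h p.2) l (𝓝[frontier Ω] x) :=
    tendsto_nhdsWithin_iff.2 ⟨hξ, hΓ⟩
  have hT : Tendsto (fun p : ℝ × Vec2 => graphTangent b h i p.2) l (𝓝 (b (Fin.castSucc i))) := by
    have h1 : Continuous (graphTangent b h i) :=
      continuous_const.add ((continuous_planeD hc.contDiff i).smul continuous_const)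
    have h2 := (h1.tendsto 0).comp hu
    rwa [hc.graphTangent_zero] at h2
  have hTn : ∀ᶠ p in l, ‖graphTangent b h i p.2‖ ≤ 2 := by
    have h1 := hT.norm
    rw [b.orthonormal.1] at h1
    exact (h1.eventually (gt_mem_nhds one_lt_two)).mono fun p hp => le_of_lt hp
  refine tendsto_integral_of_weaklySingular hA ha ha1 hμ (C := C * 2) (by positivity) hξ
    (Eventually.of_forall fun p => hΩ.aestronglyMeasurable_tanKernel hv _ _ _) ?_
    (hΩ.aestronglyMeasurable_tanKernel hv _ _ _) ?_ ?_
  · have hδ1 : ∀ᶠ p in l, |p.1| ≤ 1 := by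
      have h1 := hδ.abs
      rw [abs_zero] at h1
      exact (h1.eventually (gt_mem_nhds one_pos)).mono fun p hp => le_of_lt hp
    have hξ1 : ∀ᶠ p in l, ‖graphMap x b h p.2 - x‖ < ρ₁ :=
      (hξ.eventually (Metric.ball_mem_nhds x hρ₁)).mono fun p hp => by
        rwa [← mem_ball_iff_norm]
    filter_upwards [hδ1, hξ1, hΓ, hTn] with p h1 h2 h3 h4
    filter_upwards [IsSmoothBoundedDomain.ae_mem_frontier Ω, ae_ne_of_growth hμ (graphMap x b h p.2)] with y hy hne
    refine (hb _ h1 _ h3 h2 _ y hy hne).trans ?_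
    gcongr
  · filter_upwards [IsSmoothBoundedDomain.ae_mem_frontier Ω, ae_ne_of_growth hμ x] with y hy hne
    refine (hb 0 (by simp) x hx (by simpa using hρ₁) _ y hy hne).trans ?_
    rw [b.orthonormal.1]
    gcongr
    norm_num
  · filter_upwards [ae_ne_of_growth hμ x] with y hne
    exact hΩ.tendsto_tanKernel hx hv hne.symm hδ hξΓ hT

end

/-! ### Differentiability of the single-layer potential along the boundary -/

section

variable {Ω : Set Vec3} {x : Vec3} {k : ℂ} {v : Vec3 → ℂ}

/-- The regularised weakly singular integrals converge. -/
theorem IsSmoothBoundedDomain.tendsto_regSingleLayer (hΩ : IsSmoothBoundedDomain Ω)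
    (hv : ContinuousOn v (frontier Ω)) {ξ : Vec3} (hξ : ξ ∈ frontier Ω) :
    Tendsto (fun δ => regSingleLayer k Ω v δ ξ) (𝓝[>] 0) (𝓝 (regSingleLayer k Ω v 0 ξ)) := by
  have hfin := hΩ.isFiniteMeasure
  obtain ⟨A, hA, hμ⟩ := hΩ.exists_surfaceMeasure_closedBall_le
  obtain ⟨M, hM, hMb⟩ := hΩ.exists_norm_sub_le
  obtain ⟨Bv, hBv⟩ := hΩ.isCompact_frontier.exists_bound_of_continuousOn hv
  obtain ⟨Ck, hCk, hk⟩ := exists_profile_bounds k (M + 1)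
  have hBv0 : 0 ≤ Bv := (norm_nonneg _).trans (hBv ξ hξ)
  have hm : ∀ δ, AEStronglyMeasurable (fun y => kG k (regR δ (ξ - y)) * v y)
      (surfaceMeasure (frontier Ω)) := fun δ =>
    ((measurable_kG k).comp ((measurable_regR δ).comp
      (measurable_const.sub measurable_id))).aestronglyMeasurable.mul
      (aestronglyMeasurable_of_continuousOn hv)
  have hb : ∀ δ, |δ| ≤ 1 → ∀ᵐ y ∂surfaceMeasure (frontier Ω),
      ‖kG k (regR δ (ξ - y)) * v y‖ ≤ Ck * Bv * ‖y - ξ‖ ^ ((1 : ℝ) - 2) := fun δ hδ => by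
    filter_upwards [IsSmoothBoundedDomain.ae_mem_frontier Ω, ae_ne_of_growth hμ ξ] with y hy hne
    have hd0 : 0 < ‖ξ - y‖ := norm_pos_iff.2 (sub_ne_zero.2 hne.symm)
    have hR1 := norm_le_regR δ (ξ - y)
    have h1 := (hk _ (hd0.trans_le hR1)
      ((regR_le δ _).trans (add_le_add (hMb ξ hξ y hy) hδ))).1
    have h2 : Ck / regR δ (ξ - y) ≤ Ck / ‖ξ - y‖ := by gcongr
    rw [norm_mul, norm_sub_rev y ξ, show (1 : ℝ) - 2 = -1 by norm_num, Real.rpow_neg_one]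
    calc _ ≤ Ck / ‖ξ - y‖ * Bv := mul_le_mul (h1.trans h2) (hBv y hy) (norm_nonneg _)
          (by positivity)
      _ = _ := by ring
  have hδ : Tendsto (fun δ : ℝ => δ) (𝓝[>] 0) (𝓝 0) := nhdsWithin_le_nhds
  refine tendsto_integral_of_weaklySingular hA one_pos le_rfl hμ (C := Ck * Bv) (by positivity)
    (ξ := fun _ => ξ) tendsto_const_nhds (Eventually.of_forall hm) ?_ (hm 0) (hb 0 (by simp)) ?_
  · filter_upwards [Ioo_mem_nhdsGT one_pos] with δ h1
    exact hb δ (by rw [abs_of_pos h1.1]; exact h1.2.le)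
  · filter_upwards [ae_ne_of_growth hμ ξ] with y hne
    have h1 : Tendsto (fun δ => kG k (regR δ (ξ - y))) (𝓝[>] 0) (𝓝 (kG k (regR 0 (ξ - y)))) :=
      (continuousAt_kG k (regR_pos 0 (sub_ne_zero.2 hne.symm)).ne').tendsto.comp
        (tendsto_regR hδ tendsto_const_nhds)
    exact h1.mul_const _

/-- Mean value inequality in the chart, for the potential minus a linear map. The constant on the
right does not involve `δ`; the factor `2` counts the coordinates of the plane. -/
theorem IsGraphChart.norm_fderiv_regSingleLayer_sub_le (hΩ : IsSmoothBoundedDomain Ω)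
    {b : OrthonormalBasis (Fin 3) ℝ Vec3} {h : Vec2 → ℝ} {V : Set Vec3}
    {ρ : ℝ} (hc : IsGraphChart Ω x b h V ρ) (hv : ContinuousOn v (frontier Ω)) {δ η ε : ℝ}
    (hδ : δ ≠ 0) (hηρ : η ≤ ρ) {L : Fin 2 → ℂ}
    (hL : ∀ u ∈ Metric.ball (0 : Vec2) η, ∀ i,
      ‖(∫ y, tanKernel k Ω v δ (graphMap x b h u) (graphTangent b h i u) y
        ∂surfaceMeasure (frontier Ω)) - L i‖ ≤ ε) {u : Vec2} (hu : u ∈ Metric.ball (0 : Vec2) η) :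
    ‖regSingleLayer k Ω v δ (graphMap x b h u) - regSingleLayer k Ω v δ x
      - ∑ i, (u i : ℂ) * L i‖ ≤ 2 * ε * ‖u‖ := by
  set l : Vec2 →L[ℝ] ℂ := ∑ i, (EuclideanSpace.proj (𝕜 := ℝ) i).smulRight (L i) with hl
  have hl' : ∀ w, l w = ∑ i, (w i : ℂ) * L i := fun w => by
    simp [hl]
  choose D hD hDt using fun ξ => hΩ.hasFDerivAt_regSingleLayer (k := k) hv hδ ξ
  have hφ : ∀ u, HasFDerivAt (graphMap x b h) (fderiv ℝ (graphMap x b h) u) u := fun u =>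
    (((contDiff_graphMap x b hc.contDiff).differentiable (by simp)) u).hasFDerivAt
  have hder : ∀ u, HasFDerivAt (fun u => regSingleLayer k Ω v δ (graphMap x b h u) - l u)
      ((D (graphMap x b h u)).comp (fderiv ℝ (graphMap x b h) u) - l) u := fun u =>
    ((hD _).comp u (hφ u)).sub l.hasFDerivAt
  have hε : 0 ≤ ε := (norm_nonneg _).trans (hL u hu 0)
  have hbound : ∀ w ∈ Metric.ball (0 : Vec2) η,
      ‖(D (graphMap x b h w)).comp (fderiv ℝ (graphMap x b h) w) - l‖ ≤ 2 * ε := fun w hw => by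
    refine ContinuousLinearMap.opNorm_le_bound _ (by positivity) fun t => ?_
    have hwρ := Metric.ball_subset_ball hηρ hw
    have e : ((D (graphMap x b h w)).comp (fderiv ℝ (graphMap x b h) w) - l) t
        = ∑ i, (t i : ℂ) * ((∫ y, tanKernel k Ω v δ (graphMap x b h w) (graphTangent b h i w) y
          ∂surfaceMeasure (frontier Ω)) - L i) := by
      rw [sub_apply, ContinuousLinearMap.comp_apply, hc.fderiv_graphMap_apply,
        map_sum, hl', ← Finset.sum_sub_distrib]
      refine Finset.sum_congr rfl fun i _ => ?_
      rw [map_smul, hDt, hΩ.regSingleLayerDeriv_eq hv hδ (hc.graphMap_mem hwρ)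
        (hc.inner_normal_graphTangent hwρ i), Complex.real_smul, mul_sub]
    rw [e]
    refine (norm_sum_le _ _).trans ?_
    have h1 : ∀ i, ‖(t i : ℂ) * ((∫ y, tanKernel k Ω v δ (graphMap x b h w)
        (graphTangent b h i w) y ∂surfaceMeasure (frontier Ω)) - L i)‖ ≤ ‖t‖ * ε := fun i => by
      rw [norm_mul, Complex.norm_real]
      exact mul_le_mul (PiLp.norm_apply_le t i) (hL w hw i) (norm_nonneg _) (norm_nonneg _)
    refine (Finset.sum_le_sum fun i _ => h1 i).trans_eq ?_
    simp
    ring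
  have h0 : (0 : Vec2) ∈ Metric.ball (0 : Vec2) η :=
    Metric.mem_ball_self ((Metric.pos_of_mem_ball hu))
  have hmv := (convex_ball (0 : Vec2) η).norm_image_sub_le_of_norm_hasFDerivWithin_le
    (fun w _ => (hder w).hasFDerivWithinAt) hbound h0 hu
  rw [hc.graphMap_zero, map_zero, sub_zero, sub_zero, hl'] at hmv
  rwa [sub_right_comm]

/-- The single-layer potential of a Hölder continuous density is differentiable along the surface,
and its tangential derivatives are limits of those of the regularised potentials. -/
theorem IsSmoothBoundedDomain.differentiableWithinAt_singleLayer (hΩ : IsSmoothBoundedDomain Ω)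
    (hx : x ∈ frontier Ω) (hv : ContinuousOn v (frontier Ω)) {a : ℝ} (ha : 0 < a) (ha1 : a ≤ 1)
    (hvH : IsHolderNear Ω v x a) :
    DifferentiableWithinAt ℝ (regSingleLayer k Ω v 0) (frontier Ω) x ∧
    ∀ t, inner ℝ (outwardNormal Ω x) t = 0 →
      Tendsto (fun δ => regSingleLayerDeriv k Ω v δ x t) (𝓝[>] 0)
        (𝓝 (fderivWithin ℝ (regSingleLayer k Ω v 0) (frontier Ω) x t)) := by
  obtain ⟨b, h, V, ρ, hc⟩ := hΩ.exists_isGraphChart hx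
  set L : Fin 2 → ℂ := fun i =>
    ∫ y, tanKernel k Ω v 0 x (b (Fin.castSucc i)) y ∂surfaceMeasure (frontier Ω) with hLdef
  have hlim : ∀ i, Tendsto (fun p : ℝ × Vec2 => ∫ y, tanKernel k Ω v p.1 (graphMap x b h p.2)
        (graphTangent b h i p.2) y ∂surfaceMeasure (frontier Ω)) (𝓝[>] 0 ×ˢ 𝓝 0)
      (𝓝 (L i)) := hc.tendsto_integral_tanKernel hΩ hx hv ha ha1 hvH
  set l : Vec2 →L[ℝ] ℂ := ∑ i, (EuclideanSpace.proj (𝕜 := ℝ) i).smulRight (L i) with hl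
  have hl' : ∀ w, l w = ∑ i, (w i : ℂ) * L i := fun w => by
    simp [hl]
  have hder : HasFDerivAt (fun u => regSingleLayer k Ω v 0 (graphMap x b h u)) l 0 := by
    rw [hasFDerivAt_iff_isLittleO, Asymptotics.isLittleO_iff]
    intro ε hε
    have hev : ∀ᶠ p : ℝ × Vec2 in 𝓝[>] 0 ×ˢ 𝓝 0, ∀ i,
        ‖(∫ y, tanKernel k Ω v p.1 (graphMap x b h p.2) (graphTangent b h i p.2) y
          ∂surfaceMeasure (frontier Ω)) - L i‖ ≤ ε / 2 := by
      rw [eventually_all]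
      intro i
      refine ((hlim i).eventually (Metric.ball_mem_nhds (L i) (half_pos hε))).mono fun p hp => ?_
      rw [← dist_eq_norm]
      exact (Metric.mem_ball.1 hp).le
    obtain ⟨t₁, ht₁, t₂, ht₂, hsub⟩ := mem_prod_iff.1 hev
    obtain ⟨η, hη, hball⟩ := Metric.mem_nhds_iff.1 ht₂
    filter_upwards [Metric.ball_mem_nhds (0 : Vec2) (lt_min hη hc.pos)] with u hu
    have huρ := Metric.ball_subset_ball (min_le_right η ρ) hu
    rw [sub_zero, hc.graphMap_zero, hl']
    have h1 := ((hΩ.tendsto_regSingleLayer (k := k) hv (hc.graphMap_mem huρ)).sub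
      (hΩ.tendsto_regSingleLayer (k := k) hv hx)).sub_const (∑ i, (u i : ℂ) * L i)
    -- For fixed `u` the linear approximation estimate holds for all small `δ > 0` with the same
    -- constant, and passes to the unregularised potential.
    refine le_of_tendsto h1.norm ?_
    filter_upwards [ht₁, self_mem_nhdsWithin] with δ hδ hδ0
    refine (hc.norm_fderiv_regSingleLayer_sub_le hΩ hv (ne_of_gt hδ0) (min_le_right η ρ)
      (fun w hw i => hsub (mk_mem_prod hδ (hball (Metric.ball_subset_ball (min_le_left _ _) hw))) i)
      hu).trans_eq ?_
    ring
  have hdiff := hc.hasFDerivWithinAt hder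
  refine ⟨hdiff, fun t ht => ?_⟩
  rw [hc.fderivWithin_apply hdiff.hasFDerivWithinAt hder ht, hl']
  have h1 : Tendsto (fun δ => ∑ i : Fin 2, ((planeProj b t i : ℝ) : ℂ)
      * regSingleLayerDeriv k Ω v δ x (b (Fin.castSucc i))) (𝓝[>] 0)
      (𝓝 (∑ i, ((planeProj b t i : ℝ) : ℂ) * L i)) := by
    refine tendsto_finsetSum _ fun i _ => Tendsto.const_mul _ ?_
    have hpair : Tendsto (fun δ : ℝ => (δ, (0 : Vec2))) (𝓝[>] 0) (𝓝[>] 0 ×ˢ 𝓝 0) :=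
      tendsto_id.prodMk tendsto_const_nhds
    have h2 := (hlim i).comp hpair
    refine h2.congr' ?_
    filter_upwards [self_mem_nhdsWithin] with δ hδ
    have h3 := hc.inner_normal_graphTangent (Metric.mem_ball_self hc.pos) i
    rw [hc.graphMap_zero, hc.graphTangent_zero] at h3
    simp only [Function.comp]
    rw [hc.graphMap_zero, hc.graphTangent_zero,
      hΩ.regSingleLayerDeriv_eq hv (ne_of_gt hδ) hx h3]
  refine h1.congr' ?_
  filter_upwards [self_mem_nhdsWithin] with δ hδ
  obtain ⟨D, -, hD⟩ := hΩ.hasFDerivAt_regSingleLayer (k := k) hv (ne_of_gt hδ) x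
  rw [← hD t]
  conv_rhs => rw [hc.tangent_eq_sum ht]
  rw [map_sum]
  refine Finset.sum_congr rfl fun i _ => ?_
  rw [map_smul, hD, Complex.real_smul]
  fin_cases i <;> rfl

end

section

/-! ### Densities of class `C^{1,a}` -/

variable {Ω : Set Vec3} {x : Vec3} {p F : Vec3 → ℂ}

/-- The exponent is lowered to `min a 1`, which costs a power of the diameter bound `M`; later
estimates absorb quadratic errors and need an exponent of at most one. -/
theorem IsC1Holder.exists_extension {a : ℝ≥0} (ha : 0 < a) {Γ : Set Vec3}
    (hp : IsC1Holder a Γ p) {M : ℝ} (hM : 0 < M) :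
    ∃ F : Vec3 → ℂ, ContDiff ℝ 1 F ∧ EqOn p F Γ ∧ ∃ a' C : ℝ, 0 < a' ∧ a' ≤ 1 ∧ 0 ≤ C ∧
      ∀ y w, ‖y - w‖ ≤ M → ‖fderiv ℝ F y - fderiv ℝ F w‖ ≤ C * ‖y - w‖ ^ a' := by
  obtain ⟨F, hF, ⟨C, hC⟩, hpF⟩ := hp
  set m : ℝ := min (a : ℝ) 1
  have ha' : 0 < m := lt_min (by exact_mod_cast ha) one_pos
  refine ⟨F, hF, hpF, m, C * M ^ ((a : ℝ) - m), ha', min_le_right _ _,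
    by positivity, fun y w hyw => ?_⟩
  have h1 := hC.dist_le y w
  rw [dist_eq_norm, dist_eq_norm] at h1
  refine h1.trans ?_
  rw [mul_assoc]
  gcongr
  have h0 : 0 ≤ (a : ℝ) - m := sub_nonneg.2 (min_le_left _ _)
  have h2 : ‖y - w‖ ^ (a : ℝ) = ‖y - w‖ ^ ((a : ℝ) - m) * ‖y - w‖ ^ m := by
    rw [← Real.rpow_add_of_nonneg (norm_nonneg _) h0 ha'.le, sub_add_cancel]
  rw [h2]
  gcongr

/-- Mean value inequality for `F` minus its linearisation, on the ball of radius `‖y - x‖` about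
`x`. -/
theorem norm_taylor_le (hF : ContDiff ℝ 1 F) {M C a : ℝ} (ha : 0 < a) (hC : 0 ≤ C)
    (hH : ∀ y w, ‖y - w‖ ≤ M → ‖fderiv ℝ F y - fderiv ℝ F w‖ ≤ C * ‖y - w‖ ^ a) {y : Vec3}
    (hy : ‖y - x‖ ≤ M) :
    ‖F y - (F x + fderiv ℝ F x (y - x))‖ ≤ C * ‖y - x‖ ^ (1 + a) := by
  have hd : ∀ w, HasFDerivAt F (fderiv ℝ F w) w := fun w =>
    ((hF.differentiable (by simp)) w).hasFDerivAt
  have h1 := (convex_closedBall x ‖y - x‖).norm_image_sub_le_of_norm_hasFDerivWithin_le'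
    (f := F) (f' := fderiv ℝ F) (φ := fderiv ℝ F x) (C := C * ‖y - x‖ ^ a)
    (fun w _ => (hd w).hasFDerivWithinAt) (fun w hw => by
      rw [mem_closedBall_iff_norm] at hw
      exact (hH w x (hw.trans hy)).trans (by gcongr))
    (Metric.mem_closedBall_self (norm_nonneg _)) (mem_closedBall_iff_norm.2 le_rfl)
  rw [sub_sub] at h1
  refine h1.trans_eq ?_
  rcases eq_or_ne (y - x) 0 with h0 | h0
  · rw [h0, norm_zero, Real.zero_rpow (by linarith : 1 + a ≠ 0)]
    simp
  · rw [Real.rpow_add (norm_pos_iff.2 h0), Real.rpow_one]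
    ring

theorem IsHolderNear.mul {v w : Vec3 → ℂ} {a : ℝ} (hΩ : IsSmoothBoundedDomain Ω)
    (hv : IsHolderNear Ω v x a) (hw : IsHolderNear Ω w x a)
    (hvc : ContinuousOn v (frontier Ω)) (hwc : ContinuousOn w (frontier Ω))
    (hx : x ∈ frontier Ω) : IsHolderNear Ω (fun y => v y * w y) x a := by
  obtain ⟨C₁, hC₁, ρ₁, hρ₁, h₁⟩ := hv
  obtain ⟨C₂, hC₂, ρ₂, hρ₂, h₂⟩ := hw
  obtain ⟨B₁, hB₁⟩ := hΩ.isCompact_frontier.exists_bound_of_continuousOn hvc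
  obtain ⟨B₂, hB₂⟩ := hΩ.isCompact_frontier.exists_bound_of_continuousOn hwc
  have hB₁0 : 0 ≤ B₁ := (norm_nonneg _).trans (hB₁ x hx)
  have hB₂0 : 0 ≤ B₂ := (norm_nonneg _).trans (hB₂ x hx)
  refine ⟨B₁ * C₂ + C₁ * B₂, by positivity, min ρ₁ ρ₂, lt_min hρ₁ hρ₂, fun ξ hξ hξx y hy => ?_⟩
  have e : v y * w y - v ξ * w ξ = v y * (w y - w ξ) + (v y - v ξ) * w ξ := by ring
  rw [e]
  refine (norm_add_le _ _).trans ?_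
  rw [norm_mul, norm_mul, add_mul]
  have k₁ := h₁ ξ hξ (hξx.trans_le (min_le_left _ _)) y hy
  have k₂ := h₂ ξ hξ (hξx.trans_le (min_le_right _ _)) y hy
  refine add_le_add ?_ ?_
  · calc _ ≤ B₁ * (C₂ * ‖ξ - y‖ ^ a) := mul_le_mul (hB₁ y hy) k₂ (norm_nonneg _) hB₁0
      _ = _ := by ring
  · calc _ ≤ C₁ * ‖ξ - y‖ ^ a * B₂ := mul_le_mul k₁ (hB₂ ξ hξ) (norm_nonneg _) (by positivity)
      _ = _ := by ring

theorem IsHolderNear.sub {v w : Vec3 → ℂ} {a : ℝ} (hv : IsHolderNear Ω v x a)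
    (hw : IsHolderNear Ω w x a) : IsHolderNear Ω (fun y => v y - w y) x a := by
  obtain ⟨C₁, hC₁, ρ₁, hρ₁, h₁⟩ := hv
  obtain ⟨C₂, hC₂, ρ₂, hρ₂, h₂⟩ := hw
  refine ⟨C₁ + C₂, by positivity, min ρ₁ ρ₂, lt_min hρ₁ hρ₂, fun ξ hξ hξx y hy => ?_⟩
  have k₁ := h₁ ξ hξ (hξx.trans_le (min_le_left _ _)) y hy
  have k₂ := h₂ ξ hξ (hξx.trans_le (min_le_right _ _)) y hy
  rw [sub_sub_sub_comm, add_mul]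
  exact (norm_sub_le _ _).trans (add_le_add k₁ k₂)

theorem IsHolderNear.congr {v w : Vec3 → ℂ} {a : ℝ} (hv : IsHolderNear Ω v x a)
    (h : EqOn w v (frontier Ω)) : IsHolderNear Ω w x a := by
  obtain ⟨C₁, hC₁, ρ₁, hρ₁, h₁⟩ := hv
  refine ⟨C₁, hC₁, ρ₁, hρ₁, fun ξ hξ hξx y hy => ?_⟩
  rw [h hξ, h hy]
  exact h₁ ξ hξ hξx y hy

namespace IsSmoothBoundedDomain

theorem continuousOn_normal_apply (hΩ : IsSmoothBoundedDomain Ω) (j : Fin 3) :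
    ContinuousOn (fun y => (outwardNormal Ω y j : ℂ)) (frontier Ω) :=
  Complex.continuous_ofReal.comp_continuousOn
    ((EuclideanSpace.proj (𝕜 := ℝ) j).continuous.comp_continuousOn hΩ.continuousOn_outwardNormal)

theorem isHolderNear_normal_apply (hΩ : IsSmoothBoundedDomain Ω) (hx : x ∈ frontier Ω) {a : ℝ}
    (ha : 0 < a) (ha1 : a ≤ 1) (j : Fin 3) :
    IsHolderNear Ω (fun y => (outwardNormal Ω y j : ℂ)) x a := by
  obtain ⟨C, hC, ρ, hρ, h⟩ := hΩ.exists_normal_lipschitz hx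
  obtain ⟨M, hM, hMb⟩ := hΩ.exists_norm_sub_le
  refine ⟨C * M ^ (1 - a), by positivity, ρ, hρ, fun ξ hξ hξx y hy => ?_⟩
  have h1 : ‖((outwardNormal Ω y j : ℝ) : ℂ) - (outwardNormal Ω ξ j : ℝ)‖
      ≤ ‖outwardNormal Ω ξ - outwardNormal Ω y‖ := by
    rw [← Complex.ofReal_sub, Complex.norm_real, norm_sub_rev (outwardNormal Ω ξ)]
    exact PiLp.norm_apply_le (outwardNormal Ω y - outwardNormal Ω ξ) j
  refine (h1.trans (h ξ hξ hξx y hy)).trans ?_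
  have h2 : ‖ξ - y‖ = ‖ξ - y‖ ^ (1 - a) * ‖ξ - y‖ ^ a := by
    rw [← Real.rpow_add_of_nonneg (norm_nonneg _) (sub_nonneg.2 ha1) ha.le, sub_add_cancel,
      Real.rpow_one]
  rw [mul_assoc]
  refine mul_le_mul_of_nonneg_left ?_ hC
  calc ‖ξ - y‖ = ‖ξ - y‖ ^ (1 - a) * ‖ξ - y‖ ^ a := h2
    _ ≤ _ := by
      have := hMb ξ hξ y hy
      gcongr

theorem isHolderNear_partialD {M C a : ℝ} (hC : 0 ≤ C)
    (hM : ∀ ξ ∈ frontier Ω, ∀ y ∈ frontier Ω, ‖ξ - y‖ ≤ M)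
    (hH : ∀ y w, ‖y - w‖ ≤ M → ‖fderiv ℝ F y - fderiv ℝ F w‖ ≤ C * ‖y - w‖ ^ a) (j : Fin 3) :
    IsHolderNear Ω (partialD j F) x a := by
  refine ⟨C, hC, 1, one_pos, fun ξ hξ _ y hy => ?_⟩
  have h1 := (fderiv ℝ F y - fderiv ℝ F ξ).le_opNorm (EuclideanSpace.single j 1)
  rw [PiLp.norm_single, norm_one, mul_one, norm_sub_rev ξ y] at *
  exact h1.trans (hH y ξ (hM y hy ξ hξ))

theorem hasFDerivWithinAt_of_eqOn (hF : ContDiff ℝ 1 F)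
    (hpF : EqOn p F (frontier Ω)) {y : Vec3} (hy : y ∈ frontier Ω) :
    HasFDerivWithinAt p (fderiv ℝ F y) (frontier Ω) y :=
  ((hF.differentiable (by simp)) y).hasFDerivAt.hasFDerivWithinAt.congr hpF (hpF hy)

theorem inner_normal_tangent (hΩ : IsSmoothBoundedDomain Ω) {y : Vec3} (hy : y ∈ frontier Ω)
    (i : Fin 3) : inner ℝ (outwardNormal Ω y)
      (EuclideanSpace.single i 1 - outwardNormal Ω y i • outwardNormal Ω y) = 0 := by
  rw [inner_sub_right, inner_smul_right, real_inner_self_eq_norm_sq, hΩ.norm_outwardNormal hy,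
    inner_eq_sum]
  simp

/-- The normal part of the gradient drops out because `ν × ν = 0`, so the full gradient of any
extension may be used. -/
theorem tau1_eq (hΩ : IsSmoothBoundedDomain Ω) (hF : ContDiff ℝ 1 F)
    (hpF : EqOn p F (frontier Ω)) {y : Vec3} (hy : y ∈ frontier Ω) :
    tau1 Ω p y = cvec (outwardNormal Ω y) ⨯₃ grad F y := by
  have h1 : surfaceGrad Ω p y
      = fun i => grad F y i - (outwardNormal Ω y i : ℂ) * dirDeriv (outwardNormal Ω y) F y := by
    ext i
    rw [surfaceGrad, hΩ.fderivWithin_eq hy (hasFDerivWithinAt_of_eqOn hF hpF hy)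
      (hΩ.inner_normal_tangent hy i), map_sub, map_smul, Complex.real_smul]
    rfl
  rw [tau1, h1]
  ext i
  fin_cases i <;> simp [cross_apply, cvec] <;> ring

theorem continuousOn_tau1 (hΩ : IsSmoothBoundedDomain Ω) (hF : ContDiff ℝ 1 F)
    (hpF : EqOn p F (frontier Ω)) (i : Fin 3) :
    ContinuousOn (fun y => tau1 Ω p y i) (frontier Ω) := by
  have hn := hΩ.continuousOn_normal_apply
  have hg := fun j => (continuous_partialD hF j).continuousOn (s := frontier Ω)
  refine ContinuousOn.congr (f := fun y => (cvec (outwardNormal Ω y) ⨯₃ grad F y) i) ?_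
    fun y hy => by rw [hΩ.tau1_eq hF hpF hy]
  fin_cases i
  · exact ((hn 1).mul (hg 2)).sub ((hn 2).mul (hg 1))
  · exact ((hn 2).mul (hg 0)).sub ((hn 0).mul (hg 2))
  · exact ((hn 0).mul (hg 1)).sub ((hn 1).mul (hg 0))

theorem isHolderNear_tau1 (hΩ : IsSmoothBoundedDomain Ω) (hx : x ∈ frontier Ω)
    (hF : ContDiff ℝ 1 F) (hpF : EqOn p F (frontier Ω)) {M C a : ℝ} (ha : 0 < a) (ha1 : a ≤ 1)
    (hC : 0 ≤ C) (hM : ∀ ξ ∈ frontier Ω, ∀ y ∈ frontier Ω, ‖ξ - y‖ ≤ M)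
    (hH : ∀ y w, ‖y - w‖ ≤ M → ‖fderiv ℝ F y - fderiv ℝ F w‖ ≤ C * ‖y - w‖ ^ a) (i : Fin 3) :
    IsHolderNear Ω (fun y => tau1 Ω p y i) x a := by
  have hn := hΩ.isHolderNear_normal_apply hx ha ha1
  have hg := fun j => isHolderNear_partialD (x := x) hC hM hH j
  have hm := fun j k => (hn j).mul hΩ (hg k) (hΩ.continuousOn_normal_apply j)
    (continuous_partialD hF k).continuousOn hx
  refine IsHolderNear.congr (v := fun y => (cvec (outwardNormal Ω y) ⨯₃ grad F y) i) ?_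
    fun y hy => by simp only; rw [hΩ.tau1_eq hF hpF hy]
  fin_cases i
  · exact (hm 1 2).sub (hm 2 1)
  · exact (hm 2 0).sub (hm 0 2)
  · exact (hm 0 1).sub (hm 1 0)

end IsSmoothBoundedDomain

end

section

/-! ### Integration by parts for the regularised hyper-singular kernel -/

variable {Ω : Set Vec3} {x : Vec3} {k : ℂ} {p F : Vec3 → ℂ}

theorem hasFDerivAt_kA_regR_const_sub (k : ℂ) {δ : ℝ} (hδ : δ ≠ 0) (x y : Vec3) :
    HasFDerivAt (fun y => kA k (regR δ (x - y)))
      (-(kB k (regR δ (x - y)) • (Complex.ofRealCLM.comp (innerSL ℝ (x - y))))) y := by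
  have h1 := hasFDerivAt_kA_regR k (regR_pos_of_ne hδ (x - y))
  have h2 : HasFDerivAt (fun y : Vec3 => x - y) (-ContinuousLinearMap.id ℝ Vec3) y :=
    (hasFDerivAt_id y).const_sub x
  refine (h1.comp y h2).congr_fderiv ?_
  ext t
  simp [-map_sub]
  ring

theorem contDiff_kA_regR_const_sub (k : ℂ) {δ : ℝ} (hδ : δ ≠ 0) (x : Vec3) :
    ContDiff ℝ 1 fun y => kA k (regR δ (x - y)) := by
  have h1 : ContDiff ℝ 1 fun z => kA k (regR δ z) := contDiff_kA_regR k hδ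
  have h2 : ContDiff ℝ 1 fun y : Vec3 => x - y := contDiff_const.sub contDiff_id
  exact h1.comp h2

/-- The field `F ∇Θ`, where `Θ` is the regularised kernel. -/
def regField (k : ℂ) (F : Vec3 → ℂ) (δ : ℝ) (x : Vec3) (j : Fin 3) (y : Vec3) : ℂ :=
  F y * kA k (regR δ (x - y)) * ((x j - y j : ℝ) : ℂ)

theorem contDiff_regField (hF : ContDiff ℝ 1 F) {δ : ℝ} (hδ : δ ≠ 0) (j : Fin 3) :
    ContDiff ℝ 1 (regField k F δ x j) := by
  have h1 : ContDiff ℝ 1 fun y : Vec3 => x j - y j := by fun_prop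
  have h2 : ContDiff ℝ 1 fun y : Vec3 => ((x j - y j : ℝ) : ℂ) :=
    Complex.ofRealCLM.contDiff.comp h1
  exact (hF.mul (contDiff_kA_regR_const_sub k hδ x)).mul h2

theorem dirDeriv_regField (hF : ContDiff ℝ 1 F) {δ : ℝ} (hδ : δ ≠ 0) (j : Fin 3) (c y : Vec3) :
    dirDeriv c (regField k F δ x j) y
      = dirDeriv c F y * kA k (regR δ (x - y)) * ((x j - y j : ℝ) : ℂ)
        - F y * (kB k (regR δ (x - y)) * (inner ℝ (x - y) c : ℝ) * ((x j - y j : ℝ) : ℂ)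
          + kA k (regR δ (x - y)) * (c j : ℂ)) := by
  have h0 : HasFDerivAt F (fderiv ℝ F y) y := ((hF.differentiable (by simp)) y).hasFDerivAt
  have h1 : HasFDerivAt (fun y : Vec3 => ((x j - y j : ℝ) : ℂ))
      (-(Complex.ofRealCLM.comp (EuclideanSpace.proj (𝕜 := ℝ) j))) y := by
    have h2 : HasFDerivAt (fun y : Vec3 => x j - y j)
        (-(EuclideanSpace.proj (𝕜 := ℝ) j : Vec3 →L[ℝ] ℝ)) y :=
      ((EuclideanSpace.proj (𝕜 := ℝ) j : Vec3 →L[ℝ] ℝ).hasFDerivAt).const_sub (x j)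
    refine (Complex.ofRealCLM.hasFDerivAt.comp y h2).congr_fderiv ?_
    ext t
    simp
  have h3 : HasFDerivAt (regField k F δ x j) _ y :=
    (h0.mul (hasFDerivAt_kA_regR_const_sub k hδ x y)).mul h1
  rw [dirDeriv, h3.fderiv]
  simp [-map_sub, dirDeriv]
  ring

/-- Stokes' theorem for the component `j` of the field, with the vectors `a` and `eⱼ`, summed over
`j`. The divergence of the field produces `3 kA + kB |x - y|²`, which the Helmholtz equation
simplifies; the terms with derivatives of `F` are collected on the left. -/
theorem IsSmoothBoundedDomain.integral_regField (hΩ : IsSmoothBoundedDomain Ω)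
    (hF : ContDiff ℝ 1 F) {δ : ℝ} (hδ : δ ≠ 0) (a : Vec3) :
    ∫ y, kA k (regR δ (x - y)) * (((inner ℝ (outwardNormal Ω y) a : ℝ) : ℂ) * dirDeriv (x - y) F y
        - ((inner ℝ (outwardNormal Ω y) (x - y) : ℝ) : ℂ) * dirDeriv a F y)
        ∂surfaceMeasure (frontier Ω)
      = ∫ y, F y * (((inner ℝ (outwardNormal Ω y) a : ℝ) : ℂ)
          * (3 * kA k (regR δ (x - y)) + kB k (regR δ (x - y)) * ((‖x - y‖ ^ 2 : ℝ) : ℂ))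
        - kB k (regR δ (x - y)) * (inner ℝ (x - y) a : ℝ)
          * ((inner ℝ (x - y) (outwardNormal Ω y) : ℝ) : ℂ)
        - kA k (regR δ (x - y)) * ((inner ℝ (outwardNormal Ω y) a : ℝ) : ℂ))
        ∂surfaceMeasure (frontier Ω) := by
  have hS := fun j => hΩ.integral_normal_wedge_dirDeriv (contDiff_regField (k := k) (x := x) hF hδ j)
    a (EuclideanSpace.single j 1)
  have h0 := integral_finsetSum (μ := surfaceMeasure (frontier Ω)) Finset.univ
    fun j _ => (hS j).1
  rw [Finset.sum_eq_zero fun j _ => (hS j).2] at h0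
  have hcA := (contDiff_kA_regR_const_sub k hδ x).continuous.continuousOn (s := frontier Ω)
  have hnc : ∀ c : Vec3, ContinuousOn (fun y => ((inner ℝ (outwardNormal Ω y) c : ℝ) : ℂ))
      (frontier Ω) := fun c => Complex.continuous_ofReal.comp_continuousOn
    (hΩ.continuousOn_outwardNormal.inner continuousOn_const)
  have hz : Continuous fun y : Vec3 => x - y := by fun_prop
  have hnz : ContinuousOn (fun y => ((inner ℝ (outwardNormal Ω y) (x - y) : ℝ) : ℂ))
      (frontier Ω) := Complex.continuous_ofReal.comp_continuousOn
    (hΩ.continuousOn_outwardNormal.inner hz.continuousOn)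
  have hDz : Continuous fun y => dirDeriv (x - y) F y :=
    (hF.continuous_fderiv (by simp)).clm_apply hz
  have hDa : Continuous fun y => dirDeriv a F y :=
    (hF.continuous_fderiv (by simp)).clm_apply continuous_const
  have i1 : Integrable (fun y => kA k (regR δ (x - y)) * (((inner ℝ (outwardNormal Ω y) a : ℝ) : ℂ)
      * dirDeriv (x - y) F y - ((inner ℝ (outwardNormal Ω y) (x - y) : ℝ) : ℂ) * dirDeriv a F y))
      (surfaceMeasure (frontier Ω)) := hΩ.integrable_of_continuousOn (hcA.mul (((hnc a).mul hDz.continuousOn).sub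
    (hnz.mul hDa.continuousOn)))
  have i2 := integrable_finsetSum Finset.univ fun j _ => (hS j).1
  rw [← sub_zero (∫ y, kA k (regR δ (x - y)) * _ ∂_), ← h0, ← integral_sub i1 i2]
  refine integral_congr_ae (ae_of_all _ fun y => ?_)
  have hn2 : ‖x - y‖ ^ 2 = inner ℝ (x - y) (x - y) := (real_inner_self_eq_norm_sq _).symm
  simp only [dirDeriv_regField hF hδ, dirDeriv_eq_sum F a, dirDeriv_eq_sum F (x - y), hn2,
    inner_eq_sum, Fin.sum_univ_three]
  simp [partialD]
  ring

end

/-! ### The composition `τ₂ S τ₁` as a limit -/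

section

variable {Ω : Set Vec3} {x : Vec3} {k : ℂ} {p F : Vec3 → ℂ}

/-- The single-layer potential of `τ₁ p`. -/
def tauLayer (k : ℂ) (Ω : Set Vec3) (p : Vec3 → ℂ) (ξ : Vec3) (i : Fin 3) : ℂ :=
  regSingleLayer k Ω (fun y => tau1 Ω p y i) 0 ξ

/-- The matrix is that of the cross product with `ν(x)`. In this form `τ₂` is a fixed combination of
tangential derivatives, through which limits pass. -/
theorem tau2_eq_sum (w : Vec3 → Fin 3 → ℂ) : tau2 Ω w x = ∑ i, ∑ l,
    (!![0, -outwardNormal Ω x 2, outwardNormal Ω x 1; outwardNormal Ω x 2, 0, -outwardNormal Ω x 0;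
      -outwardNormal Ω x 1, outwardNormal Ω x 0, 0] i l : ℂ)
      * surfaceGrad Ω (fun y => w y i) x l := by
  simp [tau2, tau1, cross_apply, Fin.sum_univ_three, cvec]
  ring

namespace IsSmoothBoundedDomain

/-- `τ₂ S τ₁ p` as a limit of regularised integrals. -/
theorem tendsto_tau2_tauLayer (hΩ : IsSmoothBoundedDomain Ω) (hx : x ∈ frontier Ω)
    (hF : ContDiff ℝ 1 F) (hpF : EqOn p F (frontier Ω)) {a : ℝ} (ha : 0 < a) (ha1 : a ≤ 1)
    (hH : ∀ i, IsHolderNear Ω (fun y => tau1 Ω p y i) x a) :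
    Tendsto (fun δ => ∫ y, kA k (regR δ (x - y))
        * (((inner ℝ (outwardNormal Ω y) (outwardNormal Ω x) : ℝ) : ℂ) * dirDeriv (x - y) F y
        - ((inner ℝ (outwardNormal Ω y) (x - y) : ℝ) : ℂ) * dirDeriv (outwardNormal Ω x) F y)
        ∂surfaceMeasure (frontier Ω)) (𝓝[>] 0)
      (𝓝 (tau2 Ω (tauLayer k Ω p) x)) := by
  have hlim := fun i l => (hΩ.differentiableWithinAt_singleLayer (k := k) hx
    (hΩ.continuousOn_tau1 hF hpF i) ha ha1 (hH i)).2 _ (hΩ.inner_normal_tangent hx l)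
  rw [tau2_eq_sum]
  refine (tendsto_finsetSum Finset.univ fun i _ => tendsto_finsetSum Finset.univ fun l _ =>
    (hlim i l).const_mul _).congr' ?_
  filter_upwards [self_mem_nhdsWithin] with δ hδ
  have hδ0 : δ ≠ 0 := ne_of_gt hδ
  have hcA := continuous_kA_regR_const_sub k hδ0 x
  have hi : ∀ (i l : Fin 3) (c : ℂ), Integrable (fun y => c * (tau1 Ω p y i * (kA k (regR δ (x - y))
      * (inner ℝ (x - y) (EuclideanSpace.single l 1 - outwardNormal Ω x l • outwardNormal Ω x) : ℝ))))
      (surfaceMeasure (frontier Ω)) := fun i l c => by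
    refine (hΩ.integrable_of_continuousOn ((hΩ.continuousOn_tau1 hF hpF i).mul
      (Continuous.continuousOn (hcA.mul ?_)))).const_mul c
    exact Complex.continuous_ofReal.comp ((continuous_const.sub continuous_id).inner continuous_const)
  simp only [regSingleLayerDeriv, ← integral_const_mul]
  rw [Finset.sum_congr rfl fun i _ => (integral_finsetSum Finset.univ fun l _ => hi i l _).symm,
    ← integral_finsetSum _ fun i _ => integrable_finsetSum _ fun l _ => hi i l _]
  refine integral_congr_ae ?_
  filter_upwards [ae_mem_frontier Ω] with y hy
  -- With `z = x - y` the sum is `(ν_x × z) · (ν_y × ∇F)`, the normal projections being removed by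
  -- `ν_x × ν_x = 0`. Lagrange's identity gives the two products of the integrand.
  simp only [hΩ.tau1_eq hF hpF hy, cross_apply, inner_eq_sum, dirDeriv_eq_sum F (x - y),
    dirDeriv_eq_sum F (outwardNormal Ω x), Fin.sum_univ_three]
  simp [cvec, grad]
  ring

theorem differentiableWithinAt_tauLayer (hΩ : IsSmoothBoundedDomain Ω) (hx : x ∈ frontier Ω)
    (hF : ContDiff ℝ 1 F) (hpF : EqOn p F (frontier Ω)) {a : ℝ} (ha : 0 < a) (ha1 : a ≤ 1)
    (hH : ∀ i, IsHolderNear Ω (fun y => tau1 Ω p y i) x a) (i : Fin 3) :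
    DifferentiableWithinAt ℝ (fun ξ => tauLayer k Ω p ξ i) (frontier Ω) x :=
  (hΩ.differentiableWithinAt_singleLayer hx (hΩ.continuousOn_tau1 hF hpF i) ha ha1 (hH i)).1

end IsSmoothBoundedDomain

end

section

/-! ### Finite parts: algebra -/

section FinitePart

variable {Γ : Set Vec3} {x : Vec3} {f g : Vec3 → ℂ} {l m : ℂ}

theorem IsFinitePart.add (hf : IsFinitePart Γ x f l) (hg : IsFinitePart Γ x g m) :
    IsFinitePart Γ x (fun y => f y + g y) (l + m) := by
  obtain ⟨hfi, c, hc⟩ := hf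
  obtain ⟨hgi, d, hd⟩ := hg
  refine ⟨fun ε hε => (hfi ε hε).add (hgi ε hε), c + d, (hc.add hd).congr' ?_⟩
  filter_upwards [self_mem_nhdsWithin] with ε hε
  rw [integral_add (hfi ε hε) (hgi ε hε)]
  ring

theorem IsFinitePart.const_mul (hf : IsFinitePart Γ x f l) (c : ℂ) :
    IsFinitePart Γ x (fun y => c * f y) (c * l) := by
  obtain ⟨hfi, d, hd⟩ := hf
  refine ⟨fun ε hε => (hfi ε hε).const_mul c, c * d, (hd.const_mul c).congr' ?_⟩
  filter_upwards [self_mem_nhdsWithin] with ε hε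
  rw [integral_const_mul]
  ring

theorem IsFinitePart.congr_ae (hf : IsFinitePart Γ x f l) (h : f =ᵐ[surfaceMeasure Γ] g) :
    IsFinitePart Γ x g l := by
  obtain ⟨hfi, c, hc⟩ := hf
  refine ⟨fun ε hε => (hfi ε hε).congr (ae_restrict_of_ae h), c, hc.congr' ?_⟩
  filter_upwards [self_mem_nhdsWithin] with ε hε
  rw [integral_congr_ae (ae_restrict_of_ae h)]

theorem isFinitePart_of_integrable (hf : Integrable f (surfaceMeasure Γ))
    (hx : ∀ᵐ y ∂surfaceMeasure Γ, y ≠ x) :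
    IsFinitePart Γ x f (∫ y, f y ∂surfaceMeasure Γ) := by
  refine ⟨fun ε _ => hf.integrableOn, 0, ?_⟩
  simp only [zero_div, sub_zero]
  have h1 : ∀ ε, ∫ y in (Metric.ball x ε)ᶜ, f y ∂surfaceMeasure Γ
      = ∫ y, (Metric.ball x ε)ᶜ.indicator f y ∂surfaceMeasure Γ := fun ε =>
    (integral_indicator Metric.isOpen_ball.measurableSet.compl).symm
  simp_rw [h1]
  refine tendsto_integral_filter_of_dominated_convergence (fun y => ‖f y‖)
    (Eventually.of_forall fun ε => hf.aestronglyMeasurable.indicator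
      Metric.isOpen_ball.measurableSet.compl)
    (Eventually.of_forall fun ε => ae_of_all _ fun y => norm_indicator_le_norm_self f y) hf.norm ?_
  filter_upwards [hx] with y hy
  refine tendsto_const_nhds.congr' ?_
  filter_upwards [nhdsWithin_le_nhds (Iio_mem_nhds (dist_pos.2 hy))] with ε hε
  rw [Set.indicator_of_mem]
  rw [mem_compl_iff, Metric.mem_ball, not_lt]
  exact le_of_lt hε

end FinitePart

/-! ### The hyper-singular operator of the Helmholtz equation -/

variable {Ω : Set Vec3} {x : Vec3} {k : ℂ} {p F : Vec3 → ℂ}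

/-- The kernel `- ν_xᵀ ∇∇ᵀ γ_k ν_y`. -/
def normalHess (k : ℂ) (Ω : Set Vec3) (x y : Vec3) : ℂ :=
  -(kA k ‖x - y‖ * (inner ℝ (outwardNormal Ω y) (outwardNormal Ω x) : ℝ)
    + kB k ‖x - y‖ * (inner ℝ (x - y) (outwardNormal Ω x) : ℝ)
      * (inner ℝ (x - y) (outwardNormal Ω y) : ℝ))

/-- The weakly singular remainder of the regularised hyper-singular kernel. -/
def hyperRemainder (k : ℂ) (Ω : Set Vec3) (F : Vec3 → ℂ) (x : Vec3) (δ : ℝ) (y : Vec3) : ℂ :=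
  -(F y * ((inner ℝ (outwardNormal Ω y) (outwardNormal Ω x) : ℝ)
      * ((kA k (regR δ (x - y)) + 1 / (4 * Real.pi * (regR δ (x - y) : ℝ) ^ 3))
        + (δ : ℂ) ^ 2 * (kB k (regR δ (x - y)) - 3 / (4 * Real.pi * (regR δ (x - y) : ℝ) ^ 5)))
    + kB k (regR δ (x - y)) * (inner ℝ (x - y) (outwardNormal Ω x) : ℝ)
      * (inner ℝ (x - y) (outwardNormal Ω y) : ℝ)))

/-- The density of the strongly singular part of the hyper-singular kernel. -/
def hyperDensity (Ω : Set Vec3) (F : Vec3 → ℂ) (x y : Vec3) : ℂ :=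
  F y * (inner ℝ (outwardNormal Ω y) (outwardNormal Ω x) : ℝ) / (4 * Real.pi)

namespace IsSmoothBoundedDomain

/-- Each of three terms is of order `1/|x - y|`: the error of `kA`; the error of `kB`, as `δ² ≤ ρ²`;
and `kB`, of order `|x - y|⁻⁵`, times two inner products of order `|x - y|²`, because `x - y` is
nearly tangent at both points. -/
theorem exists_hyperRemainder_le (hΩ : IsSmoothBoundedDomain Ω) (hx : x ∈ frontier Ω)
    (hF : ContinuousOn F (frontier Ω)) :
    ∃ C : ℝ, 0 ≤ C ∧ ∀ δ, |δ| ≤ 1 → ∀ y ∈ frontier Ω, y ≠ x →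
      ‖hyperRemainder k Ω F x δ y‖ ≤ C * ‖y - x‖ ^ ((1 : ℝ) - 2) := by
  obtain ⟨Cn, hCn, ρ₂, hρ₂, h2⟩ := hΩ.exists_normal_lipschitz hx
  obtain ⟨Ca, hCa, h3⟩ := hΩ.exists_inner_normal_le hx
  obtain ⟨M, hM, hMb⟩ := hΩ.exists_norm_sub_le
  obtain ⟨Bv, hBv⟩ := hΩ.isCompact_frontier.exists_bound_of_continuousOn hF
  obtain ⟨Ck, hCk, hk⟩ := exists_profile_bounds k (M + 1)
  have hBv0 : 0 ≤ Bv := (norm_nonneg _).trans (hBv x hx)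
  refine ⟨Bv * (2 * Ck + Ck * (Ca * (Ca + Cn))), by positivity, fun δ hδ y hy hyx => ?_⟩
  rw [norm_sub_rev y x, show (1 : ℝ) - 2 = -1 by norm_num, Real.rpow_neg_one]
  set d := ‖x - y‖ with hd
  have hd0 : 0 < d := norm_pos_iff.2 (sub_ne_zero.2 hyx.symm)
  have hdM : d ≤ M := hMb x hx y hy
  set ρ := regR δ (x - y) with hρ
  have hR1 : d ≤ ρ := norm_le_regR δ _
  have hρ0 : 0 < ρ := hd0.trans_le hR1
  obtain ⟨-, -, hB, hA1, hB1⟩ := hk ρ hρ0 ((regR_le δ _).trans (add_le_add hdM hδ))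
  have hnx : ‖outwardNormal Ω x‖ = 1 := hΩ.norm_outwardNormal hx
  have hny : ‖outwardNormal Ω y‖ = 1 := hΩ.norm_outwardNormal hy
  have i1 : |inner ℝ (outwardNormal Ω y) (outwardNormal Ω x)| ≤ 1 := by
    have := abs_real_inner_le_norm (outwardNormal Ω y) (outwardNormal Ω x)
    rwa [hnx, hny, one_mul] at this
  have i2 : |inner ℝ (x - y) (outwardNormal Ω x)| ≤ Ca * d ^ 2 := by
    have := h3 y hy
    rwa [← neg_sub x y, inner_neg_right, abs_neg, norm_neg, real_inner_comm] at this
  have i3 : |inner ℝ (x - y) (outwardNormal Ω y)| ≤ (Ca + Cn) * d ^ 2 := by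
    have e : inner ℝ (x - y) (outwardNormal Ω y) = inner ℝ (x - y) (outwardNormal Ω x)
        - inner ℝ (x - y) (outwardNormal Ω x - outwardNormal Ω y) := by
      rw [inner_sub_right (x - y) (outwardNormal Ω x)]
      ring
    have h4 : |inner ℝ (x - y) (outwardNormal Ω x - outwardNormal Ω y)| ≤ d * (Cn * d) :=
      (abs_real_inner_le_norm _ _).trans (mul_le_mul_of_nonneg_left
        (h2 x hx (by simpa using hρ₂) y hy) hd0.le)
    rw [e]
    refine (abs_sub _ _).trans ((add_le_add i2 h4).trans_eq ?_)
    ring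
  have j1 : ‖kA k ρ + 1 / (4 * Real.pi * (ρ : ℝ) ^ 3)‖ ≤ Ck * d⁻¹ := by
    refine hA1.trans ?_
    rw [div_eq_mul_inv]
    gcongr
  have j2 : ‖(δ : ℂ) ^ 2 * (kB k ρ - 3 / (4 * Real.pi * (ρ : ℝ) ^ 5))‖ ≤ Ck * d⁻¹ := by
    rw [norm_mul, norm_pow, Complex.norm_real, Real.norm_eq_abs]
    have h5 : |δ| ≤ ρ := abs_le_regR δ _
    calc _ ≤ ρ ^ 2 * (Ck / ρ ^ 3) := by gcongr
      _ = Ck * ρ⁻¹ := by field_simp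
      _ ≤ _ := by gcongr
  have j3 : ‖kB k ρ * (inner ℝ (x - y) (outwardNormal Ω x) : ℝ)
      * (inner ℝ (x - y) (outwardNormal Ω y) : ℝ)‖ ≤ Ck * (Ca * (Ca + Cn)) * d⁻¹ := by
    rw [norm_mul, norm_mul, Complex.norm_real, Complex.norm_real, Real.norm_eq_abs,
      Real.norm_eq_abs]
    have h5 : Ck / ρ ^ 5 ≤ Ck / d ^ 5 := by gcongr
    calc _ ≤ Ck / d ^ 5 * (Ca * d ^ 2) * ((Ca + Cn) * d ^ 2) := by
          have := hB.trans h5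
          gcongr
      _ = _ := by field_simp
  rw [hyperRemainder, norm_neg, norm_mul, mul_assoc Bv]
  refine mul_le_mul (hBv y hy) ((norm_add_le _ _).trans ?_) (norm_nonneg _) hBv0
  rw [norm_mul, Complex.norm_real, Real.norm_eq_abs, add_mul]
  refine add_le_add ?_ j3
  calc _ ≤ 1 * (Ck * d⁻¹ + Ck * d⁻¹) := mul_le_mul i1 ((norm_add_le _ _).trans (add_le_add j1 j2))
        (norm_nonneg _) zero_le_one
    _ = _ := by ring

theorem continuousOn_inner_normal (hΩ : IsSmoothBoundedDomain Ω) (x : Vec3) :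
    ContinuousOn (fun y => ((inner ℝ (outwardNormal Ω y) (outwardNormal Ω x) : ℝ) : ℂ))
      (frontier Ω) := Complex.continuous_ofReal.comp_continuousOn
    (hΩ.continuousOn_outwardNormal.inner continuousOn_const)

theorem continuousOn_inner_sub_normal (hΩ : IsSmoothBoundedDomain Ω) (x : Vec3) :
    ContinuousOn (fun y => ((inner ℝ (x - y) (outwardNormal Ω y) : ℝ) : ℂ))
      (frontier Ω) := Complex.continuous_ofReal.comp_continuousOn
    ((continuous_const.sub continuous_id).continuousOn.inner hΩ.continuousOn_outwardNormal)

theorem aestronglyMeasurable_hyperRemainder (hΩ : IsSmoothBoundedDomain Ω)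
    (hF : ContinuousOn F (frontier Ω)) (δ : ℝ) :
    AEStronglyMeasurable (hyperRemainder k Ω F x δ) (surfaceMeasure (frontier Ω)) := by
  have hR : Measurable fun y => regR δ (x - y) :=
    (measurable_regR δ).comp (measurable_const.sub measurable_id)
  have hRc : Measurable fun y => ((regR δ (x - y) : ℝ) : ℂ) := Complex.measurable_ofReal.comp hR
  have hA := (measurable_kA k).comp hR
  have hB := (measurable_kB k).comp hR
  have m1 : Measurable fun y => (kA k (regR δ (x - y))
      + 1 / (4 * Real.pi * (regR δ (x - y) : ℝ) ^ 3 : ℂ))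
        + (δ : ℂ) ^ 2 * (kB k (regR δ (x - y)) - 3 / (4 * Real.pi * (regR δ (x - y) : ℝ) ^ 5)) :=
    (hA.add ((hRc.pow_const 3).const_mul _ |>.const_div _)).add
      ((hB.sub ((hRc.pow_const 5).const_mul _ |>.const_div _)).const_mul _)
  have hz : Continuous fun y => ((inner ℝ (x - y) (outwardNormal Ω x) : ℝ) : ℂ) :=
    Complex.continuous_ofReal.comp ((continuous_const.sub continuous_id).inner continuous_const)
  exact ((aestronglyMeasurable_of_continuousOn hF).mul
    (((aestronglyMeasurable_of_continuousOn (hΩ.continuousOn_inner_normal x)).mul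
      m1.aestronglyMeasurable).add ((hB.mul hz.measurable).aestronglyMeasurable.mul
      (aestronglyMeasurable_of_continuousOn (hΩ.continuousOn_inner_sub_normal x))))).neg

theorem integrable_hyperRemainder (hΩ : IsSmoothBoundedDomain Ω) (hx : x ∈ frontier Ω)
    (hF : ContinuousOn F (frontier Ω)) {δ : ℝ} (hδ : |δ| ≤ 1) :
    Integrable (hyperRemainder k Ω F x δ) (surfaceMeasure (frontier Ω)) := by
  have hfin := hΩ.isFiniteMeasure
  obtain ⟨A, hA, hμ⟩ := hΩ.exists_surfaceMeasure_closedBall_le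
  obtain ⟨C, hC, hb⟩ := hΩ.exists_hyperRemainder_le (k := k) hx hF
  refine integrable_of_weaklySingular hA one_pos le_rfl hμ (ξ := x) (C := C)
    (hΩ.aestronglyMeasurable_hyperRemainder hF δ) ?_
  filter_upwards [ae_mem_frontier Ω, ae_ne_of_growth hμ x] with y hy hne using hb δ hδ y hy hne

theorem tendsto_integral_hyperRemainder (hΩ : IsSmoothBoundedDomain Ω) (hx : x ∈ frontier Ω)
    (hF : ContinuousOn F (frontier Ω)) :
    Tendsto (fun δ => ∫ y, hyperRemainder k Ω F x δ y ∂surfaceMeasure (frontier Ω)) (𝓝[>] 0)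
      (𝓝 (∫ y, hyperRemainder k Ω F x 0 y ∂surfaceMeasure (frontier Ω))) := by
  have hfin := hΩ.isFiniteMeasure
  obtain ⟨A, hA, hμ⟩ := hΩ.exists_surfaceMeasure_closedBall_le
  obtain ⟨C, hC, hb⟩ := hΩ.exists_hyperRemainder_le (k := k) hx hF
  have hδ : Tendsto (fun δ : ℝ => δ) (𝓝[>] 0) (𝓝 0) := nhdsWithin_le_nhds
  refine tendsto_integral_of_weaklySingular hA one_pos le_rfl hμ hC (ξ := fun _ => x)
    tendsto_const_nhds (Eventually.of_forall fun δ => hΩ.aestronglyMeasurable_hyperRemainder hF δ)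
    ?_ (hΩ.aestronglyMeasurable_hyperRemainder hF 0) ?_ ?_
  · filter_upwards [Ioo_mem_nhdsGT one_pos] with δ h1
    filter_upwards [ae_mem_frontier Ω, ae_ne_of_growth hμ x] with y hy hne
    exact hb δ (by rw [abs_of_pos h1.1]; exact h1.2.le) y hy hne
  · filter_upwards [ae_mem_frontier Ω, ae_ne_of_growth hμ x] with y hy hne
      using hb 0 (by simp) y hy hne
  · filter_upwards [ae_ne_of_growth hμ x] with y hne
    have h0 := (regR_pos 0 (sub_ne_zero.2 hne.symm)).ne'
    have hR : Tendsto (fun δ => regR δ (x - y)) (𝓝[>] 0) (𝓝 (regR 0 (x - y))) :=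
      tendsto_regR hδ tendsto_const_nhds
    have hRc := (Complex.continuous_ofReal.tendsto _).comp hR
    have hδc := (Complex.continuous_ofReal.tendsto _).comp hδ
    have hAl := (continuousAt_kA k h0).tendsto.comp hR
    have hBl := (continuousAt_kB k h0).tendsto.comp hR
    have h0c : ((regR 0 (x - y) : ℝ) : ℂ) ≠ 0 := by exact_mod_cast h0
    have hpi : (4 * Real.pi : ℂ) ≠ 0 := by
      have := Real.pi_ne_zero
      exact_mod_cast (mul_ne_zero four_ne_zero this)
    have l3 := (tendsto_const_nhds (x := (1 : ℂ))).div ((hRc.pow 3).const_mul (4 * Real.pi : ℂ))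
      (mul_ne_zero hpi (pow_ne_zero 3 h0c))
    have l5 := (tendsto_const_nhds (x := (3 : ℂ))).div ((hRc.pow 5).const_mul (4 * Real.pi : ℂ))
      (mul_ne_zero hpi (pow_ne_zero 5 h0c))
    exact (((((hAl.add l3).add ((hδc.pow 2).mul (hBl.sub l5))).const_mul _).add
      ((hBl.mul_const _).mul_const _)).const_mul _).neg

end IsSmoothBoundedDomain

end

/-! ### Maue's formula for the Helmholtz hyper-singular operator -/

section

variable {Ω : Set Vec3} {x : Vec3} {k : ℂ} {p F : Vec3 → ℂ}

theorem regCube_eq (δ : ℝ) (z : Vec3) :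
    regCube δ ‖z‖ = (regR δ z ^ 3)⁻¹ - 3 * δ ^ 2 * (regR δ z ^ 5)⁻¹ := rfl

namespace IsSmoothBoundedDomain

theorem continuousOn_hyperDensity (hΩ : IsSmoothBoundedDomain Ω) (hF : ContinuousOn F (frontier Ω)) :
    ContinuousOn (hyperDensity Ω F x) (frontier Ω) :=
  (hF.mul (hΩ.continuousOn_inner_normal x)).div_const _

/-- From `|ν_x - ν_y|² = 2 - 2 ν_x·ν_y` the factor `ν_x·ν_y` is one up to `O(|y - x|²)`. The
expansion is therefore that of `F / 4π`. -/
theorem exists_hyperDensity_sub_le (hΩ : IsSmoothBoundedDomain Ω) (hx : x ∈ frontier Ω)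
    (hF : ContDiff ℝ 1 F) {M C a : ℝ} (ha : 0 < a) (ha1 : a ≤ 1) (hC : 0 ≤ C)
    (hM : ∀ ξ ∈ frontier Ω, ∀ y ∈ frontier Ω, ‖ξ - y‖ ≤ M)
    (hH : ∀ y w, ‖y - w‖ ≤ M → ‖fderiv ℝ F y - fderiv ℝ F w‖ ≤ C * ‖y - w‖ ^ a) :
    ∃ (q₀ : ℂ) (L : Vec3 →L[ℝ] ℂ) (C' : ℝ), ∀ y ∈ frontier Ω,
      ‖hyperDensity Ω F x y - (q₀ + L (y - x))‖ ≤ C' * ‖y - x‖ ^ (1 + a) := by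
  obtain ⟨Cn, hCn, ρ₂, hρ₂, h2⟩ := hΩ.exists_normal_lipschitz hx
  obtain ⟨B, hB⟩ := hΩ.isCompact_frontier.exists_bound_of_continuousOn hF.continuous.continuousOn
  have hB0 : 0 ≤ B := (norm_nonneg _).trans (hB x hx)
  have hM0 : 0 ≤ M := (norm_nonneg _).trans (hM x hx x hx)
  set c : ℂ := (4 * Real.pi : ℂ)⁻¹ with hc
  refine ⟨c * F x, c • fderiv ℝ F x, ‖c‖ * (B * (Cn ^ 2 / 2 * M ^ (1 - a)) + C), fun y hy => ?_⟩
  set m : ℝ := inner ℝ (outwardNormal Ω y) (outwardNormal Ω x) with hm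
  have hm1 : |m - 1| ≤ Cn ^ 2 / 2 * ‖y - x‖ ^ 2 := by
    have e := norm_sub_sq_real (outwardNormal Ω x) (outwardNormal Ω y)
    rw [hΩ.norm_outwardNormal hx, hΩ.norm_outwardNormal hy, real_inner_comm, ← hm] at e
    have h3 := h2 x hx (by simpa using hρ₂) y hy
    have h4 : ‖outwardNormal Ω x - outwardNormal Ω y‖ ^ 2 ≤ (Cn * ‖x - y‖) ^ 2 := by gcongr
    have h5 := sq_nonneg ‖outwardNormal Ω x - outwardNormal Ω y‖
    rw [norm_sub_rev y x, abs_le]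
    constructor <;> linarith [mul_pow Cn ‖x - y‖ 2]
  have hsq : ‖y - x‖ ^ 2 ≤ M ^ (1 - a) * ‖y - x‖ ^ (1 + a) := by
    have h3 : ‖y - x‖ ^ 2 = ‖y - x‖ ^ (1 - a) * ‖y - x‖ ^ (1 + a) := by
      rw [← Real.rpow_add_of_nonneg (norm_nonneg _) (sub_nonneg.2 ha1) (by linarith)]
      norm_num
    rw [h3]
    have := hM y hy x hx
    gcongr
  have e : hyperDensity Ω F x y - (c * F x + (c • fderiv ℝ F x) (y - x))
      = c * (F y * ((m - 1 : ℝ) : ℂ) + (F y - (F x + fderiv ℝ F x (y - x)))) := by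
    rw [hyperDensity, smul_apply, smul_eq_mul, div_eq_mul_inv, ← hc]
    push_cast
    ring
  have ht := norm_taylor_le (x := x) hF ha hC hH (hM y hy x hx)
  rw [e, norm_mul, mul_assoc, add_mul]
  refine mul_le_mul_of_nonneg_left ((norm_add_le _ _).trans (add_le_add ?_ ht)) (norm_nonneg _)
  rw [norm_mul, Complex.norm_real, Real.norm_eq_abs, mul_assoc, mul_assoc]
  refine mul_le_mul (hB y hy) (hm1.trans ?_) (abs_nonneg _) hB0
  gcongr

/-- The finite part of the hyper-singular operator of the Helmholtz equation. -/
theorem isFinitePart_normalHess (hΩ : IsSmoothBoundedDomain Ω) (hx : x ∈ frontier Ω)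
    (hF : ContDiff ℝ 1 F) (hpF : EqOn p F (frontier Ω)) {M C a : ℝ} (ha : 0 < a) (ha1 : a ≤ 1)
    (hC : 0 ≤ C) (hM : ∀ ξ ∈ frontier Ω, ∀ y ∈ frontier Ω, ‖ξ - y‖ ≤ M)
    (hH : ∀ y w, ‖y - w‖ ≤ M → ‖fderiv ℝ F y - fderiv ℝ F w‖ ≤ C * ‖y - w‖ ^ a) :
    IsFinitePart (frontier Ω) x (fun y => normalHess k Ω x y * p y)
      (k ^ 2 * regSingleLayer k Ω
          (fun y => F y * (inner ℝ (outwardNormal Ω y) (outwardNormal Ω x) : ℝ)) 0 x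
        + tau2 Ω (tauLayer k Ω p) x) := by
  have hfin := hΩ.isFiniteMeasure
  have hpi : (Real.pi : ℂ) ≠ 0 := by exact_mod_cast Real.pi_ne_zero
  obtain ⟨A, hA, hμ⟩ := hΩ.exists_surfaceMeasure_closedBall_le
  have hFc := hF.continuous.continuousOn (s := frontier Ω)
  have hmc : ContinuousOn (fun y => F y * ((inner ℝ (outwardNormal Ω y) (outwardNormal Ω x) : ℝ) : ℂ))
      (frontier Ω) := hFc.mul (hΩ.continuousOn_inner_normal x)
  obtain ⟨q₀, L, C', hq⟩ := hΩ.exists_hyperDensity_sub_le hx hF ha ha1 hC hM hH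
  obtain ⟨hint, c, l, h1, h2⟩ := hΩ.exists_finitePart hx
    (aestronglyMeasurable_of_continuousOn (hΩ.continuousOn_hyperDensity hFc)) ha ha1 hq
  have h3 := hΩ.tendsto_tau2_tauLayer (k := k) hx hF hpF ha ha1
    (hΩ.isHolderNear_tau1 hx hF hpF ha ha1 hC hM hH)
  have h4 := (h2.sub ((hΩ.tendsto_regSingleLayer (k := k) hmc hx).const_mul (k ^ 2))).add
    (hΩ.tendsto_integral_hyperRemainder (k := k) hx hFc)
  -- Both limits belong to the two sides of the Stokes identity, so `τ₂ S τ₁ p` equals the finite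
  -- part `l`, minus `k²` times the single-layer potential, plus the integral of the remainder.
  have h5 := tendsto_nhds_unique h3 (h4.congr' (by
    filter_upwards [Ioo_mem_nhdsGT one_pos] with δ hδ
    have hδ0 : δ ≠ 0 := hδ.1.ne'
    have hnm : Measurable fun y : Vec3 => ‖y - x‖ := (measurable_id.sub_const x).norm
    obtain ⟨B, hB⟩ := hΩ.isCompact_frontier.exists_bound_of_continuousOn
      (hΩ.continuousOn_hyperDensity (x := x) hFc)
    have i1 : Integrable (fun y => regCube δ ‖y - x‖ • hyperDensity Ω F x y)
        (surfaceMeasure (frontier Ω)) := by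
      refine Integrable.of_bound (((measurable_regCube δ).comp hnm).aestronglyMeasurable.smul
        (aestronglyMeasurable_of_continuousOn (hΩ.continuousOn_hyperDensity hFc)))
        (4 * (δ ^ 3)⁻¹ * B) ?_
      filter_upwards [ae_mem_frontier Ω] with y hy
      rw [norm_smul, Real.norm_eq_abs]
      exact mul_le_mul (abs_regCube_le_delta hδ.1 _) (hB y hy) (norm_nonneg _)
        (by have := hδ.1; positivity)
    have i2 : Integrable (fun y => kG k (regR δ (x - y)) * (F y
        * ((inner ℝ (outwardNormal Ω y) (outwardNormal Ω x) : ℝ) : ℂ)))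
        (surfaceMeasure (frontier Ω)) := hΩ.integrable_of_continuousOn
      ((contDiff_kG_regR_const_sub k hδ0 x).continuous.continuousOn.mul hmc)
    have i3 := hΩ.integrable_hyperRemainder (k := k) hx hFc (δ := δ)
      (by rw [abs_of_pos hδ.1]; exact hδ.2.le)
    have i4 : Integrable (fun y => regCube δ ‖y - x‖ • hyperDensity Ω F x y
        - k ^ 2 * (kG k (regR δ (x - y)) * (F y
          * ((inner ℝ (outwardNormal Ω y) (outwardNormal Ω x) : ℝ) : ℂ))))
        (surfaceMeasure (frontier Ω)) := i1.sub (i2.const_mul _)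
    rw [hΩ.integral_regField hF hδ0, regSingleLayer, ← integral_const_mul,
      ← integral_sub i1 (i2.const_mul _), ← integral_add i4 i3]
    refine integral_congr_ae (ae_of_all _ fun y => ?_)
    have hρ := (regR_pos_of_ne hδ0 (x - y)).ne'
    have hρc : ((regR δ (x - y) : ℝ) : ℂ) ≠ 0 := by exact_mod_cast hρ
    have e1 := three_kA_add k hρ
    have e2 : ((‖x - y‖ ^ 2 : ℝ) : ℂ) = (regR δ (x - y) : ℂ) ^ 2 - (δ : ℂ) ^ 2 := by
      have := regR_sq δ (x - y)
      rw [← Complex.ofReal_pow, this]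
      push_cast
      ring
    -- The Helmholtz equation for the profile involves `ρ²`, the divergence `|x - y|² = ρ² - δ²`.
    -- The missing `δ² kB` has leading part `3δ²ρ⁻⁵ / 4π` and completes `ρ⁻³` to `regCube`.
    have e3 : 3 * kA k (regR δ (x - y)) + kB k (regR δ (x - y)) * ((‖x - y‖ ^ 2 : ℝ) : ℂ)
        = -(k ^ 2 * kG k (regR δ (x - y))) - kB k (regR δ (x - y)) * (δ : ℂ) ^ 2 := by
      rw [e2, ← e1]
      ring
    beta_reduce
    rw [e3, norm_sub_rev y x, regCube_eq, hyperDensity, hyperRemainder, Complex.real_smul]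
    push_cast
    field_simp
    ring))
  have hE := isFinitePart_of_integrable (hΩ.integrable_hyperRemainder (k := k) hx hFc
    (δ := 0) (by simp)) (ae_ne_of_growth hμ x)
  have htr : ∀ ε, 0 < ε → ((Metric.ball x ε)ᶜ.indicator fun y =>
      (‖y - x‖ ^ 3)⁻¹ • hyperDensity Ω F x y) = fun y => truncCube ε ‖y - x‖ • hyperDensity Ω F x y :=
    fun ε hε => by
      ext y
      by_cases hy : ε ≤ ‖y - x‖
      · rw [Set.indicator_of_mem (by rwa [mem_compl_iff, mem_ball_iff_norm, not_lt]), truncCube,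
          if_pos hy]
      · rw [Set.indicator_of_notMem (by rwa [mem_compl_iff, mem_ball_iff_norm, not_lt]), truncCube,
          if_neg hy, zero_smul]
  have hQ : IsFinitePart (frontier Ω) x (fun y => (‖y - x‖ ^ 3)⁻¹ • hyperDensity Ω F x y) l := by
    have hball : ∀ ε, MeasurableSet (Metric.ball x ε)ᶜ := fun ε =>
      Metric.isOpen_ball.measurableSet.compl
    refine ⟨fun ε hε => ?_, c, h1.congr' ?_⟩
    · rw [← integrable_indicator_iff (hball ε), htr ε hε]
      exact hint ε hε
    · filter_upwards [self_mem_nhdsWithin] with ε hε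
      rw [← integral_indicator (hball ε), htr ε hε]
  -- The `k²` terms cancel. It remains that the kernel is the singular density over `|x - y|³` plus
  -- the remainder at `δ = 0`.
  rw [h5, show k ^ 2 * regSingleLayer k Ω
      (fun y => F y * (inner ℝ (outwardNormal Ω y) (outwardNormal Ω x) : ℝ)) 0 x
      + (l - k ^ 2 * regSingleLayer k Ω
      (fun y => F y * (inner ℝ (outwardNormal Ω y) (outwardNormal Ω x) : ℝ)) 0 x
      + ∫ y, hyperRemainder k Ω F x 0 y ∂surfaceMeasure (frontier Ω))
      = l + ∫ y, hyperRemainder k Ω F x 0 y ∂surfaceMeasure (frontier Ω) by ring]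
  refine (hQ.add hE).congr_ae ?_
  filter_upwards [ae_mem_frontier Ω, ae_ne_of_growth hμ x] with y hy hne
  have hd : ((‖x - y‖ : ℝ) : ℂ) ≠ 0 := by
    exact_mod_cast (norm_pos_iff.2 (sub_ne_zero.2 hne.symm)).ne'
  rw [hpF hy, hyperRemainder, hyperDensity, normalHess, regR_zero, norm_sub_rev y x,
    Complex.real_smul]
  push_cast
  field_simp
  ring

end IsSmoothBoundedDomain

end

section

/-! ### Weakly singular kernels -/

variable {Γ : Set Vec3} {K K' : Vec3 → Vec3 → ℂ} {Ω : Set Vec3}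

namespace IsWeaklySingular

theorem congr (hK : IsWeaklySingular Γ K)
    (h : ∀ x ∈ Γ, ∀ y ∈ Γ, x ≠ y → K' x y = K x y) : IsWeaklySingular Γ K' := by
  obtain ⟨hc, C, hC⟩ := hK
  refine ⟨hc.congr fun z hz => h _ hz.1 _ hz.2.1 hz.2.2, C, fun x hx y hy hxy => ?_⟩
  rw [h x hx y hy hxy]
  exact hC x hx y hy hxy

theorem add (hK : IsWeaklySingular Γ K) (hK' : IsWeaklySingular Γ K') :
    IsWeaklySingular Γ fun x y => K x y + K' x y := by
  obtain ⟨hc, C, hC⟩ := hK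
  obtain ⟨hc', C', hC'⟩ := hK'
  refine ⟨hc.add hc', C + C', fun x hx y hy hxy => ?_⟩
  rw [add_div]
  exact (norm_add_le _ _).trans (add_le_add (hC x hx y hy hxy) (hC' x hx y hy hxy))

theorem const_mul (hK : IsWeaklySingular Γ K) (c : ℂ) :
    IsWeaklySingular Γ fun x y => c * K x y := by
  obtain ⟨hc, C, hC⟩ := hK
  refine ⟨continuousOn_const.mul hc, ‖c‖ * C, fun x hx y hy hxy => ?_⟩
  rw [norm_mul, mul_div_assoc]
  exact mul_le_mul_of_nonneg_left (hC x hx y hy hxy) (norm_nonneg _)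

theorem mul_bounded {b : Vec3 → Vec3 → ℂ} (hK : IsWeaklySingular Γ K)
    (hb : ContinuousOn (fun z : Vec3 × Vec3 => b z.1 z.2) {z | z.1 ∈ Γ ∧ z.2 ∈ Γ ∧ z.1 ≠ z.2})
    (hb1 : ∀ x ∈ Γ, ∀ y ∈ Γ, ‖b x y‖ ≤ 1) : IsWeaklySingular Γ fun x y => K x y * b x y := by
  obtain ⟨hc, C, hC⟩ := hK
  refine ⟨hc.mul hb, C, fun x hx y hy hxy => ?_⟩
  rw [norm_mul]
  exact (mul_le_of_le_one_right (norm_nonneg _) (hb1 x hx y hy)).trans (hC x hx y hy hxy)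

end IsWeaklySingular

theorem continuousOn_profile {f : ℝ → ℂ} (hf : ∀ ρ ≠ 0, ContinuousAt f ρ) (Γ : Set Vec3) :
    ContinuousOn (fun z : Vec3 × Vec3 => f ‖z.1 - z.2‖) {z | z.1 ∈ Γ ∧ z.2 ∈ Γ ∧ z.1 ≠ z.2} := by
  intro z hz
  have h1 : ContinuousAt (fun z : Vec3 × Vec3 => ‖z.1 - z.2‖) z := by fun_prop
  exact (ContinuousAt.comp (f := fun z : Vec3 × Vec3 => ‖z.1 - z.2‖)
    (hf _ (norm_pos_iff.2 (sub_ne_zero.2 hz.2.2)).ne') h1).continuousWithinAt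

namespace IsSmoothBoundedDomain

theorem isWeaklySingular_helmholtz (hΩ : IsSmoothBoundedDomain Ω) (k : ℂ) :
    IsWeaklySingular (frontier Ω) (helmholtz k) := by
  obtain ⟨M, hM, hMb⟩ := hΩ.exists_norm_sub_le
  obtain ⟨C, hC, hk⟩ := exists_profile_bounds k M
  refine ⟨continuousOn_profile (f := kG k) (fun _ => continuousAt_kG k) _, C,
    fun x hx y hy hxy => ?_⟩
  exact (hk _ (norm_pos_iff.2 (sub_ne_zero.2 hxy)) (hMb x hx y hy)).1

/-- A combination of the first radial derivatives in which the leading singularities cancel. -/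
theorem isWeaklySingular_kA_comb (hΩ : IsSmoothBoundedDomain Ω) (k₀ k₁ k₂ : ℂ) {c d : ℂ}
    (hcd : 1 - c + d = 0) : IsWeaklySingular (frontier Ω) fun x y =>
      kA k₀ ‖x - y‖ - c * kA k₁ ‖x - y‖ + d * kA k₂ ‖x - y‖ := by
  obtain ⟨M, hM, hMb⟩ := hΩ.exists_norm_sub_le
  have key : ∀ k, IsWeaklySingular (frontier Ω) fun x y =>
      kA k ‖x - y‖ + 1 / (4 * Real.pi * (‖x - y‖ : ℝ) ^ 3) := fun k => by
    obtain ⟨C, hC, hk⟩ := exists_profile_bounds k M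
    have hpi : (4 * Real.pi : ℂ) ≠ 0 := by
      exact_mod_cast (mul_ne_zero four_ne_zero Real.pi_ne_zero)
    refine ⟨continuousOn_profile (f := fun ρ => kA k ρ + 1 / (4 * Real.pi * (ρ : ℝ) ^ 3))
      (fun ρ hρ => (continuousAt_kA k hρ).add ?_) _, C, fun x hx y hy hxy => ?_⟩
    · have hρc : (ρ : ℂ) ≠ 0 := by exact_mod_cast hρ
      exact continuousAt_const.div (continuousAt_const.mul
        (Complex.continuous_ofReal.continuousAt.pow 3)) (mul_ne_zero hpi (pow_ne_zero 3 hρc))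
    · exact (hk _ (norm_pos_iff.2 (sub_ne_zero.2 hxy)) (hMb x hx y hy)).2.2.2.1
  refine (((key k₀).add ((key k₁).const_mul (-c))).add ((key k₂).const_mul d)).congr
    fun x _ y _ _ => ?_
  -- The static part `-1/(4πρ³)` enters with total weight `1 - c + d = 0`.
  linear_combination (-(1 / (4 * Real.pi * (‖x - y‖ : ℂ) ^ 3))) * hcd

theorem continuousOn_normal_fst (hΩ : IsSmoothBoundedDomain Ω) :
    ContinuousOn (fun z : Vec3 × Vec3 => outwardNormal Ω z.1)
      {z | z.1 ∈ frontier Ω ∧ z.2 ∈ frontier Ω ∧ z.1 ≠ z.2} :=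
  hΩ.continuousOn_outwardNormal.comp continuousOn_fst fun _ hz => hz.1

theorem continuousOn_normal_snd (hΩ : IsSmoothBoundedDomain Ω) :
    ContinuousOn (fun z : Vec3 × Vec3 => outwardNormal Ω z.2)
      {z | z.1 ∈ frontier Ω ∧ z.2 ∈ frontier Ω ∧ z.1 ≠ z.2} :=
  hΩ.continuousOn_outwardNormal.comp continuousOn_snd fun _ hz => hz.2.1

theorem mul_normal (hΩ : IsSmoothBoundedDomain Ω) (hK : IsWeaklySingular (frontier Ω) K) :
    IsWeaklySingular (frontier Ω) fun x y =>
      K x y * (inner ℝ (outwardNormal Ω y) (outwardNormal Ω x) : ℝ) := by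
  refine hK.mul_bounded (b := fun x y => ((inner ℝ (outwardNormal Ω y) (outwardNormal Ω x) : ℝ) : ℂ))
    (Complex.continuous_ofReal.comp_continuousOn
      (hΩ.continuousOn_normal_snd.inner hΩ.continuousOn_normal_fst)) fun x hx y hy => ?_
  rw [Complex.norm_real, Real.norm_eq_abs]
  refine (abs_real_inner_le_norm _ _).trans ?_
  rw [hΩ.norm_outwardNormal hx, hΩ.norm_outwardNormal hy, one_mul]

/-- A combination of the second radial derivatives in which the leading singularities cancel. -/
theorem isWeaklySingular_kB_comb (hΩ : IsSmoothBoundedDomain Ω) (k₀ k₁ k₂ : ℂ) {c d : ℂ}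
    (hcd : 1 - c + d = 0) : IsWeaklySingular (frontier Ω) fun x y =>
      (kB k₀ ‖x - y‖ - c * kB k₁ ‖x - y‖ + d * kB k₂ ‖x - y‖)
      * (inner ℝ (x - y) (outwardNormal Ω x) : ℝ) * (inner ℝ (x - y) (outwardNormal Ω y) : ℝ) := by
  obtain ⟨M, hM, hMb⟩ := hΩ.exists_norm_sub_le
  have hz : ContinuousOn (fun z : Vec3 × Vec3 => z.1 - z.2)
      {z | z.1 ∈ frontier Ω ∧ z.2 ∈ frontier Ω ∧ z.1 ≠ z.2} := by fun_prop
  have key : ∀ k, IsWeaklySingular (frontier Ω) fun x y =>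
      (kB k ‖x - y‖ - 3 / (4 * Real.pi * (‖x - y‖ : ℝ) ^ 5))
      * (inner ℝ (x - y) (outwardNormal Ω x) : ℝ)
      * (inner ℝ (x - y) (outwardNormal Ω y) : ℝ) := fun k => by
    obtain ⟨C, hC, hk⟩ := exists_profile_bounds k M
    have hpi : (4 * Real.pi : ℂ) ≠ 0 := by
      exact_mod_cast (mul_ne_zero four_ne_zero Real.pi_ne_zero)
    refine ⟨((continuousOn_profile (f := fun ρ => kB k ρ - 3 / (4 * Real.pi * (ρ : ℝ) ^ 5))
      (fun ρ hρ => (continuousAt_kB k hρ).sub ?_) _).mul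
      (Complex.continuous_ofReal.comp_continuousOn (hz.inner hΩ.continuousOn_normal_fst))).mul
      (Complex.continuous_ofReal.comp_continuousOn (hz.inner hΩ.continuousOn_normal_snd)), C,
      fun x hx y hy hxy => ?_⟩
    · have hρc : (ρ : ℂ) ≠ 0 := by exact_mod_cast hρ
      exact continuousAt_const.div (continuousAt_const.mul
        (Complex.continuous_ofReal.continuousAt.pow 5)) (mul_ne_zero hpi (pow_ne_zero 5 hρc))
    · have hd : 0 < ‖x - y‖ := norm_pos_iff.2 (sub_ne_zero.2 hxy)
      have h1 := (hk _ hd (hMb x hx y hy)).2.2.2.2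
      have i1 : |inner ℝ (x - y) (outwardNormal Ω x)| ≤ ‖x - y‖ := by
        simpa [hΩ.norm_outwardNormal hx] using abs_real_inner_le_norm (x - y) (outwardNormal Ω x)
      have i2 : |inner ℝ (x - y) (outwardNormal Ω y)| ≤ ‖x - y‖ := by
        simpa [hΩ.norm_outwardNormal hy] using abs_real_inner_le_norm (x - y) (outwardNormal Ω y)
      rw [norm_mul, norm_mul, Complex.norm_real, Complex.norm_real, Real.norm_eq_abs,
        Real.norm_eq_abs]
      calc _ ≤ C / ‖x - y‖ ^ 3 * ‖x - y‖ * ‖x - y‖ := by gcongr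
        _ = _ := by field_simp
  refine (((key k₀).add ((key k₁).const_mul (-c))).add ((key k₂).const_mul d)).congr
    fun x _ y _ _ => ?_
  linear_combination (3 / (4 * Real.pi * (‖x - y‖ : ℂ) ^ 5))
    * (inner ℝ (x - y) (outwardNormal Ω x) : ℝ) * (inner ℝ (x - y) (outwardNormal Ω y) : ℝ) * hcd

/-- Weakly singular operators act on continuous densities. -/
theorem integrable_mul_of_isWeaklySingular (hΩ : IsSmoothBoundedDomain Ω)
    (hK : IsWeaklySingular (frontier Ω) K) {x : Vec3} (hx : x ∈ frontier Ω) {f : Vec3 → ℂ}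
    (hf : ContinuousOn f (frontier Ω)) :
    Integrable (fun y => K x y * f y) (surfaceMeasure (frontier Ω)) := by
  have hfin := hΩ.isFiniteMeasure
  obtain ⟨A, hA, hμ⟩ := hΩ.exists_surfaceMeasure_closedBall_le
  obtain ⟨hc, C, hC⟩ := hK
  obtain ⟨B, hB⟩ := hΩ.isCompact_frontier.exists_bound_of_continuousOn hf
  have hS : MeasurableSet (frontier Ω \ {x}) :=
    isClosed_frontier.measurableSet.diff (measurableSet_singleton x)
  have hae : ∀ᵐ y ∂surfaceMeasure (frontier Ω), y ∈ frontier Ω \ {x} := by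
    filter_upwards [ae_mem_frontier Ω, ae_ne_of_growth hμ x] with y hy hne using ⟨hy, hne⟩
  have hcont : ContinuousOn (fun y => K x y) (frontier Ω \ {x}) :=
    hc.comp (f := fun y => (x, y)) (by fun_prop) fun y hy => ⟨hx, hy.1, fun h => hy.2 h.symm⟩
  -- The kernel is continuous only off the diagonal, but the point `x` is a null set.
  have hm : AEStronglyMeasurable (fun y => K x y * f y) (surfaceMeasure (frontier Ω)) := by
    rw [← Measure.restrict_eq_self_of_ae_mem hae]
    exact (hcont.mul (hf.mono sdiff_subset)).aestronglyMeasurable hS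
  refine integrable_of_weaklySingular hA one_pos le_rfl hμ (ξ := x) (C := C * B) hm ?_
  filter_upwards [hae] with y hy
  have h1 := hC x hx y hy.1 fun h => hy.2 h.symm
  rw [norm_mul, norm_sub_rev y x, show (1 : ℝ) - 2 = -1 by norm_num, Real.rpow_neg_one]
  calc _ ≤ C / ‖x - y‖ * B := mul_le_mul h1 (hB y hy.1) (norm_nonneg _) ((norm_nonneg _).trans h1)
    _ = _ := by ring

end IsSmoothBoundedDomain

end

section

/-! ### The entry of the hyper-singular kernel that acts on pressures -/

variable {x y : Vec3} {k : ℂ} {Ω : Set Vec3}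

theorem dirDeriv_congr {f g : Vec3 → ℂ} (n : Vec3) (h : f =ᶠ[𝓝 x] g) :
    dirDeriv n f x = dirDeriv n g x := by
  rw [dirDeriv, dirDeriv, h.fderiv_eq]

theorem dirDeriv_add {f g : Vec3 → ℂ} (n : Vec3) (hf : DifferentiableAt ℝ f x)
    (hg : DifferentiableAt ℝ g x) :
    dirDeriv n (fun z => f z + g z) x = dirDeriv n f x + dirDeriv n g x := by
  rw [dirDeriv, fderiv_fun_add hf hg]
  rfl

theorem dirDeriv_sub {f g : Vec3 → ℂ} (n : Vec3) (hf : DifferentiableAt ℝ f x)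
    (hg : DifferentiableAt ℝ g x) :
    dirDeriv n (fun z => f z - g z) x = dirDeriv n f x - dirDeriv n g x := by
  rw [dirDeriv, fderiv_fun_sub hf hg]
  rfl

theorem dirDeriv_const_mul {f : Vec3 → ℂ} (n : Vec3) (c : ℂ) (hf : DifferentiableAt ℝ f x) :
    dirDeriv n (fun z => c * f z) x = c * dirDeriv n f x := by
  rw [dirDeriv, fderiv_const_mul hf]
  rfl

theorem dirDeriv_comb {f g h : Vec3 → ℂ} (n : Vec3) (c d : ℂ) (hf : DifferentiableAt ℝ f x)
    (hg : DifferentiableAt ℝ g x) (hh : DifferentiableAt ℝ h x) :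
    dirDeriv n (fun z => f z - c * g z + d * h z) x
      = dirDeriv n f x - c * dirDeriv n g x + d * dirDeriv n h x := by
  rw [← dirDeriv_const_mul n c hg, ← dirDeriv_const_mul n d hh,
    ← dirDeriv_sub n hf (hg.const_mul c)]
  exact dirDeriv_add n (hf.sub (hg.const_mul c)) (hh.const_mul d)

/-- The kernel `wᵀ ∇∇ᵀ γ_k n` of the Hessian of the fundamental solution. -/
def hessForm (k : ℂ) (x y n w : Vec3) : ℂ :=
  kA k ‖x - y‖ * (inner ℝ n w : ℝ)
    + kB k ‖x - y‖ * (inner ℝ (x - y) n : ℝ) * (inner ℝ (x - y) w : ℝ)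

theorem helmholtz_comm (k : ℂ) (x y : Vec3) : helmholtz k x y = helmholtz k y x := by
  rw [helmholtz, helmholtz, norm_sub_rev]

theorem grad_sub_helmholtz (k₁ k₂ : ℂ) (hxy : x ≠ y) (i : Fin 3) :
    grad (fun z => helmholtz k₁ z y - helmholtz k₂ z y) x i
      = kA k₁ ‖x - y‖ * ((x - y) i : ℝ) - kA k₂ ‖x - y‖ * ((x - y) i : ℝ) := by
  rw [← grad_helmholtz k₁ hxy, ← grad_helmholtz k₂ hxy]
  exact dirDeriv_sub _ (differentiableAt_helmholtz k₁ hxy) (differentiableAt_helmholtz k₂ hxy)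

theorem eventually_ne_nhds (hxy : x ≠ y) : ∀ᶠ z in 𝓝 x, z ≠ y :=
  isOpen_ne.mem_nhds hxy

theorem inner_single_eq (z : Vec3) (i : Fin 3) :
    inner ℝ z (EuclideanSpace.single i (1 : ℝ)) = z i := by
  rw [inner_eq_sum]
  simp

theorem hess_helmholtz_comb (k₀ k₁ k₂ c d : ℂ) (hxy : x ≠ y) (i j : Fin 3) :
    hess (fun z => helmholtz k₀ z y - c * helmholtz k₁ z y + d * helmholtz k₂ z y) x i j
      = (kA k₀ ‖x - y‖ - c * kA k₁ ‖x - y‖ + d * kA k₂ ‖x - y‖) * (if i = j then 1 else 0)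
        + (kB k₀ ‖x - y‖ - c * kB k₁ ‖x - y‖ + d * kB k₂ ‖x - y‖)
          * ((x - y) i : ℝ) * ((x - y) j : ℝ) := by
  set e : Fin 3 → Vec3 := fun j => EuclideanSpace.single j (1 : ℝ) with he
  have h1 : (fun z => partialD j (fun z => helmholtz k₀ z y - c * helmholtz k₁ z y
        + d * helmholtz k₂ z y) z) =ᶠ[𝓝 x] fun z =>
      kA k₀ ‖z - y‖ * (inner ℝ (z - y) (e j) : ℝ) - c * (kA k₁ ‖z - y‖ * (inner ℝ (z - y) (e j) : ℝ))
        + d * (kA k₂ ‖z - y‖ * (inner ℝ (z - y) (e j) : ℝ)) := by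
    filter_upwards [eventually_ne_nhds hxy] with z hz
    have d0 := differentiableAt_helmholtz k₀ hz
    have d1 := differentiableAt_helmholtz k₁ hz
    have d2 := differentiableAt_helmholtz k₂ hz
    rw [partialD, dirDeriv_comb _ c d d0 d1 d2,
      dirDeriv_helmholtz _ _ hz, dirDeriv_helmholtz _ _ hz, dirDeriv_helmholtz _ _ hz]
  obtain ⟨d0, e0⟩ := dirDeriv_kA_inner k₀ (e i) (e j) hxy
  obtain ⟨d1, e1⟩ := dirDeriv_kA_inner k₁ (e i) (e j) hxy
  obtain ⟨d2, e2⟩ := dirDeriv_kA_inner k₂ (e i) (e j) hxy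
  have h2 : inner ℝ (e i) (e j) = if i = j then (1 : ℝ) else 0 := by
    rw [inner_single_eq]
    simp [he, eq_comm]
  rw [hess, Matrix.of_apply, partialD, dirDeriv_congr _ h1,
    dirDeriv_comb _ c d d0 d1 d2, e0, e1, e2, h2, inner_single_eq, inner_single_eq]
  split_ifs <;> push_cast <;> ring

/-- The derivative of `γ_k(x, ·)` in the second variable. -/
theorem dirDeriv_helmholtz_snd (k : ℂ) (n : Vec3) (hxy : x ≠ y) :
    dirDeriv n (fun w => helmholtz k x w) y = -(kA k ‖x - y‖ * (inner ℝ (x - y) n : ℝ)) := by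
  simp_rw [helmholtz_comm k x]
  rw [dirDeriv_helmholtz k n hxy.symm, norm_sub_rev, ← neg_sub x y, inner_neg_left]
  push_cast
  ring

theorem differentiableAt_helmholtz_snd (k : ℂ) (hxy : x ≠ y) :
    DifferentiableAt ℝ (fun w => helmholtz k x w) y := by
  simp_rw [helmholtz_comm k x]
  exact differentiableAt_helmholtz k hxy.symm

/-- The derivative of `wᵀ ∇γ_k(x, ·)` in the second variable. -/
theorem dirDeriv_kA_inner_snd (k : ℂ) (n w : Vec3) (hxy : x ≠ y) :
    DifferentiableAt ℝ (fun z => kA k ‖x - z‖ * (inner ℝ (x - z) w : ℝ)) y ∧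
    dirDeriv n (fun z => kA k ‖x - z‖ * (inner ℝ (x - z) w : ℝ)) y = -hessForm k x y n w := by
  have e : (fun z => kA k ‖x - z‖ * ((inner ℝ (x - z) w : ℝ) : ℂ))
      = fun z => (-1) * (kA k ‖z - x‖ * ((inner ℝ (z - x) w : ℝ) : ℂ)) := by
    ext z
    rw [norm_sub_rev, ← neg_sub z x, inner_neg_left]
    push_cast
    ring
  obtain ⟨hd, hv⟩ := dirDeriv_kA_inner k n w hxy.symm
  rw [e, dirDeriv_const_mul _ _ hd, hv]
  refine ⟨hd.const_mul _, ?_⟩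
  rw [hessForm, norm_sub_rev, ← neg_sub x y, inner_neg_left, inner_neg_left]
  push_cast
  ring

theorem E11_apply (P : Params) (k₁ k₂ : ℂ) (hxy : x ≠ y) (i j : Fin 3) :
    E11 P k₁ k₂ x y i j = (1 / P.mu : ℂ) * helmholtz P.ks x y * (if i = j then 1 else 0)
      + (1 / ((P.rho - P.beta * P.rhoF) * P.omega ^ 2)) *
        ((kA P.ks ‖x - y‖ - (P.kp ^ 2 - k₂ ^ 2) / (k₁ ^ 2 - k₂ ^ 2) * kA k₁ ‖x - y‖
          + (P.kp ^ 2 - k₁ ^ 2) / (k₁ ^ 2 - k₂ ^ 2) * kA k₂ ‖x - y‖) * (if i = j then 1 else 0)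
        + (kB P.ks ‖x - y‖ - (P.kp ^ 2 - k₂ ^ 2) / (k₁ ^ 2 - k₂ ^ 2) * kB k₁ ‖x - y‖
          + (P.kp ^ 2 - k₁ ^ 2) / (k₁ ^ 2 - k₂ ^ 2) * kB k₂ ‖x - y‖)
          * ((x - y) i : ℝ) * ((x - y) j : ℝ)) := by
  rw [E11, Matrix.add_apply, Matrix.smul_apply, Matrix.smul_apply, hess_helmholtz_comb _ _ _ _ _ hxy,
    Matrix.one_apply, smul_eq_mul, smul_eq_mul]

theorem cvec_dotProduct (a c : Vec3) : cvec a ⬝ᵥ cvec c = ((inner ℝ c a : ℝ) : ℂ) := by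
  rw [inner_eq_sum]
  simp [dotProduct, cvec, mul_comm]

theorem dotProduct_mulVec_eq {E : Matrix (Fin 3) (Fin 3) ℂ} {s c A B : ℂ} {z : Vec3}
    (hE : ∀ i j, E i j = s * (if i = j then 1 else 0)
      + c * (A * (if i = j then 1 else 0) + B * (z i : ℝ) * (z j : ℝ))) (n m : Vec3) :
    cvec n ⬝ᵥ (E *ᵥ cvec m) = s * (inner ℝ m n : ℝ)
      + c * (A * (inner ℝ m n : ℝ) + B * (inner ℝ z n : ℝ) * (inner ℝ z m : ℝ)) := by
  simp only [dotProduct, Matrix.mulVec, hE, inner_eq_sum, Fin.sum_univ_three, cvec]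
  simp
  ring

theorem kernel41a_eq (P : Params) (k₁ k₂ : ℂ) (hxy : x ≠ y) :
    kernel41a P k₁ k₂ Ω x y = P.rhoF * P.omega ^ 2 * P.beta *
      ((1 / P.mu : ℂ) * (helmholtz P.ks x y
          * (inner ℝ (outwardNormal Ω y) (outwardNormal Ω x) : ℝ))
      + (1 / ((P.rho - P.beta * P.rhoF) * P.omega ^ 2)) *
        ((kA P.ks ‖x - y‖ - (P.kp ^ 2 - k₂ ^ 2) / (k₁ ^ 2 - k₂ ^ 2) * kA k₁ ‖x - y‖
          + (P.kp ^ 2 - k₁ ^ 2) / (k₁ ^ 2 - k₂ ^ 2) * kA k₂ ‖x - y‖)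
          * (inner ℝ (outwardNormal Ω y) (outwardNormal Ω x) : ℝ)
        + (kB P.ks ‖x - y‖ - (P.kp ^ 2 - k₂ ^ 2) / (k₁ ^ 2 - k₂ ^ 2) * kB k₁ ‖x - y‖
          + (P.kp ^ 2 - k₁ ^ 2) / (k₁ ^ 2 - k₂ ^ 2) * kB k₂ ‖x - y‖)
          * (inner ℝ (x - y) (outwardNormal Ω x) : ℝ)
          * (inner ℝ (x - y) (outwardNormal Ω y) : ℝ))) := by
  rw [kernel41a, dotProduct_mulVec_eq (E11_apply P k₁ k₂ hxy), mul_assoc (1 / P.mu : ℂ)]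

end

/-! ### Closed form of the pressure entry of the hyper-singular kernel -/

section

variable {x y : Vec3} {k : ℂ} {Ω : Set Vec3} {p : Vec3 → ℂ}

theorem normalHess_eq (k : ℂ) (Ω : Set Vec3) (x y : Vec3) :
    normalHess k Ω x y = -hessForm k x y (outwardNormal Ω y) (outwardNormal Ω x) := by
  rw [normalHess, hessForm]
  ring

theorem hessForm_comm (k : ℂ) (x y n w : Vec3) : hessForm k x y n w = hessForm k x y w n := by
  rw [hessForm, hessForm, real_inner_comm]
  ring

theorem sum_mul_hessForm (k : ℂ) (x y n w : Vec3) :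
    ∑ i, (w i : ℂ) * hessForm k x y n (EuclideanSpace.single i 1) = hessForm k x y n w := by
  simp only [hessForm, inner_single_eq, inner_eq_sum n w, inner_eq_sum (x - y) w,
    Fin.sum_univ_three]
  push_cast
  ring

theorem dirDeriv_mul_sub {f g : Vec3 → ℂ} (n : Vec3) (c : ℂ) (hf : DifferentiableAt ℝ f x)
    (hg : DifferentiableAt ℝ g x) :
    dirDeriv n (fun z => c * (f z - g z)) x = c * (dirDeriv n f x - dirDeriv n g x) := by
  rw [← dirDeriv_sub n hf hg]
  exact dirDeriv_const_mul n c (hf.sub hg)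

section

variable (P : Params) (k₁ k₂ : ℂ)

/-- The coefficient of `γ_{k₁} - γ_{k₂}` in `N₄²`. -/
def coeffA : ℂ := (P.rhoF * P.omega ^ 2 * (P.alpha - P.beta) + Complex.I * P.omega * P.beta * P.gam) /
  ((P.lam + 2 * P.mu) * (k₁ ^ 2 - k₂ ^ 2))

/-- The coefficient of `γ_{k₁}` in `N₄²`. -/
def coeffFst : ℂ := coeffA P k₁ k₂ - 1 / (k₁ ^ 2 - k₂ ^ 2) * (P.kp ^ 2 - k₁ ^ 2)

/-- The coefficient of `γ_{k₂}` in `N₄²`. -/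
def coeffSnd : ℂ := 1 / (k₁ ^ 2 - k₂ ^ 2) * (P.kp ^ 2 - k₂ ^ 2) - coeffA P k₁ k₂

/-- Off the diagonal `E₁₁` is a combination of the identity and `z zᵀ`. The symmetry is needed
because the transpose in the double-layer kernel puts `ν_y` on the left of `E₁₁`. -/
theorem E11_form_comm (hxy : x ≠ y) (n m : Vec3) :
    cvec n ⬝ᵥ (E11 P k₁ k₂ x y *ᵥ cvec m) = cvec m ⬝ᵥ (E11 P k₁ k₂ x y *ᵥ cvec n) := by
  rw [dotProduct_mulVec_eq (E11_apply P k₁ k₂ hxy), dotProduct_mulVec_eq (E11_apply P k₁ k₂ hxy),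
    real_inner_comm]
  ring

theorem dirDeriv_E21_snd (hxy : x ≠ y) (n : Vec3) (i : Fin 3) :
    dirDeriv n (fun w => E21 P k₁ k₂ x w i) y
      = (P.alpha - P.beta) / ((P.lam + 2 * P.mu) * (k₁ ^ 2 - k₂ ^ 2))
        * (hessForm k₁ x y n (EuclideanSpace.single i 1)
          - hessForm k₂ x y n (EuclideanSpace.single i 1)) := by
  obtain ⟨d₁, e₁⟩ := dirDeriv_kA_inner_snd k₁ n (EuclideanSpace.single i 1) hxy
  obtain ⟨d₂, e₂⟩ := dirDeriv_kA_inner_snd k₂ n (EuclideanSpace.single i 1) hxy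
  have h : (fun w => E21 P k₁ k₂ x w i) =ᶠ[𝓝 y] fun w =>
      (-((P.alpha - P.beta) / ((P.lam + 2 * P.mu) * (k₁ ^ 2 - k₂ ^ 2))))
        * (kA k₁ ‖x - w‖ * (inner ℝ (x - w) (EuclideanSpace.single i (1 : ℝ)) : ℝ)
          - kA k₂ ‖x - w‖ * (inner ℝ (x - w) (EuclideanSpace.single i (1 : ℝ)) : ℝ)) := by
    filter_upwards [eventually_ne_nhds hxy.symm] with w hw
    rw [E21, Pi.smul_apply, smul_eq_mul, grad_sub_helmholtz k₁ k₂ hw.symm, inner_single_eq]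
  rw [dirDeriv_congr n h, dirDeriv_mul_sub n _ d₁ d₂, e₁, e₂]
  ring

theorem dirDeriv_E22_snd (hxy : x ≠ y) (n : Vec3) :
    dirDeriv n (fun w => E22 P k₁ k₂ x w) y
      = 1 / (k₁ ^ 2 - k₂ ^ 2) * (P.kp ^ 2 - k₁ ^ 2) * (kA k₁ ‖x - y‖ * (inner ℝ (x - y) n : ℝ))
        - 1 / (k₁ ^ 2 - k₂ ^ 2) * (P.kp ^ 2 - k₂ ^ 2)
          * (kA k₂ ‖x - y‖ * (inner ℝ (x - y) n : ℝ)) := by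
  have d₁ := (differentiableAt_helmholtz_snd k₁ hxy).const_mul (P.kp ^ 2 - k₁ ^ 2)
  have d₂ := (differentiableAt_helmholtz_snd k₂ hxy).const_mul (P.kp ^ 2 - k₂ ^ 2)
  unfold E22
  rw [dirDeriv_mul_sub n _ d₁ d₂,
    dirDeriv_const_mul n _ (differentiableAt_helmholtz_snd k₁ hxy),
    dirDeriv_const_mul n _ (differentiableAt_helmholtz_snd k₂ hxy),
    dirDeriv_helmholtz_snd k₁ n hxy, dirDeriv_helmholtz_snd k₂ n hxy]
  ring

theorem doubleLayerKernel_inl_inr (hxy : x ≠ y) (i : Fin 3) :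
    doubleLayerKernel P k₁ k₂ Ω x y (Sum.inl i) (Sum.inr ())
      = -(P.beta * ∑ m, (outwardNormal Ω y m : ℂ) * E11 P k₁ k₂ x y m i)
        + (P.alpha - P.beta) / ((P.lam + 2 * P.mu) * (k₁ ^ 2 - k₂ ^ 2))
        * (hessForm k₁ x y (outwardNormal Ω y) (EuclideanSpace.single i 1)
          - hessForm k₂ x y (outwardNormal Ω y) (EuclideanSpace.single i 1)) := by
  rw [← dirDeriv_E21_snd P k₁ k₂ hxy]
  rfl

theorem doubleLayerKernel_inr_inr (hxy : x ≠ y) :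
    doubleLayerKernel P k₁ k₂ Ω x y (Sum.inr ()) (Sum.inr ())
      = (1 / (k₁ ^ 2 - k₂ ^ 2) * (P.kp ^ 2 - k₁ ^ 2) - P.beta * (Complex.I * P.omega * P.gam /
            ((P.lam + 2 * P.mu) * (k₁ ^ 2 - k₂ ^ 2))))
          * (kA k₁ ‖x - y‖ * (inner ℝ (x - y) (outwardNormal Ω y) : ℝ))
        + (P.beta * (Complex.I * P.omega * P.gam / ((P.lam + 2 * P.mu) * (k₁ ^ 2 - k₂ ^ 2)))
            - 1 / (k₁ ^ 2 - k₂ ^ 2) * (P.kp ^ 2 - k₂ ^ 2))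
          * (kA k₂ ‖x - y‖ * (inner ℝ (x - y) (outwardNormal Ω y) : ℝ)) := by
  have h : doubleLayerKernel P k₁ k₂ Ω x y (Sum.inr ()) (Sum.inr ())
      = -(P.beta * ∑ m, (outwardNormal Ω y m : ℂ) * E12 P k₁ k₂ x y m)
        + dirDeriv (outwardNormal Ω y) (fun w => E22 P k₁ k₂ x w) y := rfl
  have h12 : ∀ m, E12 P k₁ k₂ x y m = Complex.I * P.omega * P.gam /
      ((P.lam + 2 * P.mu) * (k₁ ^ 2 - k₂ ^ 2))
        * (kA k₁ ‖x - y‖ * ((x - y) m : ℝ) - kA k₂ ‖x - y‖ * ((x - y) m : ℝ)) := fun m => by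
    rw [E12, Pi.smul_apply, smul_eq_mul, grad_sub_helmholtz k₁ k₂ hxy]
  rw [h, dirDeriv_E22_snd P k₁ k₂ hxy]
  simp only [h12, inner_eq_sum, Fin.sum_univ_three]
  push_cast
  ring

/-- The block `E₁₁` yields the first kernel of N₄¹. Hessian forms arise from `E₂₁` through `-ρ_f ω²
ν_xᵀ`, which gives the term with `α - β`; from `E₁₂` through `-β ν_yᵀ`, which gives the term with `β
γ`; and from two normal derivatives of `E₂₂`. Sorting them by wave number gives `coeffFst` and
`coeffSnd`. -/
theorem hyperKernel_inr_inr (hxy : x ≠ y) :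
    hyperKernel P k₁ k₂ Ω x y (Sum.inr ()) (Sum.inr ())
      = kernel41a P k₁ k₂ Ω x y + coeffFst P k₁ k₂ * normalHess k₁ Ω x y
        + coeffSnd P k₁ k₂ * normalHess k₂ Ω x y := by
  have h : hyperKernel P k₁ k₂ Ω x y (Sum.inr ()) (Sum.inr ())
      = -(P.rhoF * P.omega ^ 2 * ∑ i, (outwardNormal Ω x i : ℂ)
          * doubleLayerKernel P k₁ k₂ Ω x y (Sum.inl i) (Sum.inr ()))
        + dirDeriv (outwardNormal Ω x)
          (fun z => doubleLayerKernel P k₁ k₂ Ω z y (Sum.inr ()) (Sum.inr ())) x := rfl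
  have hev : (fun z => doubleLayerKernel P k₁ k₂ Ω z y (Sum.inr ()) (Sum.inr ())) =ᶠ[𝓝 x] _ :=
    (eventually_ne_nhds hxy).mono fun z hz => doubleLayerKernel_inr_inr P k₁ k₂ hz
  obtain ⟨d₁, e₁⟩ := dirDeriv_kA_inner k₁ (outwardNormal Ω x) (outwardNormal Ω y) hxy
  obtain ⟨d₂, e₂⟩ := dirDeriv_kA_inner k₂ (outwardNormal Ω x) (outwardNormal Ω y) hxy
  rw [← hessForm, hessForm_comm] at e₁ e₂
  have hE : ∑ i, (outwardNormal Ω x i : ℂ) * ∑ m, (outwardNormal Ω y m : ℂ) * E11 P k₁ k₂ x y m i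
      = cvec (outwardNormal Ω x) ⬝ᵥ (E11 P k₁ k₂ x y *ᵥ cvec (outwardNormal Ω y)) := by
    rw [E11_form_comm P k₁ k₂ hxy]
    simp only [dotProduct, Matrix.mulVec, cvec, Fin.sum_univ_three]
    ring
  have hsum : ∑ i, (outwardNormal Ω x i : ℂ)
        * doubleLayerKernel P k₁ k₂ Ω x y (Sum.inl i) (Sum.inr ())
      = -(P.beta * (cvec (outwardNormal Ω x) ⬝ᵥ (E11 P k₁ k₂ x y *ᵥ cvec (outwardNormal Ω y))))
        + (P.alpha - P.beta) / ((P.lam + 2 * P.mu) * (k₁ ^ 2 - k₂ ^ 2))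
        * (hessForm k₁ x y (outwardNormal Ω y) (outwardNormal Ω x)
          - hessForm k₂ x y (outwardNormal Ω y) (outwardNormal Ω x)) := by
    rw [← hE, ← sum_mul_hessForm k₁, ← sum_mul_hessForm k₂]
    simp only [doubleLayerKernel_inl_inr P k₁ k₂ hxy, Fin.sum_univ_three]
    ring
  rw [h, hsum, dirDeriv_congr _ hev, dirDeriv_add _ (d₁.const_mul _) (d₂.const_mul _),
    dirDeriv_const_mul _ _ d₁, dirDeriv_const_mul _ _ d₂, e₁, e₂, normalHess_eq, normalHess_eq,
    kernel41a, coeffFst, coeffSnd, coeffA]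
  ring

theorem hyperKernel_mulVec_pressureField (hxy : x ≠ y) :
    (hyperKernel P k₁ k₂ Ω x y *ᵥ pressureField p y) (Sum.inr ())
      = kernel41a P k₁ k₂ Ω x y * p y + coeffFst P k₁ k₂ * (normalHess k₁ Ω x y * p y)
        + coeffSnd P k₁ k₂ * (normalHess k₂ Ω x y * p y) := by
  have h : (hyperKernel P k₁ k₂ Ω x y *ᵥ pressureField p y) (Sum.inr ())
      = hyperKernel P k₁ k₂ Ω x y (Sum.inr ()) (Sum.inr ()) * p y := by
    simp [Matrix.mulVec, dotProduct, pressureField]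
  rw [h, hyperKernel_inr_inr P k₁ k₂ hxy]
  ring

end

end

section

/-! ### The operators of the regularised representation -/

variable {Ω : Set Vec3} {p F : Vec3 → ℂ} {x : Vec3} (P : Params) (k₁ k₂ : ℂ)

theorem isWeaklySingular_kernel42a (hΩ : IsSmoothBoundedDomain Ω) :
    IsWeaklySingular (frontier Ω) (kernel42a P k₁ k₂) :=
  (((hΩ.isWeaklySingular_helmholtz k₁).const_mul (coeffA P k₁ k₂)).add
    ((hΩ.isWeaklySingular_helmholtz k₂).const_mul (-coeffA P k₁ k₂))).congr fun x _ y _ _ => by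
      rw [kernel42a, ← coeffA]
      ring

theorem isWeaklySingular_kernel42b (hΩ : IsSmoothBoundedDomain Ω) :
    IsWeaklySingular (frontier Ω) (kernel42b P k₁ k₂) :=
  (((hΩ.isWeaklySingular_helmholtz k₁).const_mul
      (-(1 / (k₁ ^ 2 - k₂ ^ 2)) * (P.kp ^ 2 - k₁ ^ 2))).add
    ((hΩ.isWeaklySingular_helmholtz k₂).const_mul
      (1 / (k₁ ^ 2 - k₂ ^ 2) * (P.kp ^ 2 - k₂ ^ 2)))).congr fun x _ y _ _ => by
      rw [kernel42b]
      ring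

theorem kernel41b_eq (x y : Vec3) : kernel41b P k₁ k₂ Ω x y =
    coeffA P k₁ k₂ * k₁ ^ 2 * (helmholtz k₁ x y * (inner ℝ (outwardNormal Ω y) (outwardNormal Ω x) : ℝ))
      + -(coeffA P k₁ k₂ * k₂ ^ 2)
        * (helmholtz k₂ x y * (inner ℝ (outwardNormal Ω y) (outwardNormal Ω x) : ℝ)) := by
  rw [kernel41b, cvec_dotProduct, coeffA]
  ring

theorem kernel41c_eq (x y : Vec3) : kernel41c P k₁ k₂ Ω x y =
    (-(1 / (k₁ ^ 2 - k₂ ^ 2)) * (P.kp ^ 2 - k₁ ^ 2)) * k₁ ^ 2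
        * (helmholtz k₁ x y * (inner ℝ (outwardNormal Ω y) (outwardNormal Ω x) : ℝ))
      + 1 / (k₁ ^ 2 - k₂ ^ 2) * (P.kp ^ 2 - k₂ ^ 2) * k₂ ^ 2
        * (helmholtz k₂ x y * (inner ℝ (outwardNormal Ω y) (outwardNormal Ω x) : ℝ)) := by
  rw [kernel41c, cvec_dotProduct]
  ring

theorem isWeaklySingular_kernel41b (hΩ : IsSmoothBoundedDomain Ω) :
    IsWeaklySingular (frontier Ω) (kernel41b P k₁ k₂ Ω) :=
  (((hΩ.mul_normal (hΩ.isWeaklySingular_helmholtz k₁)).const_mul _).add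
    ((hΩ.mul_normal (hΩ.isWeaklySingular_helmholtz k₂)).const_mul _)).congr fun x _ y _ _ =>
      kernel41b_eq P k₁ k₂ x y

theorem isWeaklySingular_kernel41c (hΩ : IsSmoothBoundedDomain Ω) :
    IsWeaklySingular (frontier Ω) (kernel41c P k₁ k₂ Ω) :=
  (((hΩ.mul_normal (hΩ.isWeaklySingular_helmholtz k₁)).const_mul _).add
    ((hΩ.mul_normal (hΩ.isWeaklySingular_helmholtz k₂)).const_mul _)).congr fun x _ y _ _ =>
      kernel41c_eq P k₁ k₂ x y

variable {k₁ k₂} in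
-- The weights `1`, `-(k_p² - k₂²)/(k₁² - k₂²)` and `(k_p² - k₁²)/(k₁² - k₂²)` sum to zero, so the
-- static singularities of the three Hessians cancel.
theorem isWeaklySingular_kernel41a (hΩ : IsSmoothBoundedDomain Ω) (hne : k₁ ^ 2 ≠ k₂ ^ 2) :
    IsWeaklySingular (frontier Ω) (kernel41a P k₁ k₂ Ω) := by
  have h0 : k₁ ^ 2 - k₂ ^ 2 ≠ 0 := sub_ne_zero.2 hne
  have hcd : 1 - (P.kp ^ 2 - k₂ ^ 2) / (k₁ ^ 2 - k₂ ^ 2)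
      + (P.kp ^ 2 - k₁ ^ 2) / (k₁ ^ 2 - k₂ ^ 2) = 0 := by
    field_simp
    ring
  exact ((((hΩ.mul_normal (hΩ.isWeaklySingular_helmholtz P.ks)).const_mul _).add
    (((hΩ.mul_normal (hΩ.isWeaklySingular_kA_comb P.ks k₁ k₂ hcd)).add
      (hΩ.isWeaklySingular_kB_comb P.ks k₁ k₂ hcd)).const_mul _)).const_mul _).congr
    fun x _ y _ hxy => kernel41a_eq P k₁ k₂ hxy

namespace IsSmoothBoundedDomain

theorem integrable_smul_of_isWeaklySingular (hΩ : IsSmoothBoundedDomain Ω)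
    {K : Vec3 → Vec3 → ℂ} (hK : IsWeaklySingular (frontier Ω) K) (hx : x ∈ frontier Ω)
    {v : Vec3 → Fin 3 → ℂ} (hv : ∀ i, ContinuousOn (fun y => v y i) (frontier Ω)) :
    Integrable (fun y => K x y • v y) (surfaceMeasure (frontier Ω)) :=
  Integrable.of_eval fun i => hΩ.integrable_mul_of_isWeaklySingular hK hx (hv i)

theorem N42_eq (hΩ : IsSmoothBoundedDomain Ω) (hx : x ∈ frontier Ω)
    (ht : ∀ i, ContinuousOn (fun y => tau1 Ω p y i) (frontier Ω)) :
    N42 P k₁ k₂ Ω (tau1 Ω p) x = fun i =>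
      coeffFst P k₁ k₂ * tauLayer k₁ Ω p x i + coeffSnd P k₁ k₂ * tauLayer k₂ Ω p x i := by
  have hI := fun k i => hΩ.integrable_mul_of_isWeaklySingular
    (hΩ.isWeaklySingular_helmholtz k) hx (ht i)
  have hS : ∀ k i, tauLayer k Ω p x i
      = ∫ y, helmholtz k x y * tau1 Ω p y i ∂surfaceMeasure (frontier Ω) := fun k i => by
    simp only [tauLayer, regSingleLayer, regR_zero, helmholtz_eq]
  have ha := hΩ.integrable_smul_of_isWeaklySingular (isWeaklySingular_kernel42a P k₁ k₂ hΩ) hx ht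
  have hb := hΩ.integrable_smul_of_isWeaklySingular (isWeaklySingular_kernel42b P k₁ k₂ hΩ) hx ht
  ext i
  have he := eval_integral (fun j => (ha.add hb).eval j) i
  simp only [Pi.add_apply] at he
  rw [N42, ← integral_add ha hb, he, hS, hS,
    ← integral_const_mul, ← integral_const_mul,
    ← integral_add ((hI k₁ i).const_mul _) ((hI k₂ i).const_mul _)]
  refine integral_congr_ae (ae_of_all _ fun y => ?_)
  simp only [Pi.smul_apply, smul_eq_mul, kernel42a, kernel42b, coeffFst, coeffSnd, coeffA]
  ring

/-- The identity for `w` is known on the surface alone, and `fderivWithin` is additive there only on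
tangent vectors; hence the detour through an explicit derivative. -/
theorem tau2_comb (hΩ : IsSmoothBoundedDomain Ω) (hx : x ∈ frontier Ω)
    {u v w : Vec3 → Fin 3 → ℂ} {c d : ℂ}
    (hu : ∀ i, DifferentiableWithinAt ℝ (fun ξ => u ξ i) (frontier Ω) x)
    (hv : ∀ i, DifferentiableWithinAt ℝ (fun ξ => v ξ i) (frontier Ω) x)
    (hw : ∀ ξ ∈ frontier Ω, w ξ = fun i => c * u ξ i + d * v ξ i) :
    tau2 Ω w x = c * tau2 Ω u x + d * tau2 Ω v x := by
  have h : ∀ i l, surfaceGrad Ω (fun ξ => w ξ i) x l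
      = c * surfaceGrad Ω (fun ξ => u ξ i) x l + d * surfaceGrad Ω (fun ξ => v ξ i) x l :=
    fun i l => by
    have hd : HasFDerivWithinAt (fun ξ => w ξ i) _ (frontier Ω) x :=
      (((hu i).hasFDerivWithinAt.const_mul c).add ((hv i).hasFDerivWithinAt.const_mul d)).congr
        (fun ξ hξ => by rw [hw ξ hξ]; rfl) (by rw [hw x hx]; rfl)
    rw [surfaceGrad, hΩ.fderivWithin_eq hx hd (hΩ.inner_normal_tangent hx l)]
    rfl
  simp only [tau2_eq_sum, h, Fin.sum_univ_three]
  ring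

theorem differentiableWithinAt_N42 (hΩ : IsSmoothBoundedDomain Ω) (hx : x ∈ frontier Ω)
    (hF : ContDiff ℝ 1 F) (hpF : EqOn p F (frontier Ω)) {a : ℝ} (ha : 0 < a) (ha1 : a ≤ 1)
    (hH : ∀ i, IsHolderNear Ω (fun y => tau1 Ω p y i) x a) :
    DifferentiableWithinAt ℝ (N42 P k₁ k₂ Ω (tau1 Ω p)) (frontier Ω) x := by
  have ht := fun i => hΩ.continuousOn_tau1 hF hpF i
  have hd := fun k i => hΩ.differentiableWithinAt_tauLayer (k := k) hx hF hpF ha ha1 hH i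
  refine DifferentiableWithinAt.congr (f := fun ξ i =>
    coeffFst P k₁ k₂ * tauLayer k₁ Ω p ξ i + coeffSnd P k₁ k₂ * tauLayer k₂ Ω p ξ i)
    (differentiableWithinAt_pi.2 fun i => ((hd k₁ i).const_mul _).add ((hd k₂ i).const_mul _))
    (fun ξ hξ => hΩ.N42_eq P k₁ k₂ hξ ht) (hΩ.N42_eq P k₁ k₂ hx ht)

theorem N41_eq (hΩ : IsSmoothBoundedDomain Ω) (hx : x ∈ frontier Ω)
    (hF : ContinuousOn F (frontier Ω)) (hpF : EqOn p F (frontier Ω)) :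
    N41 P k₁ k₂ Ω p x = (∫ y, kernel41a P k₁ k₂ Ω x y * p y ∂surfaceMeasure (frontier Ω))
      + coeffFst P k₁ k₂ * (k₁ ^ 2 * regSingleLayer k₁ Ω
          (fun y => F y * (inner ℝ (outwardNormal Ω y) (outwardNormal Ω x) : ℝ)) 0 x)
      + coeffSnd P k₁ k₂ * (k₂ ^ 2 * regSingleLayer k₂ Ω
          (fun y => F y * (inner ℝ (outwardNormal Ω y) (outwardNormal Ω x) : ℝ)) 0 x) := by
  have hp : ContinuousOn p (frontier Ω) := hF.congr hpF
  have hI := fun k => hΩ.integrable_mul_of_isWeaklySingular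
    (hΩ.mul_normal (hΩ.isWeaklySingular_helmholtz k)) hx hp
  have hS : ∀ k, regSingleLayer k Ω
      (fun y => F y * (inner ℝ (outwardNormal Ω y) (outwardNormal Ω x) : ℝ)) 0 x
      = ∫ y, helmholtz k x y * (inner ℝ (outwardNormal Ω y) (outwardNormal Ω x) : ℝ) * p y
        ∂surfaceMeasure (frontier Ω) := fun k => by
    refine integral_congr_ae ?_
    filter_upwards [ae_mem_frontier Ω] with y hy
    rw [regR_zero, helmholtz_eq, hpF hy]
    ring
  rw [N41, add_assoc, add_assoc, ← integral_add
    (hΩ.integrable_mul_of_isWeaklySingular (isWeaklySingular_kernel41b P k₁ k₂ hΩ) hx hp)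
    (hΩ.integrable_mul_of_isWeaklySingular (isWeaklySingular_kernel41c P k₁ k₂ hΩ) hx hp), hS, hS,
    ← mul_assoc, ← mul_assoc, ← integral_const_mul, ← integral_const_mul,
    ← integral_add ((hI k₁).const_mul _) ((hI k₂).const_mul _)]
  congr 1
  refine integral_congr_ae (ae_of_all _ fun y => ?_)
  simp only [kernel41b_eq, kernel41c_eq, coeffFst, coeffSnd]
  ring

variable {k₁ k₂} in
-- Finite parts are linear. The `E₁₁` part is an absolutely convergent integral, Maue's formula
-- applies to each of the two wave numbers, and the coefficients regroup into the two operators of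
-- the theorem.
theorem isFinitePart_hyperKernel (hΩ : IsSmoothBoundedDomain Ω) (hne : k₁ ^ 2 ≠ k₂ ^ 2)
    (hx : x ∈ frontier Ω)
    (hF : ContDiff ℝ 1 F) (hpF : EqOn p F (frontier Ω)) {M C a : ℝ} (ha : 0 < a) (ha1 : a ≤ 1)
    (hC : 0 ≤ C) (hM : ∀ ξ ∈ frontier Ω, ∀ y ∈ frontier Ω, ‖ξ - y‖ ≤ M)
    (hH : ∀ y w, ‖y - w‖ ≤ M → ‖fderiv ℝ F y - fderiv ℝ F w‖ ≤ C * ‖y - w‖ ^ a) :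
    IsFinitePart (frontier Ω) x
      (fun y => (hyperKernel P k₁ k₂ Ω x y *ᵥ pressureField p y) (Sum.inr ()))
      (N41 P k₁ k₂ Ω p x + tau2 Ω (N42 P k₁ k₂ Ω (tau1 Ω p)) x) := by
  obtain ⟨A, hA, hμ⟩ := hΩ.exists_surfaceMeasure_closedBall_le
  have hFc := hF.continuous.continuousOn (s := frontier Ω)
  have hae := ae_ne_of_growth hμ x
  have hHt := hΩ.isHolderNear_tau1 hx hF hpF ha ha1 hC hM hH
  have hd := fun k i => hΩ.differentiableWithinAt_tauLayer (k := k) hx hF hpF ha ha1 hHt i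
  have hn := fun k => hΩ.isFinitePart_normalHess (k := k) hx hF hpF ha ha1 hC hM hH
  have h := ((isFinitePart_of_integrable (hΩ.integrable_mul_of_isWeaklySingular
    (isWeaklySingular_kernel41a P hΩ hne) hx (hFc.congr hpF)) hae).add
    ((hn k₁).const_mul (coeffFst P k₁ k₂))).add ((hn k₂).const_mul (coeffSnd P k₁ k₂))
  convert h.congr_ae (hae.mono fun y hy => ?_) using 1
  · rw [hΩ.N41_eq P k₁ k₂ hx hFc hpF, hΩ.tau2_comb hx (hd k₁) (hd k₂) fun ξ hξ =>
      hΩ.N42_eq P k₁ k₂ hξ fun i => hΩ.continuousOn_tau1 hF hpF i]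
    ring
  · exact (hyperKernel_mulVec_pressureField P k₁ k₂ hy.symm).symm

end IsSmoothBoundedDomain

end

end Poroelastic

end

/-! ### The regularised representation of N₄ -/

theorem mainTheorem8 (P : Poroelastic.Params) (hmu : 0 < P.mu)
    (hlam : 0 < 3 * P.lam + 2 * P.mu) (k₁ k₂ : ℂ) (hk : P.IsWaveNumbers k₁ k₂)
    (hne : k₁ ^ 2 ≠ k₂ ^ 2) (Ω : Set Poroelastic.Vec3)
    (hΩ : Poroelastic.IsSmoothBoundedDomain Ω) :
    -- the kernels of the two operators on the right are weakly singular
    (Poroelastic.IsWeaklySingular (frontier Ω) (Poroelastic.kernel41a P k₁ k₂ Ω) ∧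
      Poroelastic.IsWeaklySingular (frontier Ω) (Poroelastic.kernel41b P k₁ k₂ Ω) ∧
      Poroelastic.IsWeaklySingular (frontier Ω) (Poroelastic.kernel41c P k₁ k₂ Ω) ∧
      Poroelastic.IsWeaklySingular (frontier Ω) (Poroelastic.kernel42a P k₁ k₂) ∧
      Poroelastic.IsWeaklySingular (frontier Ω) (Poroelastic.kernel42b P k₁ k₂)) ∧
    ∀ (a : NNReal), 0 < a → ∀ p : Poroelastic.Vec3 → ℂ,
      Poroelastic.IsC1Holder a (frontier Ω) p → ∀ x ∈ frontier Ω,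
        -- the integrals on the right exist
        (MeasureTheory.Integrable (fun y => Poroelastic.kernel41a P k₁ k₂ Ω x y * p y)
            (Poroelastic.surfaceMeasure (frontier Ω)) ∧
          MeasureTheory.Integrable (fun y => Poroelastic.kernel41b P k₁ k₂ Ω x y * p y)
            (Poroelastic.surfaceMeasure (frontier Ω)) ∧
          MeasureTheory.Integrable (fun y => Poroelastic.kernel41c P k₁ k₂ Ω x y * p y)
            (Poroelastic.surfaceMeasure (frontier Ω)) ∧
          MeasureTheory.Integrable
            (fun y => Poroelastic.kernel42a P k₁ k₂ x y • Poroelastic.tau1 Ω p y)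
            (Poroelastic.surfaceMeasure (frontier Ω)) ∧
          MeasureTheory.Integrable
            (fun y => Poroelastic.kernel42b P k₁ k₂ x y • Poroelastic.tau1 Ω p y)
            (Poroelastic.surfaceMeasure (frontier Ω))) ∧
        -- the tangential derivatives on the right exist
        DifferentiableWithinAt ℝ p (frontier Ω) x ∧
        DifferentiableWithinAt ℝ (Poroelastic.N42 P k₁ k₂ Ω (Poroelastic.tau1 Ω p))
          (frontier Ω) x ∧
        -- the finite part integral that defines the left side exists
        (∃ l : ℂ, Poroelastic.IsFinitePart (frontier Ω) x
          (fun y => (Poroelastic.hyperKernel P k₁ k₂ Ω x y).mulVec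
            (Poroelastic.pressureField p y) (Sum.inr ())) l) ∧
        -- the identity
        Poroelastic.N4 P k₁ k₂ Ω p x =
          Poroelastic.N41 P k₁ k₂ Ω p x +
            Poroelastic.tau2 Ω (Poroelastic.N42 P k₁ k₂ Ω (Poroelastic.tau1 Ω p)) x := by
  refine ⟨⟨Poroelastic.isWeaklySingular_kernel41a P hΩ hne,
    Poroelastic.isWeaklySingular_kernel41b P k₁ k₂ hΩ,
    Poroelastic.isWeaklySingular_kernel41c P k₁ k₂ hΩ,
    Poroelastic.isWeaklySingular_kernel42a P k₁ k₂ hΩ,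
    Poroelastic.isWeaklySingular_kernel42b P k₁ k₂ hΩ⟩, fun a ha p hp x hx => ?_⟩
  obtain ⟨M, hM0, hM⟩ := hΩ.exists_norm_sub_le
  obtain ⟨F, hF, hpF, b, C, hb, hb1, hC, hH⟩ := hp.exists_extension ha hM0
  have hpc : ContinuousOn p (frontier Ω) := hF.continuous.continuousOn.congr hpF
  have ht := fun i => hΩ.continuousOn_tau1 hF hpF i
  have hfp := hΩ.isFinitePart_hyperKernel P hne hx hF hpF hb hb1 hC hM hH
  exact ⟨⟨hΩ.integrable_mul_of_isWeaklySingular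
        (Poroelastic.isWeaklySingular_kernel41a P hΩ hne) hx hpc,
      hΩ.integrable_mul_of_isWeaklySingular
        (Poroelastic.isWeaklySingular_kernel41b P k₁ k₂ hΩ) hx hpc,
      hΩ.integrable_mul_of_isWeaklySingular
        (Poroelastic.isWeaklySingular_kernel41c P k₁ k₂ hΩ) hx hpc,
      hΩ.integrable_smul_of_isWeaklySingular
        (Poroelastic.isWeaklySingular_kernel42a P k₁ k₂ hΩ) hx ht,
      hΩ.integrable_smul_of_isWeaklySingular
        (Poroelastic.isWeaklySingular_kernel42b P k₁ k₂ hΩ) hx ht⟩,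
    (Poroelastic.IsSmoothBoundedDomain.hasFDerivWithinAt_of_eqOn hF hpF hx).differentiableWithinAt,
    hΩ.differentiableWithinAt_N42 P k₁ k₂ hx hF hpF hb hb1
      (hΩ.isHolderNear_tau1 hx hF hpF hb hb1 hC hM hH),
    ⟨_, hfp⟩, hfp.finitePart_eq⟩
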